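/- **Setting.** Let $n\ge 2$, $N\ge 1$, and let $\Omega\subset\mathbb R^n$ be a Borel set; $|E|$ is the Lebesgue measure of $E$, and $B(x,r)$ is an open ball. $W^{1,2}(\mathbb R^n)$ is the set of functions of $L^2_{loc}(\mathbb R^n)$ whose distributional gradient lies in $L^2(\mathbb R^n)$. Let $\mathcal F$ be the set of pairs $(\mathbf u,\mathbf W)$ where $\mathbf W=(W_1,\dots,W_N)$ is an $N$-tuple of pairwise disjoint Borel subsets of $\Omega$, and $\mathbf u=(u_1,\dots,u_N)$ is an $N$-tuple of real-valued functions $u_i\in W^{1,2}(\mathbb R^n)$ with $u_i=0$ a.e. on $\mathbb R^n\setminus W_i$. Given functions $f_i,g_i$ on $\Omega$ and a real-valued function $F$ of $N$-tuples of disjoint Borel subsets of $\Omega$, set $$J(\mathbf u,\mathbf W)=\sum_{i=1}^N\int|\nabla u_i|^2+\sum_{i=1}^N\int_\Omega(u_i^2f_i-u_ig_i)+F(\mathbf W)$$ for the pairs of $\mathcal F$ for which the integrals converge. Let $(\mathbf u,\mathbf W)$ be a minimizer of $J$ among these pairs. Suppose that $f_1,g_1\in L^\infty(\Omega)$ and that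 $W_1$ is a good region: for some $\lambda>0$ and $\varepsilon>0$, for each Borel set $A\subset W_1$ with $0<|A|\le\varepsilon$ there are disjoint Borel sets $A_j\subset A$, $2\le j\le N$, such that $$F(W_1\setminus A,\,W_2\cup A_2,\dots,W_N\cup A_N)\le F(\mathbf W)-\lambda|A|.\qquad(13.1)$$ Set $\Omega_1=\{x\in\Omega:\ u_1(x)>0\}$ and $u_{1,+}=\max(0,u_1)$. **Theorem 13.1.** Let $x\in\mathbb R^n$ and $r>0$ be such that $\mathbf u$ is continuous on $B(x,r)$, $r\le\min(1,\varepsilon^{1/n})$, and $B(x,r/2)$ meets $\partial\Omega_1$. Then $$\frac{1}{|B(x,r)|}\int_{B(x,r)}u_{1,+}^2\ge c_1r^2\quad\text{and}\quad|\Omega_1\cap B(x,r)|\ge c_2r^n,$$ where $c_1,c_2>0$ depend only on $n$, $\lambda$, upper bounds for $\|f_1\|_\infty$ and $\|g_1\|_\infty$, and an upper bound for $\frac{1}{|B(x,r)|}\int_{B(x,r)}|\nabla u_{1,+}|^2$. **Theorem 13.2.** Let $x,r$ be as in Theorem 13.1 and let $C_0>0$. Suppose that either $u_1$ is $C_0$-Lipschitz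 on $B(x,r)$ and $u_1=0$ everywhere on $B(x,r)\setminus\Omega$, or $|B(x,r)\setminus\Omega_1|\ge C_0^{-1}r^n$. Then $\frac{1}{|B(x,r)|}\int_{B(x,r)}|\nabla u_{1,+}|^2\ge c_3$, where $c_3>0$ depends only on $n$, $\lambda$, upper bounds for $\|f_1\|_\infty$ and $\|g_1\|_\infty$, and $C_0$. **Theorem 13.3.** Suppose that $u_1$ is continuous on $\mathbb R^n$, and set $\delta(x)=\operatorname{dist}(x,\mathbb R^n\setminus\Omega_1)$ (which is $+\infty$ when $\Omega_1=\mathbb R^n$). For each $C_0\ge1$ there is $c_5>0$, which depends only on $n$, $\lambda$, upper bounds for $\|f_1\|_\infty$ and $\|g_1\|_\infty$, and $C_0$, such that $u_1(x)\ge c_5\min(\delta(x),\varepsilon^{1/n},1)$ whenever $x\in\Omega_1$ and $u_1$ is $C_0$-Lipschitz on $B(x,\delta(x)/2)$. **Theorem 13.4.** Suppose in addition that all the $f_i$ and $g_i$ lie in $L^\infty(\Omega)$ and that $F$ is Lipschitz: $|F(\mathbf W')-F(\mathbf W'')|\le L\sum_{i}|W_i'\,\Delta\,W_i''|$ for all $N$-tuples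 $\mathbf W',\mathbf W''$ of disjoint Borel subsets of $\Omega$. For each $C_0\ge1$ there are $c_6>0$, which depends only on $n$, $\lambda$, upper bounds for the $\|f_i\|_\infty$ and $\|g_i\|_\infty$, $L$ and $C_0$, and $r_0>0$, which depends on the same constants and on $\varepsilon$, such that if $0\le r\le r_0$, $B(x,r)\subset\Omega$, each $u_i$ is $C_0$-Lipschitz on $B(x,r)$, and $B(x,r/2)$ meets $\partial\Omega_1$, then $|\{y\in B(x,r):\ u_1(y)\le0\}|\ge c_6r^n$. -/

import Mathlib

open MeasureTheory
open scoped ENNReal NNReal ContDiff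

noncomputable section

/-- `G` is a distributional gradient of `u` on `ℝⁿ`: for every test function `φ` and every
direction `v`, one has `∫ u ∂ᵥφ = - ∫ φ ⟨G, v⟩`. -/
def HasWeakGrad {n : ℕ} (u : EuclideanSpace ℝ (Fin n) → ℝ)
    (G : EuclideanSpace ℝ (Fin n) → EuclideanSpace ℝ (Fin n)) : Prop :=
  LocallyIntegrable u volume ∧ LocallyIntegrable G volume ∧
    ∀ φ : EuclideanSpace ℝ (Fin n) → ℝ, ContDiff ℝ ∞ φ → HasCompactSupport φ →
      ∀ v : EuclideanSpace ℝ (Fin n),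
        ∫ x, u x * fderiv ℝ φ x v = - ∫ x, φ x * inner ℝ (G x) v

/-- The space `W^{1,2}(ℝⁿ)` of functions that lie in `L²_loc` and whose distributional gradient
lies in `L²`. -/
def MemW12 {n : ℕ} (u : EuclideanSpace ℝ (Fin n) → ℝ) : Prop :=
  (∀ K : Set (EuclideanSpace ℝ (Fin n)), IsCompact K → MemLp u 2 (volume.restrict K)) ∧
    ∃ G : EuclideanSpace ℝ (Fin n) → EuclideanSpace ℝ (Fin n),
      MemLp G 2 volume ∧ HasWeakGrad u G

open Classical in
/-- The distributional gradient of a function of `W^{1,2}(ℝⁿ)`, which is well defined up to a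
null set (and `0`, by convention, for the other functions). -/
def weakGrad {n : ℕ} (u : EuclideanSpace ℝ (Fin n) → ℝ) :
    EuclideanSpace ℝ (Fin n) → EuclideanSpace ℝ (Fin n) :=
  if h : MemW12 u then h.2.choose else 0

/-- Distributional gradients are unique up to a null set. -/
theorem HasWeakGrad.ae_eq {n : ℕ} {u : EuclideanSpace ℝ (Fin n) → ℝ}
    {G H : EuclideanSpace ℝ (Fin n) → EuclideanSpace ℝ (Fin n)}
    (hG : HasWeakGrad u G) (hH : HasWeakGrad u H) : G =ᵐ[volume] H := by
  have key : ∀ K : EuclideanSpace ℝ (Fin n) → EuclideanSpace ℝ (Fin n), HasWeakGrad u K →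
      ∀ φ : EuclideanSpace ℝ (Fin n) → ℝ, ContDiff ℝ ∞ φ → HasCompactSupport φ →
      ∀ v, inner ℝ v (∫ x, φ x • K x) = - ∫ x, u x * fderiv ℝ φ x v := by
    intro K hK φ hφ hc v
    rw [hK.2.2 φ hφ hc v, neg_neg,
      ← integral_inner (hK.2.1.integrable_smul_left_of_hasCompactSupport hφ.continuous hc) v]
    refine integral_congr_ae (Filter.Eventually.of_forall fun x => ?_)
    simp only [inner_smul_right, real_inner_comm]
  refine ae_eq_of_integral_contDiff_smul_eq hG.2.1 hH.2.1 fun φ hφ hc => ?_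
  refine ext_inner_left ℝ fun v => ?_
  rw [key G hG φ hφ hc v, key H hH φ hφ hc v]

/-- The positive part `u₊ = max(0, u)`. -/
def posPartFun {n : ℕ} (u : EuclideanSpace ℝ (Fin n) → ℝ) : EuclideanSpace ℝ (Fin n) → ℝ :=
  fun x => max 0 (u x)

/-- The data of the free boundary problem: a Borel set `Ω ⊆ ℝⁿ`, the functions `f_i` and `g_i`
(only their values on `Ω` are used), and the volume term `F` (only its values on `N`-tuples of
pairwise disjoint Borel subsets of `Ω` are used). -/
structure FBProblem (n N : ℕ) where
  /-- the domain -/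
  Ω : Set (EuclideanSpace ℝ (Fin n))
  measurableSet_Ω : MeasurableSet Ω
  /-- the coefficients of the quadratic terms -/
  f : Fin N → EuclideanSpace ℝ (Fin n) → ℝ
  /-- the coefficients of the linear terms -/
  g : Fin N → EuclideanSpace ℝ (Fin n) → ℝ
  /-- the volume term -/
  F : (Fin N → Set (EuclideanSpace ℝ (Fin n))) → ℝ

namespace FBProblem

variable {n N : ℕ} (P : FBProblem n N)

/-- The `N`-tuples of pairwise disjoint Borel subsets of `Ω`. -/
def IsTuple (W : Fin N → Set (EuclideanSpace ℝ (Fin n))) : Prop :=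
  (∀ i, MeasurableSet (W i)) ∧ (∀ i, W i ⊆ P.Ω) ∧ Pairwise fun i j => Disjoint (W i) (W j)

/-- The class `𝓕` of admissible pairs. -/
def Admissible (u : Fin N → EuclideanSpace ℝ (Fin n) → ℝ)
    (W : Fin N → Set (EuclideanSpace ℝ (Fin n))) : Prop :=
  P.IsTuple W ∧ ∀ i, MemW12 (u i) ∧ ∀ᵐ x ∂volume, x ∉ W i → u i x = 0

/-- The energy `E(u) = ∑ ∫ |∇u_i|²`. -/
def energy (u : Fin N → EuclideanSpace ℝ (Fin n) → ℝ) : ℝ :=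
  ∑ i, ∫ x, ‖weakGrad (u i) x‖ ^ 2

/-- The integrals that define `M(u)` converge. -/
def MConverges (u : Fin N → EuclideanSpace ℝ (Fin n) → ℝ) : Prop :=
  ∀ i, IntegrableOn (fun x => u i x ^ 2 * P.f i x - u i x * P.g i x) P.Ω volume

/-- `M(u) = ∑ ∫ (u_i² f_i - u_i g_i)`. The `u_i` vanish a.e. outside of `Ω`, so it is enough to
integrate on `Ω`. -/
def M (u : Fin N → EuclideanSpace ℝ (Fin n) → ℝ) : ℝ :=
  ∑ i, ∫ x in P.Ω, (u i x ^ 2 * P.f i x - u i x * P.g i x)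

/-- The functional `J(u, W) = E(u) + M(u) + F(W)`. -/
def J (u : Fin N → EuclideanSpace ℝ (Fin n) → ℝ)
    (W : Fin N → Set (EuclideanSpace ℝ (Fin n))) : ℝ :=
  energy u + P.M u + P.F W

/-- `(u, W)` minimizes `J` in the class `𝓕`. The functional is only considered where the integrals
of `M` converge, which is automatic when `|Ω| < ∞`, the `f_i` are bounded and the `g_i` lie
in `L²(Ω)`. -/
def IsMinimizer (u : Fin N → EuclideanSpace ℝ (Fin n) → ℝ)
    (W : Fin N → Set (EuclideanSpace ℝ (Fin n))) : Prop :=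
  P.Admissible u W ∧ P.MConverges u ∧
    ∀ u' W', P.Admissible u' W' → P.MConverges u' → P.J u W ≤ P.J u' W'

/-- `h` lies in `L^∞(Ω)`, with norm at most `K`. -/
def BoundedOn (h : EuclideanSpace ℝ (Fin n) → ℝ) (K : ℝ) : Prop :=
  AEStronglyMeasurable h (volume.restrict P.Ω) ∧ ∀ᵐ x ∂volume.restrict P.Ω, |h x| ≤ K

/-- The nondegeneracy condition on the region `W i`, with constants `lam` and `ε`: every Borel set
`A ⊆ W i` with `0 < |A| ≤ ε` contains disjoint Borel sets `A' j`, `j ≠ i`, such that removing `A`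
from `W i` and adding `A' j` to `W j` for `j ≠ i` makes `F` smaller by at least `lam * |A|`. -/
def IsGoodIndex (W : Fin N → Set (EuclideanSpace ℝ (Fin n))) (i : Fin N) (lam ε : ℝ) : Prop :=
  ∀ A : Set (EuclideanSpace ℝ (Fin n)), MeasurableSet A → A ⊆ W i →
    0 < volume A → volume A ≤ ENNReal.ofReal ε →
    ∃ A' : Fin N → Set (EuclideanSpace ℝ (Fin n)),
      (∀ j, j ≠ i → MeasurableSet (A' j) ∧ A' j ⊆ A) ∧
      (∀ j k, j ≠ i → k ≠ i → j ≠ k → Disjoint (A' j) (A' k)) ∧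
      P.F (fun j => if j = i then W i \ A else W j ∪ A' j) ≤ P.F W - lam * volume.real A

/-- The volume term is Lipschitz with constant `L`:
`|F(W) - F(W')| ≤ L ∑ |W_i Δ W'_i|`. -/
def FLipschitz (L : ℝ≥0) : Prop :=
  ∀ W W', P.IsTuple W → P.IsTuple W' →
    ENNReal.ofReal |P.F W - P.F W'| ≤ L * ∑ i, volume (symmDiff (W i) (W' i))

/-- The set `{x ∈ Ω ; v(x) > 0}`. -/
def posSet (v : EuclideanSpace ℝ (Fin n) → ℝ) : Set (EuclideanSpace ℝ (Fin n)) :=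
  {x | x ∈ P.Ω ∧ 0 < v x}

end FBProblem

end

/-! Write u for the component of the good phase and λ for the gain in the good-region condition. Two
comparison arguments carry everything.

Shrinking the phase. Replace u by u - ξ²u₊, with ξ a cutoff equal to 1 on a ball. The competitor no
longer needs the set {u > 0} in that ball, so this set can be given away, which lowers the volume
term by λ times its measure. Minimality then bounds both |{u > 0}| and ∫|∇u₊|² on the ball by
integrals of u₊² and u₊ on a larger ball (`IsGoodMinimizer.caccioppoli`). A function supported on a
set of small measure has small L² norm compared with its gradient (`HasWeakGrad.faberKrahn`). So
once ∫u₊² and |{u > 0}| are small at scale d, they are small, in the scale invariant sense, at scale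
d/2 (`IsGoodMinimizer.halving`). Iterating as De Giorgi does, u₊ would vanish near the centre. Hence
∫u₊² ≥ cρ^(n+2) on every small enough ball B(z, ρ) on which u is continuous and whose centre
satisfies u(z) > 0 (`exists_nondegeneracy`). Such points exist near the free boundary, which gives
the lower bound on the average of u₊². If {u > 0} had tiny density, the gradient bound, Poincaré and
Faber–Krahn would make ∫u₊² too small (`exists_density_bounds`). If the gradient were tiny, Poincaré
would do the same, because u₊ is small on a substantial set: a small ball around a boundary point in
the Lipschitz case, the complement of {u > 0} in the other (`exists_gradient_bound`).

Enlarging u. Replace u by u + tΦ, where Φ ≥ 0 is a radial bump in B(y, ρ). The first order change of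
the Dirichlet energy is -2t∫uΔΦ. The bump is built so that ΔΦ ≥ c/ρ² on B(y, ρ/2) away from B(y,
sρ), and is negative only inside B(y, sρ), by at most A/ρ² with As^(n+1) as small as desired
(`exists_barrier`). If u ≤ ηρ + C₀|x - y| and {u ≤ 0} is small, the contributions of B(y, sρ) and {u
≤ 0} are negligible. Nondegeneracy gives ∫u₊ ≥ c'ρ^(n+1), so the energy would drop by an amount of
order ρ^n, against lower order terms (`exists_forall_not_almostMinimal`). For the distance estimate,
y is a point where u is too small and B(y, ρ) lies in {u > 0}, so the sets W need not change
(`exists_le_of_infEDist`). For the density of {u ≤ 0}, y is a free boundary point and the whole ball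
is given to the good phase. The other components vanish at y, hence are at most of order ρ, and
cutting them off together with changing F costs at most a multiple of |{u ≤ 0}|
(`IsMinimizer.cost_le_of_ball`). If that measure is too small, the same contradiction occurs
(`exists_density_compl`). -/

open MeasureTheory Filter Metric
open scoped ENNReal NNReal ContDiff Convolution Topology

/-! ### Mollification in L² and its compatibility with weak gradients. -/

section Mollification

variable {n : ℕ} {F : Type*} [NormedAddCommGroup F] [NormedSpace ℝ F]

/-- A sequence of bump functions shrinking to the origin. -/
noncomputable def shrinkingBump (n k : ℕ) : ContDiffBump (0 : EuclideanSpace ℝ (Fin n)) where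
  rIn := 1 / (k + 1)
  rOut := 2 / (k + 1)
  rIn_pos := by positivity
  rIn_lt_rOut := by gcongr; norm_num

/-- The standard mollification of `g`, at scale `2 / (k + 1)`. -/
noncomputable def mollify (k : ℕ) (g : EuclideanSpace ℝ (Fin n) → F) :
    EuclideanSpace ℝ (Fin n) → F :=
  ((shrinkingBump n k).normed volume) ⋆[ContinuousLinearMap.lsmul ℝ ℝ, volume] g

theorem tendsto_shrinkingBump_rOut (n : ℕ) :
    Tendsto (fun k => (shrinkingBump n k).rOut) atTop (𝓝 0) := by
  have := (tendsto_one_div_add_atTop_nhds_zero_nat (𝕜 := ℝ)).const_mul 2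
  simp only [mul_zero] at this
  refine this.congr fun k => ?_
  simp only [shrinkingBump]
  ring

theorem ae_tendsto_mollify [CompleteSpace F] {g : EuclideanSpace ℝ (Fin n) → F}
    (hg : LocallyIntegrable g volume) :
    ∀ᵐ x ∂volume, Tendsto (fun k => mollify k g x) atTop (𝓝 (g x)) :=
  -- The outer radius is exactly twice the inner one; this fixed ratio gives convergence at almost
  -- every point for merely locally integrable functions.
  ContDiffBump.ae_convolution_tendsto_right_of_locallyIntegrable (K := 2)
    (tendsto_shrinkingBump_rOut n)
    (Eventually.of_forall fun k => by simp only [shrinkingBump]; apply le_of_eq; ring) hg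

theorem contDiff_mollify {g : EuclideanSpace ℝ (Fin n) → F} (k : ℕ)
    (hg : LocallyIntegrable g volume) : ContDiff ℝ ∞ (mollify k g) :=
  HasCompactSupport.contDiff_convolution_left _ (shrinkingBump n k).hasCompactSupport_normed
    (ContDiffBump.contDiff_normed _) hg

theorem eLpNorm_two_sq {α G : Type*} [MeasurableSpace α] {μ : Measure α} [ENorm G] (f : α → G) :
    eLpNorm f 2 μ ^ 2 = ∫⁻ x, ‖f x‖ₑ ^ 2 ∂μ := by
  have := eLpNorm_nnreal_pow_eq_lintegral (μ := μ) (f := f) (p := 2) (by norm_num)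
  simpa [ENNReal.rpow_ofNat] using this

theorem sq_lintegral_mul_le {α : Type*} [MeasurableSpace α] {μ : Measure α} {f g : α → ℝ≥0∞}
    (hf : AEMeasurable f μ) (hg : AEMeasurable g μ) :
    (∫⁻ x, f x * g x ∂μ) ^ 2 ≤ (∫⁻ x, f x ^ 2 ∂μ) * ∫⁻ x, g x ^ 2 ∂μ := by
  have h := ENNReal.lintegral_mul_le_Lp_mul_Lq μ Real.HolderConjugate.two_two hf hg
  calc _ ≤ _ := pow_le_pow_left' h 2
    _ = _ := by
      rw [mul_pow, ← ENNReal.rpow_ofNat, ← ENNReal.rpow_ofNat, ← ENNReal.rpow_mul,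
        ← ENNReal.rpow_mul]
      simp

/-- Cauchy–Schwarz for √w and √w·a. When w has integral 1 this is Jensen's inequality for the
square, and it is used in that form. -/
theorem sq_lintegral_mul_le_of_weight {α : Type*} [MeasurableSpace α] {μ : Measure α}
    {w a : α → ℝ≥0∞} (hw : AEMeasurable w μ) (ha : AEMeasurable a μ) :
    (∫⁻ x, w x * a x ∂μ) ^ 2 ≤ (∫⁻ x, w x ∂μ) * ∫⁻ x, w x * a x ^ 2 ∂μ := by
  have key : ∀ t : ℝ≥0∞, (t ^ (1 / 2 : ℝ)) ^ 2 = t := fun t => by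
    rw [← ENNReal.rpow_ofNat, ← ENNReal.rpow_mul]; simp
  have h := sq_lintegral_mul_le (μ := μ) (f := fun x => w x ^ (1 / 2 : ℝ))
    (g := fun x => w x ^ (1 / 2 : ℝ) * a x) (hw.pow_const _) ((hw.pow_const _).mul ha)
  simp only [← mul_assoc, ← sq, key, mul_pow] at h
  exact h

/-- A mollification is an average of translates with a probability weight: use Jensen pointwise,
then Tonelli and translation invariance. The constant 1 matters for the Fatou argument below. -/
theorem lintegral_mollify_sq_le [CompleteSpace F] {g : EuclideanSpace ℝ (Fin n) → F} (k : ℕ)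
    (hg : AEStronglyMeasurable g volume) :
    ∫⁻ x, ‖mollify k g x‖ₑ ^ 2 ≤ ∫⁻ x, ‖g x‖ₑ ^ 2 := by
  set ρ := (shrinkingBump n k).normed (volume : Measure (EuclideanSpace ℝ (Fin n)))
  have hρm : Measurable fun t => ‖ρ t‖ₑ := (ContDiffBump.continuous_normed _).measurable.enorm
  have hρ1 : ∫⁻ t, ‖ρ t‖ₑ = 1 := by
    have h1 := (shrinkingBump n k).integral_normed (μ := volume)
    have h2 := ofReal_integral_eq_lintegral_ofReal
      ((shrinkingBump n k).integrable_normed (μ := volume))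
      (Eventually.of_forall fun x => (shrinkingBump n k).nonneg_normed x)
    rw [h1, ENNReal.ofReal_one] at h2
    rw [h2]
    refine lintegral_congr fun t => ?_
    exact Real.enorm_eq_ofReal ((shrinkingBump n k).nonneg_normed t)
  have hsub : ∀ x : EuclideanSpace ℝ (Fin n), AEMeasurable (fun t => ‖g (x - t)‖ₑ) volume :=
    fun x => (hg.comp_quasiMeasurePreserving
      (quasiMeasurePreserving_sub_left volume x)).enorm
  have hpt : ∀ x, ‖mollify k g x‖ₑ ^ 2 ≤ ∫⁻ t, ‖ρ t‖ₑ * ‖g (x - t)‖ₑ ^ 2 := by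
    intro x
    have h1 : ‖mollify k g x‖ₑ ≤ ∫⁻ t, ‖ρ t‖ₑ * ‖g (x - t)‖ₑ := by
      refine (enorm_integral_le_lintegral_enorm _).trans (le_of_eq ?_)
      refine lintegral_congr fun t => ?_
      simp [enorm_smul, ρ]
    calc _ ≤ _ := pow_le_pow_left' h1 2
      _ ≤ _ := sq_lintegral_mul_le_of_weight hρm.aemeasurable (hsub x)
      _ = _ := by rw [hρ1, one_mul]
  calc ∫⁻ x, ‖mollify k g x‖ₑ ^ 2 ≤ ∫⁻ x, ∫⁻ t, ‖ρ t‖ₑ * ‖g (x - t)‖ₑ ^ 2 := lintegral_mono hpt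
    _ = ∫⁻ t, ∫⁻ x, ‖ρ t‖ₑ * ‖g (x - t)‖ₑ ^ 2 := by
      rw [lintegral_lintegral_swap]
      refine AEMeasurable.mul (M := ℝ≥0∞)
        (f := fun p : EuclideanSpace ℝ (Fin n) × EuclideanSpace ℝ (Fin n) => ‖ρ p.2‖ₑ)
        (g := fun p => ‖g (p.1 - p.2)‖ₑ ^ 2) ?_ ?_
      · exact (hρm.comp measurable_snd).aemeasurable
      · exact (hg.comp_quasiMeasurePreserving
          (quasiMeasurePreserving_sub_of_right_invariant volume volume)).enorm.pow_const 2
    _ = ∫⁻ t, ‖ρ t‖ₑ * ∫⁻ x, ‖g x‖ₑ ^ 2 := by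
      refine lintegral_congr fun t => ?_
      rw [lintegral_const_mul' _ _ enorm_ne_top]
      congr 1
      exact lintegral_sub_right_eq_self (fun x => ‖g x‖ₑ ^ 2) t
    _ = _ := by rw [lintegral_mul_const'' _ hρm.aemeasurable, hρ1, one_mul]

theorem memLp_mollify [CompleteSpace F] {g : EuclideanSpace ℝ (Fin n) → F} (k : ℕ)
    (hg : MemLp g 2 volume) : MemLp (mollify k g) 2 volume := by
  refine ⟨(contDiff_mollify k (hg.locallyIntegrable (by norm_num))).continuous.aestronglyMeasurable,
    ?_⟩
  have h1 := lintegral_mollify_sq_le k hg.1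
  rw [← eLpNorm_two_sq, ← eLpNorm_two_sq] at h1
  have h2 := (ENNReal.pow_lt_top hg.2 (n := 2))
  by_contra h
  rw [not_lt, top_le_iff] at h
  rw [h] at h1
  simp at h1
  exact hg.2.ne h1

/-- Mollifications of an `L²` function converge in `L²`. -/
theorem tendsto_eLpNorm_mollify_sub [CompleteSpace F] {g : EuclideanSpace ℝ (Fin n) → F}
    (hg : MemLp g 2 volume) :
    Tendsto (fun k => eLpNorm (mollify k g - g) 2 volume) atTop (𝓝 0) := by
  set S := ∫⁻ x, ‖g x‖ₑ ^ 2 with hS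
  have hSfin : S ≠ ⊤ := by
    rw [hS, ← eLpNorm_two_sq]
    exact (ENNReal.pow_lt_top hg.2).ne
  have hmm : ∀ k, AEStronglyMeasurable (mollify k g) volume := fun k => (memLp_mollify k hg).1
  set D : ℕ → ℝ≥0∞ := fun k => ∫⁻ x, ‖mollify k g x - g x‖ₑ ^ 2 with hD
  have hpt : ∀ a b : F, ‖a - b‖ₑ ^ 2 ≤ 2 * ‖a‖ₑ ^ 2 + 2 * ‖b‖ₑ ^ 2 := by
    intro a b
    have h : ‖a - b‖ ^ 2 ≤ 2 * ‖a‖ ^ 2 + 2 * ‖b‖ ^ 2 := by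
      nlinarith [norm_sub_le a b, norm_nonneg (a - b), norm_nonneg a, norm_nonneg b,
        sq_nonneg (‖a‖ - ‖b‖)]
    have := ENNReal.ofReal_le_ofReal h
    rw [ENNReal.ofReal_add (by positivity) (by positivity), ENNReal.ofReal_mul (by norm_num),
      ENNReal.ofReal_mul (by norm_num), ENNReal.ofReal_pow (norm_nonneg _),
      ENNReal.ofReal_pow (norm_nonneg _), ENNReal.ofReal_pow (norm_nonneg _), ofReal_norm,
      ofReal_norm, ofReal_norm] at this
    simpa using this
  have hDle : ∀ k, D k ≤ 4 * S := by
    intro k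
    calc D k ≤ ∫⁻ x, (2 * ‖mollify k g x‖ₑ ^ 2 + 2 * ‖g x‖ₑ ^ 2) :=
          lintegral_mono fun x => hpt _ _
      _ = 2 * (∫⁻ x, ‖mollify k g x‖ₑ ^ 2) + 2 * S := by
        rw [lintegral_add_left' (((hmm k).enorm.pow_const 2).const_mul 2),
          lintegral_const_mul' _ _ (by norm_num), lintegral_const_mul' _ _ (by norm_num)]
      _ ≤ 2 * S + 2 * S := by gcongr; exact lintegral_mollify_sq_le k hg.1
      _ = 4 * S := by rw [← add_mul]; norm_num
  -- Fatou for 2|gₖ|² + 2|g|² - |gₖ - g|² ≥ 0, which tends a.e. to 4|g|². Since ∫|gₖ|² ≤ ∫|g|², the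
  -- integrals are at most 4S - Dₖ, and this forces limsup Dₖ = 0.
  have hFatou : 4 * S ≤ liminf (fun k => 4 * S - D k) atTop := by
    have h1 : ∀ᵐ x ∂volume, 4 * ‖g x‖ₑ ^ 2 ≤ liminf (fun k =>
        (2 * ‖mollify k g x‖ₑ ^ 2 + 2 * ‖g x‖ₑ ^ 2) - ‖mollify k g x - g x‖ₑ ^ 2) atTop := by
      filter_upwards [ae_tendsto_mollify (hg.locallyIntegrable (by norm_num))] with x hx
      have h2 : Tendsto (fun k => (2 * ‖mollify k g x‖ₑ ^ 2 + 2 * ‖g x‖ₑ ^ 2) -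
          ‖mollify k g x - g x‖ₑ ^ 2) atTop
          (𝓝 ((2 * ‖g x‖ₑ ^ 2 + 2 * ‖g x‖ₑ ^ 2) - ‖g x - g x‖ₑ ^ 2)) := by
        refine ENNReal.Tendsto.sub ?_ ?_ (Or.inr (by simp))
        · refine Tendsto.add ?_ tendsto_const_nhds
          refine ENNReal.Tendsto.const_mul ?_ (Or.inr (by norm_num))
          exact (ENNReal.continuous_pow 2).continuousAt.tendsto.comp hx.enorm
        · exact (ENNReal.continuous_pow 2).continuousAt.tendsto.comp
            (hx.sub tendsto_const_nhds).enorm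
      rw [h2.liminf_eq, ← add_mul]
      simp only [sub_self, enorm_zero]
      norm_num
    calc 4 * S = ∫⁻ x, 4 * ‖g x‖ₑ ^ 2 := (lintegral_const_mul' _ _ (by norm_num)).symm
      _ ≤ _ := lintegral_mono_ae h1
      _ ≤ _ := lintegral_liminf_le' fun k =>
        (((hmm k).enorm.pow_const 2).const_mul 2 |>.add ((hg.1.enorm.pow_const 2).const_mul 2)).sub
          (((hmm k).sub hg.1).enorm.pow_const 2)
      _ ≤ _ := by
        refine liminf_le_liminf (Eventually.of_forall fun k => ?_)
        rw [lintegral_sub' (g := fun x => ‖mollify k g x - g x‖ₑ ^ 2)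
          (((hmm k).sub hg.1).enorm.pow_const 2)
          (ne_top_of_le_ne_top (by finiteness) (hDle k))
          (Eventually.of_forall fun x => hpt _ _)]
        refine tsub_le_tsub_right ?_ _
        rw [lintegral_add_left' (((hmm k).enorm.pow_const 2).const_mul 2),
          lintegral_const_mul' _ _ (by norm_num), lintegral_const_mul' _ _ (by norm_num)]
        calc _ ≤ 2 * S + 2 * S := by gcongr; exact lintegral_mollify_sq_le k hg.1
          _ = 4 * S := by rw [← add_mul]; norm_num
  rw [ENNReal.liminf_const_sub _ _ (by finiteness)] at hFatou
  have hlim : limsup D atTop = 0 := by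
    have hle : limsup D atTop ≤ 4 * S :=
      (limsup_le_limsup (Eventually.of_forall hDle)).trans (by simp)
    -- Truncated subtraction only gives a contradiction when 4S ≠ 0; the case S = 0 is covered by
    -- `hle`.
    by_contra hne
    have h4 : 4 * S ≠ 0 := fun h => hne (le_zero_iff.1 (h ▸ hle))
    exact absurd hFatou (not_le.2 (ENNReal.sub_lt_self (by finiteness) h4 hne))
  have hDt : Tendsto D atTop (𝓝 0) :=
    tendsto_of_le_liminf_of_limsup_le bot_le hlim.le
  have h3 : ∀ k, eLpNorm (mollify k g - g) 2 volume = (D k) ^ (1 / 2 : ℝ) := by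
    intro k
    have := eLpNorm_two_sq (μ := volume) (mollify k g - g)
    simp only [Pi.sub_apply] at this
    simp only [hD]
    rw [← this, ← ENNReal.rpow_ofNat, ← ENNReal.rpow_mul]
    simp
  simp only [h3]
  have := (ENNReal.continuous_rpow_const (y := (1 / 2 : ℝ))).tendsto 0
  rw [ENNReal.zero_rpow_of_pos (by norm_num)] at this
  exact this.comp hDt

/-- The gradient of a mollification is the mollification of the distributional gradient. -/
theorem HasWeakGrad.fderiv_mollify {u : EuclideanSpace ℝ (Fin n) → ℝ}
    {G : EuclideanSpace ℝ (Fin n) → EuclideanSpace ℝ (Fin n)} (h : HasWeakGrad u G) (k : ℕ)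
    (x v : EuclideanSpace ℝ (Fin n)) :
    fderiv ℝ (mollify k u) x v = inner ℝ (mollify k G x) v := by
  obtain ⟨hu, hG, hw⟩ := h
  set ρ := (shrinkingBump n k).normed (volume : Measure (EuclideanSpace ℝ (Fin n))) with hρ
  have hρs : ContDiff ℝ ∞ ρ := ContDiffBump.contDiff_normed _
  have hρc : HasCompactSupport ρ := (shrinkingBump n k).hasCompactSupport_normed
  have h1 := (hρc.hasFDerivAt_convolution_left (ContinuousLinearMap.lsmul ℝ ℝ)
    (hρs.of_le (by norm_cast)) hu x).fderiv
  have hex : Integrable (fun t => ((ContinuousLinearMap.lsmul ℝ ℝ).precompL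
      (EuclideanSpace ℝ (Fin n)) (fderiv ℝ ρ (x - t))) (u t)) volume := by
    have := HasCompactSupport.convolutionExists_left
      ((ContinuousLinearMap.lsmul ℝ ℝ).precompL (EuclideanSpace ℝ (Fin n))) (hρc.fderiv ℝ)
      (hρs.continuous_fderiv (by simp)) hu x
    exact this.integrable_swap
  have h2 : fderiv ℝ (mollify k u) x v = ∫ t, fderiv ℝ ρ (x - t) v * u t := by
    rw [mollify, h1, convolution_eq_swap, ContinuousLinearMap.integral_apply hex v]
    rfl
  -- The reflected bump is the test function; reflection changes the sign of its derivative, which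
  -- cancels the sign in the definition of the weak gradient.
  set φ : EuclideanSpace ℝ (Fin n) → ℝ := fun t => ρ (x - t) with hφ
  have hφs : ContDiff ℝ ∞ φ := hρs.comp (contDiff_const.sub contDiff_id)
  have hφc : HasCompactSupport φ :=
    hρc.comp_homeomorph (Homeomorph.subLeft x)
  have hφd : ∀ t, fderiv ℝ φ t v = - fderiv ℝ ρ (x - t) v := by
    intro t
    have : HasFDerivAt φ ((fderiv ℝ ρ (x - t)).comp
        (-ContinuousLinearMap.id ℝ (EuclideanSpace ℝ (Fin n)))) t := by
      refine ((hρs.differentiable (by simp)) (x - t)).hasFDerivAt.comp t ?_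
      exact (hasFDerivAt_id t).const_sub x
    rw [this.fderiv]
    simp
  have h3 := hw φ hφs hφc v
  simp only [hφd] at h3
  have h4 : inner ℝ (mollify k G x) v = ∫ t, φ t * inner ℝ (G t) v := by
    have hint : Integrable (fun t => φ t • G t) volume :=
      hG.integrable_smul_left_of_hasCompactSupport hφs.continuous hφc
    rw [mollify, convolution_eq_swap, real_inner_comm, ← integral_inner]
    · refine integral_congr_ae (Eventually.of_forall fun t => ?_)
      simp [inner_smul_right, hφ, real_inner_comm, hρ]
    · exact hint
  rw [h2, h4]
  have h5 : ∫ t, u t * -fderiv ℝ ρ (x - t) v = - ∫ t, fderiv ℝ ρ (x - t) v * u t := by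
    rw [← integral_neg]
    congr 1
    ext t
    ring
  rw [h5] at h3
  exact neg_injective h3

end Mollification

/-! ### Cutoff functions with a universal gradient constant. -/

section Cutoff

theorem exists_norm_deriv_smoothTransition_le :
    ∃ C > 0, ∀ t, ‖deriv Real.smoothTransition t‖ ≤ C := by
  have hc : Continuous (deriv Real.smoothTransition) :=
    (Real.smoothTransition.contDiff (n := 1)).continuous_deriv (by simp)
  obtain ⟨C, hC⟩ := (isCompact_Icc (a := (0 : ℝ)) (b := 1)).exists_bound_of_continuousOn
    hc.continuousOn
  refine ⟨max C 1, by positivity, fun t => ?_⟩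
  rcases lt_or_ge t 0 with h | h
  · have : Real.smoothTransition =ᶠ[𝓝 t] fun _ => 0 := by
      filter_upwards [Iio_mem_nhds h] with s hs
      exact Real.smoothTransition.zero_of_nonpos (le_of_lt hs)
    rw [this.deriv_eq]
    simp
  rcases lt_or_ge 1 t with h' | h'
  · have : Real.smoothTransition =ᶠ[𝓝 t] fun _ => 1 := by
      filter_upwards [Ioi_mem_nhds h'] with s hs
      exact Real.smoothTransition.one_of_one_le (le_of_lt hs)
    rw [this.deriv_eq]
    simp
  · exact (hC t ⟨h, h'⟩).trans (le_max_left _ _)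

/-- One can cut off from `B(z, s)` to `B(z, s')` with a gradient at most `C / (s' - s)`. -/
def IsCutoffConstant (C : ℝ) : Prop :=
  ∀ (n : ℕ) (z : EuclideanSpace ℝ (Fin n)) (s s' : ℝ),
    0 < s → s < s' → ∃ η : EuclideanSpace ℝ (Fin n) → ℝ, ContDiff ℝ ∞ η ∧
      (∀ x, 0 ≤ η x) ∧ (∀ x, η x ≤ 1) ∧ (∀ x ∈ closedBall z s, η x = 1) ∧
      (∀ x, x ∉ ball z s' → η x = 0) ∧ HasCompactSupport η ∧
      ∀ x, ‖gradient η x‖ ≤ C / (s' - s)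

/-- The profile is composed with an affine function of ‖x - z‖², which is smooth at the centre too.
The factor 2 comes from 2s'/(s'² - s²) ≤ 2/(s' - s). -/
theorem exists_isCutoffConstant : ∃ C > (0 : ℝ), IsCutoffConstant C := by
  obtain ⟨C, hC0, hC⟩ := exists_norm_deriv_smoothTransition_le
  refine ⟨2 * C, by positivity, fun n z s s' hs hss' => ?_⟩
  have hd : 0 < s' ^ 2 - s ^ 2 := by nlinarith
  have hd' : 0 < s' - s := by linarith
  set q : EuclideanSpace ℝ (Fin n) → ℝ := fun x => (s' ^ 2 - ‖x - z‖ ^ 2) / (s' ^ 2 - s ^ 2)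
    with hq
  have hqs : ContDiff ℝ ∞ q :=
    (contDiff_const.sub ((contDiff_id.sub contDiff_const).norm_sq ℝ)).div_const _
  have hzero : ∀ x, x ∉ ball z s' → Real.smoothTransition (q x) = 0 := by
    intro x hx
    refine Real.smoothTransition.zero_of_nonpos ?_
    rw [mem_ball, dist_eq_norm, not_lt] at hx
    refine div_nonpos_of_nonpos_of_nonneg ?_ hd.le
    nlinarith
  refine ⟨fun x => Real.smoothTransition (q x), Real.smoothTransition.contDiff.comp hqs,
    fun x => Real.smoothTransition.nonneg _, fun x => Real.smoothTransition.le_one _, ?_, hzero,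
    ?_, ?_⟩
  · intro x hx
    refine Real.smoothTransition.one_of_one_le ?_
    rw [mem_closedBall, dist_eq_norm] at hx
    rw [hq, one_le_div hd]
    nlinarith [norm_nonneg (x - z)]
  · refine HasCompactSupport.of_support_subset_isCompact (isCompact_closedBall z s') ?_
    intro x hx
    by_contra h
    exact hx (hzero x fun h' => h (ball_subset_closedBall h'))
  · intro x
    have hqd : HasFDerivAt q (-(s' ^ 2 - s ^ 2)⁻¹ • (2 • (innerSL ℝ (x - z)))) x := by
      have h1 : HasFDerivAt (fun x : EuclideanSpace ℝ (Fin n) => ‖x - z‖ ^ 2)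
          (2 • (innerSL ℝ (x - z))) x := by
        simpa using ((hasFDerivAt_id x).sub_const z).norm_sq
      have h2 := (h1.const_sub (s' ^ 2)).mul_const ((s' ^ 2 - s ^ 2)⁻¹)
      simp only [hq, div_eq_mul_inv]
      refine h2.congr_fderiv ?_
      rw [smul_neg, neg_smul]
    have hcomp : HasFDerivAt (fun x => Real.smoothTransition (q x)) _ x :=
      (((Real.smoothTransition.contDiff (n := 1)).differentiable (by simp)
        (q x)).hasDerivAt.comp_hasFDerivAt x hqd)
    have hng : ‖gradient (fun x => Real.smoothTransition (q x)) x‖ =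
        ‖fderiv ℝ (fun x => Real.smoothTransition (q x)) x‖ := by
      simp [gradient]
    by_cases hx : x ∈ ball z s'
    · rw [hng, hcomp.fderiv, norm_smul, norm_smul]
      rw [mem_ball, dist_eq_norm] at hx
      have h3 : ‖(2 • (innerSL ℝ (x - z)) : EuclideanSpace ℝ (Fin n) →L[ℝ] ℝ)‖ ≤ 2 * s' := by
        rw [← Nat.cast_smul_eq_nsmul ℝ, norm_smul, innerSL_apply_norm]
        simp
        exact hx.le
      rw [norm_neg, norm_inv, Real.norm_of_nonneg hd.le]
      calc _ ≤ C * ((s' ^ 2 - s ^ 2)⁻¹ * (2 * s')) := by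
            gcongr
            exact hC _
        _ ≤ 2 * C / (s' - s) := by
          rw [← mul_assoc, ← div_eq_mul_inv, div_mul_eq_mul_div, div_le_div_iff₀ hd hd']
          have : 0 < C * (s' - s) * s := by positivity
          nlinarith
    -- Off the ball the cutoff attains its minimum 0, so its gradient vanishes there, the boundary
    -- sphere included.
    · have hmin : IsLocalMin (fun x => Real.smoothTransition (q x)) x :=
        Eventually.of_forall fun y => by
          show Real.smoothTransition (q x) ≤ _
          rw [hzero x hx]; exact Real.smoothTransition.nonneg _
      rw [hng, hmin.fderiv_eq_zero, norm_zero]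
      positivity

end Cutoff

/-! ### Linearity and the product rule for weak gradients. -/

section Calculus

variable {n : ℕ} {u w : EuclideanSpace ℝ (Fin n) → ℝ}
  {G H : EuclideanSpace ℝ (Fin n) → EuclideanSpace ℝ (Fin n)}

theorem continuous_gradient {η : EuclideanSpace ℝ (Fin n) → ℝ} (hη : ContDiff ℝ ∞ η) :
    Continuous (gradient η) :=
  (LinearIsometryEquiv.continuous _).comp (hη.continuous_fderiv (by simp))

theorem HasWeakGrad.add (hu : HasWeakGrad u G) (hw : HasWeakGrad w H) :
    HasWeakGrad (fun x => u x + w x) (fun x => G x + H x) := by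
  refine ⟨hu.1.add hw.1, hu.2.1.add hw.2.1, fun φ hφ hc v => ?_⟩
  have hφ' : Continuous fun x => fderiv ℝ φ x v :=
    (hφ.continuous_fderiv (by simp)).clm_apply continuous_const
  have hc' : HasCompactSupport fun x => fderiv ℝ φ x v := hc.fderiv_apply (𝕜 := ℝ) v
  have e1 : ∀ {a : EuclideanSpace ℝ (Fin n) → ℝ}, LocallyIntegrable a volume →
      Integrable (fun x => a x * fderiv ℝ φ x v) volume := fun ha =>
    ha.integrable_smul_right_of_hasCompactSupport hφ' hc'
  have e2 : ∀ {K : EuclideanSpace ℝ (Fin n) → EuclideanSpace ℝ (Fin n)},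
      LocallyIntegrable K volume → Integrable (fun x => φ x * inner ℝ (K x) v) volume := by
    intro K hK
    have := (hK.integrable_smul_left_of_hasCompactSupport hφ.continuous hc).inner_const (𝕜 := ℝ) v
    simpa [inner_smul_left] using this
  simp only [add_mul, inner_add_left, mul_add]
  rw [integral_add (e1 hu.1) (e1 hw.1), integral_add (e2 hu.2.1) (e2 hw.2.1),
    hu.2.2 φ hφ hc v, hw.2.2 φ hφ hc v]
  ring

theorem HasWeakGrad.const_mul (hu : HasWeakGrad u G) (c : ℝ) :
    HasWeakGrad (fun x => c * u x) (fun x => c • G x) := by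
  refine ⟨hu.1.smul c, hu.2.1.smul c, fun φ hφ hc v => ?_⟩
  have h := hu.2.2 φ hφ hc v
  simp only [inner_smul_left, mul_assoc, conj_trivial, mul_left_comm _ c]
  rw [integral_const_mul, integral_const_mul, h]
  ring

theorem HasWeakGrad.sub (hu : HasWeakGrad u G) (hw : HasWeakGrad w H) :
    HasWeakGrad (fun x => u x - w x) (fun x => G x - H x) := by
  have := hu.add (hw.const_mul (-1))
  simpa [sub_eq_add_neg] using this

theorem HasWeakGrad.mul_contDiff {η : EuclideanSpace ℝ (Fin n) → ℝ} (hu : HasWeakGrad u G)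
    (hη : ContDiff ℝ ∞ η) :
    HasWeakGrad (fun x => η x * u x) (fun x => η x • G x + u x • gradient η x) := by
  refine ⟨hu.1.continuous_smul hη.continuous, (hu.2.1.continuous_smul hη.continuous).add
    (hu.1.smul_continuous (continuous_gradient hη)), fun φ hφ hc v => ?_⟩
  have h := hu.2.2 (fun x => η x * φ x) (hη.mul hφ) hc.mul_left v
  have hd : ∀ x, fderiv ℝ (fun x => η x * φ x) x v =
      η x * fderiv ℝ φ x v + φ x * fderiv ℝ η x v := by
    intro x
    rw [fderiv_fun_mul (hη.differentiable (by simp) x) (hφ.differentiable (by simp) x)]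
    simp
  have hφ' : Continuous fun x => fderiv ℝ φ x v :=
    (hφ.continuous_fderiv (by simp)).clm_apply continuous_const
  have hη' : Continuous fun x => fderiv ℝ η x v :=
    (hη.continuous_fderiv (by simp)).clm_apply continuous_const
  have hc' : HasCompactSupport fun x => fderiv ℝ φ x v := hc.fderiv_apply (𝕜 := ℝ) v
  have i1 : Integrable (fun x => u x * (η x * fderiv ℝ φ x v)) volume :=
    hu.1.integrable_smul_right_of_hasCompactSupport (hη.continuous.mul hφ') hc'.mul_left
  have i2 : Integrable (fun x => u x * (φ x * fderiv ℝ η x v)) volume :=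
    hu.1.integrable_smul_right_of_hasCompactSupport (hφ.continuous.mul hη') hc.mul_right
  have i3 : Integrable (fun x => (η x * φ x) * inner ℝ (G x) v) volume := by
    have := (hu.2.1.integrable_smul_left_of_hasCompactSupport (hη.continuous.mul hφ.continuous)
      hc.mul_left).inner_const (𝕜 := ℝ) v
    simpa [inner_smul_left] using this
  simp only [hd, mul_add] at h
  rw [integral_add i1 i2] at h
  have e1 : ∀ x, η x * u x * fderiv ℝ φ x v = u x * (η x * fderiv ℝ φ x v) := fun x => by ring
  have e2 : ∀ x, φ x * inner ℝ (η x • G x + u x • gradient η x) v =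
      (η x * φ x) * inner ℝ (G x) v + u x * (φ x * fderiv ℝ η x v) := fun x => by
    rw [inner_add_left, inner_smul_left, inner_smul_left, inner_gradient_left]
    simp only [conj_trivial]
    ring
  simp only [e1, e2]
  rw [integral_add i3 i2]
  linarith

theorem hasWeakGrad_of_contDiff {η : EuclideanSpace ℝ (Fin n) → ℝ} (hη : ContDiff ℝ ∞ η) :
    HasWeakGrad η (gradient η) := by
  refine ⟨hη.continuous.locallyIntegrable, (continuous_gradient hη).locallyIntegrable,
    fun φ hφ hc v => ?_⟩
  have hφ' : Continuous fun x => fderiv ℝ φ x v :=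
    (hφ.continuous_fderiv (by simp)).clm_apply continuous_const
  have hη' : Continuous fun x => fderiv ℝ η x v :=
    (hη.continuous_fderiv (by simp)).clm_apply continuous_const
  have hc' : HasCompactSupport fun x => fderiv ℝ φ x v := hc.fderiv_apply (𝕜 := ℝ) v
  rw [integral_mul_fderiv_eq_neg_fderiv_mul_of_integrable
    ((hη'.mul hφ.continuous).integrable_of_hasCompactSupport hc.mul_left)
    ((hη.continuous.mul hφ').integrable_of_hasCompactSupport hc'.mul_left)
    ((hη.continuous.mul hφ.continuous).integrable_of_hasCompactSupport hc.mul_left)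
    (fun x _ => hη.differentiable (by simp) x) (fun x _ => hφ.differentiable (by simp) x)]
  simp only [inner_gradient_left, mul_comm]

theorem gradient_hasCompactSupport {η : EuclideanSpace ℝ (Fin n) → ℝ}
    (hc : HasCompactSupport η) : HasCompactSupport (gradient η) := by
  have := hc.fderiv (𝕜 := ℝ)
  exact this.comp_left (map_zero _)

end Calculus

/-! ### The weak gradient of the positive part. -/

section PositivePart

variable {n : ℕ} {u : EuclideanSpace ℝ (Fin n) → ℝ}
  {G : EuclideanSpace ℝ (Fin n) → EuclideanSpace ℝ (Fin n)}

/-- If `w k → w` a.e. with `|w k| ≤ b ∈ L²` and `g k → g` in `L²`, then `∫ w k * g k → ∫ w * g`. -/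
theorem tendsto_integral_mul_of_L2 {α : Type*} [MeasurableSpace α] {μ : Measure α}
    {w : ℕ → α → ℝ} {w' b g' : α → ℝ} {g : ℕ → α → ℝ}
    (hb : MemLp b 2 μ) (hw : ∀ k, AEStronglyMeasurable (w k) μ)
    (hwb : ∀ k, ∀ᵐ x ∂μ, ‖w k x‖ ≤ b x)
    (hww : ∀ᵐ x ∂μ, Tendsto (fun k => w k x) atTop (𝓝 (w' x)))
    (hg : ∀ k, MemLp (g k) 2 μ) (hg' : MemLp g' 2 μ)
    (hgg : Tendsto (fun k => eLpNorm (g k - g') 2 μ) atTop (𝓝 0)) :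
    Tendsto (fun k => ∫ x, w k x * g k x ∂μ) atTop (𝓝 (∫ x, w' x * g' x ∂μ)) := by
  have hwL : ∀ k, MemLp (w k) 2 μ := fun k => hb.of_le (hw k) (by
    filter_upwards [hwb k] with x hx using hx.trans (le_abs_self _))
  -- The first term converges by domination, the second tends to 0 by Cauchy–Schwarz.
  have e : ∀ k, ∫ x, w k x * g k x ∂μ = (∫ x, w k x * g' x ∂μ) + ∫ x, w k x * (g k - g') x ∂μ := by
    intro k
    have i1 : Integrable (fun x => w k x * g' x) μ := (hwL k).integrable_mul hg'
    have i2 : Integrable (fun x => w k x * (g k - g') x) μ :=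
      (hwL k).integrable_mul ((hg k).sub hg')
    rw [← integral_add i1 i2]
    congr 1
    ext x
    simp only [Pi.sub_apply]
    ring
  simp only [e]
  rw [← add_zero (∫ x, w' x * g' x ∂μ)]
  refine Tendsto.add ?_ ?_
  · refine tendsto_integral_of_dominated_convergence (fun x => ‖b x‖ * ‖g' x‖)
      (fun k => (hw k).mul hg'.1) (hb.norm.integrable_mul hg'.norm) (fun k => ?_) ?_
    · filter_upwards [hwb k] with x hx
      rw [norm_mul]
      gcongr
      exact hx.trans (le_abs_self _)
    · filter_upwards [hww] with x hx using hx.mul_const _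
  · rw [tendsto_zero_iff_norm_tendsto_zero]
    have hb' : ∀ k, ‖∫ x, w k x * (g k - g') x ∂μ‖ ≤
        (eLpNorm b 2 μ * eLpNorm (g k - g') 2 μ).toReal := by
      intro k
      have h1 := enorm_integral_le_lintegral_enorm (μ := μ) (fun x => w k x * (g k - g') x)
      rw [← eLpNorm_one_eq_lintegral_enorm] at h1
      have h2 := eLpNorm_smul_le_mul_eLpNorm (p := 2) (q := 2) (r := 1) ((hg k).sub hg').1
        (hwL k).1
      have h3 : eLpNorm (w k) 2 μ ≤ eLpNorm b 2 μ := eLpNorm_mono_ae (by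
        filter_upwards [hwb k] with x hx using hx.trans (le_abs_self _))
      have h4 := (h1.trans h2).trans (mul_le_mul_left h3 _)
      rw [← toReal_enorm]
      exact ENNReal.toReal_mono (ENNReal.mul_ne_top hb.2.ne ((hg k).sub hg').2.ne) h4
    refine squeeze_zero (fun k => norm_nonneg _) hb' ?_
    have := ENNReal.Tendsto.const_mul (a := eLpNorm b 2 μ) hgg (Or.inr hb.2.ne)
    rw [mul_zero] at this
    exact (ENNReal.tendsto_toReal ENNReal.zero_ne_top).comp this

theorem hasDerivAt_max_zero_sq (t : ℝ) : HasDerivAt (fun t : ℝ => max t 0 ^ 2) (2 * max t 0) t := by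
  rcases lt_trichotomy t 0 with h | h | h
  · have : (fun t : ℝ => max t 0 ^ 2) =ᶠ[𝓝 t] fun _ => 0 := by
      filter_upwards [Iio_mem_nhds h] with s hs
      rw [max_eq_right (le_of_lt hs)]; norm_num
    rw [max_eq_right h.le, mul_zero]
    exact (hasDerivAt_const t (0 : ℝ)).congr_of_eventuallyEq this
  · subst h
    simp only [max_self, mul_zero]
    rw [hasDerivAt_iff_isLittleO]
    simp only [max_self, sub_zero, smul_zero]
    have h1 : (fun t : ℝ => max t 0 ^ 2 - 0 ^ 2) =O[𝓝 0] fun t : ℝ => t ^ 2 := by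
      refine Asymptotics.IsBigO.of_bound 1 (Eventually.of_forall fun s => ?_)
      rcases le_total s 0 with hs | hs
      · rw [max_eq_right hs]; simp; positivity
      · rw [max_eq_left hs]; simp
    refine h1.trans_isLittleO ?_
    have := Asymptotics.isLittleO_pow_id (𝕜 := ℝ) (n := 2) (by norm_num)
    simpa [id] using! this
  · have : (fun t : ℝ => max t 0 ^ 2) =ᶠ[𝓝 t] fun t => t ^ 2 := by
      filter_upwards [Ioi_mem_nhds h] with s hs
      rw [max_eq_left (le_of_lt hs)]
    rw [max_eq_left h.le]
    refine HasDerivAt.congr_of_eventuallyEq ?_ this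
    simpa using hasDerivAt_pow 2 t

/-- A `C¹` approximation of the positive part. -/
noncomputable def smoothPos (δ t : ℝ) : ℝ := √(max t 0 ^ 2 + δ ^ 2) - δ

/-- The derivative of `smoothPos`. -/
noncomputable def smoothPosDeriv (δ t : ℝ) : ℝ := max t 0 / √(max t 0 ^ 2 + δ ^ 2)

theorem hasDerivAt_smoothPos {δ : ℝ} (hδ : 0 < δ) (t : ℝ) :
    HasDerivAt (smoothPos δ) (smoothPosDeriv δ t) t := by
  have h := (((hasDerivAt_max_zero_sq t).add_const (δ ^ 2)).sqrt (by positivity)).sub_const δ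
  refine h.congr_deriv ?_
  rw [smoothPosDeriv]
  field_simp

theorem continuous_smoothPosDeriv {δ : ℝ} (hδ : 0 < δ) : Continuous (smoothPosDeriv δ) := by
  unfold smoothPosDeriv
  refine Continuous.div (by fun_prop) (by fun_prop) fun t => ?_
  positivity

theorem smoothPosDeriv_nonneg (δ t : ℝ) : 0 ≤ smoothPosDeriv δ t := by
  unfold smoothPosDeriv; positivity

theorem smoothPosDeriv_le_one (δ t : ℝ) : smoothPosDeriv δ t ≤ 1 := by
  unfold smoothPosDeriv
  refine div_le_one_of_le₀ ?_ (Real.sqrt_nonneg _)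
  exact Real.le_sqrt_of_sq_le (by nlinarith [sq_nonneg δ])

theorem lipschitzWith_smoothPos {δ : ℝ} (hδ : 0 < δ) : LipschitzWith 1 (smoothPos δ) := by
  refine lipschitzWith_of_nnnorm_deriv_le (fun t => (hasDerivAt_smoothPos hδ t).differentiableAt)
    fun t => ?_
  rw [(hasDerivAt_smoothPos hδ t).deriv, ← NNReal.coe_le_coe, coe_nnnorm, Real.norm_eq_abs,
    abs_of_nonneg (smoothPosDeriv_nonneg _ _)]
  exact smoothPosDeriv_le_one _ _

theorem smoothPos_zero {δ : ℝ} (hδ : 0 < δ) : smoothPos δ 0 = 0 := by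
  simp [smoothPos, Real.sqrt_sq hδ.le]

theorem abs_smoothPos_le {δ : ℝ} (hδ : 0 < δ) (t : ℝ) : |smoothPos δ t| ≤ |t| := by
  have := (lipschitzWith_smoothPos hδ).dist_le_mul t 0
  simpa [smoothPos_zero hδ, Real.dist_eq] using this

/-- The chain rule holds classically for the mollifications of u. The limit passes because
`smoothPos δ` is 1-Lipschitz, its derivative is continuous and bounded by 1, and both u and G are
approximated in L². -/
theorem hasWeakGrad_smoothPos {δ : ℝ} (hδ : 0 < δ) (h : HasWeakGrad u G)
    (hu : MemLp u 2 volume) (hG : MemLp G 2 volume) {φ : EuclideanSpace ℝ (Fin n) → ℝ}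
    (hφ : ContDiff ℝ ∞ φ) (hc : HasCompactSupport φ) (v : EuclideanSpace ℝ (Fin n)) :
    ∫ x, fderiv ℝ φ x v * smoothPos δ (u x) =
      - ∫ x, (φ x * smoothPosDeriv δ (u x)) * inner ℝ (G x) v := by
  have hφ' : Continuous fun x => fderiv ℝ φ x v :=
    (hφ.continuous_fderiv (by simp)).clm_apply continuous_const
  have hc' : HasCompactSupport fun x => fderiv ℝ φ x v := hc.fderiv_apply (𝕜 := ℝ) v
  have hβ : Continuous (smoothPos δ) := (lipschitzWith_smoothPos hδ).continuous
  have hβL : ∀ {a : EuclideanSpace ℝ (Fin n) → ℝ}, MemLp a 2 volume →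
      MemLp (fun x => smoothPos δ (a x)) 2 volume := fun {a} ha =>
    ha.of_le (hβ.comp_aestronglyMeasurable ha.1)
      (Eventually.of_forall fun x => abs_smoothPos_le hδ _)
  have hus : ∀ k, ContDiff ℝ ∞ (mollify k u) := fun k => contDiff_mollify k h.1
  have hparts : ∀ k, ∫ x, fderiv ℝ φ x v * smoothPos δ (mollify k u x) =
      - ∫ x, (φ x * smoothPosDeriv δ (mollify k u x)) * inner ℝ (mollify k G x) v := by
    intro k
    have hd : ∀ x, HasFDerivAt (fun x => smoothPos δ (mollify k u x))
        (smoothPosDeriv δ (mollify k u x) • fderiv ℝ (mollify k u) x) x := fun x =>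
      (hasDerivAt_smoothPos hδ _).comp_hasFDerivAt x
        ((hus k).differentiable (by simp) x).hasFDerivAt
    have hd' : ∀ x, fderiv ℝ (fun x => smoothPos δ (mollify k u x)) x v =
        smoothPosDeriv δ (mollify k u x) * inner ℝ (mollify k G x) v := fun x => by
      rw [(hd x).fderiv, _root_.smul_apply, h.fderiv_mollify, smul_eq_mul]
    have c1 : Continuous fun x => smoothPos δ (mollify k u x) := hβ.comp (hus k).continuous
    have c2 : Continuous fun x => smoothPosDeriv δ (mollify k u x) * inner ℝ (mollify k G x) v := by
      refine ((continuous_smoothPosDeriv hδ).comp (hus k).continuous).mul ?_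
      exact (contDiff_mollify k h.2.1).continuous.inner continuous_const
    have := integral_mul_fderiv_eq_neg_fderiv_mul_of_integrable (μ := volume) (𝕜 := ℝ)
      (f := fun x => smoothPos δ (mollify k u x)) (g := φ) (v := v)
      (by simp only [hd']
          exact (c2.mul hφ.continuous).integrable_of_hasCompactSupport hc.mul_left)
      ((c1.mul hφ').integrable_of_hasCompactSupport hc'.mul_left)
      ((c1.mul hφ.continuous).integrable_of_hasCompactSupport hc.mul_left)
      (fun x _ => (hd x).differentiableAt) (fun x _ => hφ.differentiable (by simp) x)
    simp only [hd'] at this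
    simp only [mul_comm (fderiv ℝ φ _ v)]
    rw [this]
    congr 2
    ext x
    ring
  have hlim1 : Tendsto (fun k => ∫ x, fderiv ℝ φ x v * smoothPos δ (mollify k u x)) atTop
      (𝓝 (∫ x, fderiv ℝ φ x v * smoothPos δ (u x))) := by
    refine tendsto_integral_mul_of_L2 (w := fun _ x => fderiv ℝ φ x v)
      (b := fun x => ‖fderiv ℝ φ x v‖)
      ((hφ'.memLp_of_hasCompactSupport hc').norm) (fun _ => hφ'.aestronglyMeasurable)
      (fun _ => Eventually.of_forall fun x => le_rfl)
      (Eventually.of_forall fun x => tendsto_const_nhds) (fun k => hβL (memLp_mollify k hu))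
      (hβL hu) ?_
    refine tendsto_of_tendsto_of_tendsto_of_le_of_le tendsto_const_nhds
      (tendsto_eLpNorm_mollify_sub hu) (fun _ => zero_le) fun k => ?_
    refine eLpNorm_mono fun x => ?_
    have := (lipschitzWith_smoothPos hδ).dist_le_mul (mollify k u x) (u x)
    simpa [dist_eq_norm] using this
  have hin : ∀ {K : EuclideanSpace ℝ (Fin n) → EuclideanSpace ℝ (Fin n)}, MemLp K 2 volume →
      MemLp (fun x => inner ℝ (K x) v) 2 volume := fun hK => hK.inner_const v
  have hlim2 : Tendsto (fun k => ∫ x, (φ x * smoothPosDeriv δ (mollify k u x)) *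
      inner ℝ (mollify k G x) v) atTop
      (𝓝 (∫ x, (φ x * smoothPosDeriv δ (u x)) * inner ℝ (G x) v)) := by
    refine tendsto_integral_mul_of_L2 (w := fun k x => φ x * smoothPosDeriv δ (mollify k u x))
      (b := fun x => ‖φ x‖) (hφ.continuous.memLp_of_hasCompactSupport hc).norm
      (fun k => (hφ.continuous.mul ((continuous_smoothPosDeriv hδ).comp
        (hus k).continuous)).aestronglyMeasurable)
      (fun k => Eventually.of_forall fun x => ?_) ?_ (fun k => hin (memLp_mollify k hG)) (hin hG) ?_
    · rw [norm_mul, Real.norm_eq_abs (smoothPosDeriv _ _), abs_of_nonneg (smoothPosDeriv_nonneg _ _)]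
      exact mul_le_of_le_one_right (norm_nonneg _) (smoothPosDeriv_le_one _ _)
    · filter_upwards [ae_tendsto_mollify h.1] with x hx
      exact (((continuous_smoothPosDeriv hδ).tendsto _).comp hx).const_mul _
    · have h1 := ENNReal.Tendsto.const_mul (a := ENNReal.ofReal ‖v‖)
        (tendsto_eLpNorm_mollify_sub hG) (Or.inr ENNReal.ofReal_ne_top)
      rw [mul_zero] at h1
      refine tendsto_of_tendsto_of_tendsto_of_le_of_le tendsto_const_nhds h1 (fun _ => zero_le)
        fun k => ?_
      refine eLpNorm_le_mul_eLpNorm_of_ae_le_mul (Eventually.of_forall fun x => ?_) 2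
      simp only [Pi.sub_apply]
      rw [← inner_sub_left, mul_comm]
      exact norm_inner_le_norm _ _
  refine tendsto_nhds_unique hlim1 ?_
  simp only [hparts]
  exact hlim2.neg

theorem tendsto_smoothPos (t : ℝ) :
    Tendsto (fun k : ℕ => smoothPos (1 / ((k : ℝ) + 1)) t) atTop (𝓝 (max 0 t)) := by
  have h := tendsto_one_div_add_atTop_nhds_zero_nat (𝕜 := ℝ)
  have hc : Continuous fun δ : ℝ => smoothPos δ t := by unfold smoothPos; fun_prop
  have e : smoothPos 0 t = max 0 t := by
    rw [smoothPos, max_comm]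
    simp [Real.sqrt_sq]
  exact e ▸ (hc.tendsto 0).comp h

theorem tendsto_smoothPosDeriv (t : ℝ) :
    Tendsto (fun k : ℕ => smoothPosDeriv (1 / ((k : ℝ) + 1)) t) atTop
      (𝓝 (if 0 < t then 1 else 0)) := by
  split_ifs with h
  · have h0 := tendsto_one_div_add_atTop_nhds_zero_nat (𝕜 := ℝ)
    have hc : ContinuousAt (fun δ : ℝ => smoothPosDeriv δ t) 0 := by
      unfold smoothPosDeriv
      refine ContinuousAt.div (by fun_prop) (by fun_prop) ?_
      rw [max_eq_left h.le]
      positivity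
    have e : smoothPosDeriv 0 t = 1 := by
      rw [smoothPosDeriv, max_eq_left h.le]
      simp [Real.sqrt_sq h.le, h.ne']
    have := hc.tendsto.comp h0
    rw [e] at this
    exact this
  · have : ∀ k : ℕ, smoothPosDeriv (1 / ((k : ℝ) + 1)) t = 0 := fun k => by
      rw [smoothPosDeriv, max_eq_right (not_lt.1 h), zero_div]
    simp only [this]
    exact tendsto_const_nhds

theorem AEStronglyMeasurable.nullMeasurableSet_pos (h : AEStronglyMeasurable u volume) :
    NullMeasurableSet {x | 0 < u x} volume :=
  nullMeasurableSet_lt aemeasurable_const h.aemeasurable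

/-- Let δ → 0 in `hasWeakGrad_smoothPos`. Each derivative vanishes at 0, so the limit is the
indicator of the strict set {u > 0}, and nothing needs to be known about G on {u = 0}. -/
theorem HasWeakGrad.posPart_of_memLp (h : HasWeakGrad u G)
    (hu : MemLp u 2 volume) (hG : MemLp G 2 volume) :
    HasWeakGrad (posPartFun u) ({x | 0 < u x}.indicator G) := by
  have hup : MemLp (posPartFun u) 2 volume := by
    refine hu.of_le (aestronglyMeasurable_const.sup hu.1) (Eventually.of_forall fun x => ?_)
    rw [posPartFun, Real.norm_of_nonneg (le_max_left _ _)]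
    exact max_le (norm_nonneg _) (le_abs_self _)
  have hGp : MemLp ({x | 0 < u x}.indicator G) 2 volume := by
    refine hG.of_le (hG.1.indicator₀ (AEStronglyMeasurable.nullMeasurableSet_pos hu.1))
      (Eventually.of_forall fun x => ?_)
    exact norm_indicator_le_norm_self _ _
  refine ⟨hup.locallyIntegrable (by norm_num), hGp.locallyIntegrable (by norm_num),
    fun φ hφ hc v => ?_⟩
  have hφ' : Continuous fun x => fderiv ℝ φ x v :=
    (hφ.continuous_fderiv (by simp)).clm_apply continuous_const
  have hc' : HasCompactSupport fun x => fderiv ℝ φ x v := hc.fderiv_apply (𝕜 := ℝ) v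
  have hpos : ∀ k : ℕ, (0 : ℝ) < 1 / ((k : ℝ) + 1) := fun k => by positivity
  have l1 : Tendsto (fun k : ℕ => ∫ x, fderiv ℝ φ x v * smoothPos (1 / ((k : ℝ) + 1)) (u x)) atTop
      (𝓝 (∫ x, fderiv ℝ φ x v * posPartFun u x)) := by
    refine tendsto_integral_of_dominated_convergence (fun x => ‖fderiv ℝ φ x v‖ * ‖u x‖)
      (fun k => hφ'.aestronglyMeasurable.mul
        ((lipschitzWith_smoothPos (hpos k)).continuous.comp_aestronglyMeasurable hu.1))
      ((hφ'.memLp_of_hasCompactSupport (p := 2) hc').norm.integrable_mul hu.norm)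
      (fun k => Eventually.of_forall fun x => ?_) (Eventually.of_forall fun x => ?_)
    · rw [norm_mul]
      gcongr
      exact abs_smoothPos_le (hpos k) _
    · exact (tendsto_smoothPos (u x)).const_mul _
  have l2 : Tendsto (fun k : ℕ => ∫ x, (φ x * smoothPosDeriv (1 / ((k : ℝ) + 1)) (u x)) *
      inner ℝ (G x) v) atTop (𝓝 (∫ x, (φ x * if 0 < u x then 1 else 0) * inner ℝ (G x) v)) := by
    have hGv : MemLp (fun x => inner ℝ (G x) v) 2 volume := hG.inner_const v
    refine tendsto_integral_of_dominated_convergence (fun x => ‖φ x‖ * ‖inner ℝ (G x) v‖)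
      (fun k => (hφ.continuous.aestronglyMeasurable.mul
        ((continuous_smoothPosDeriv (hpos k)).comp_aestronglyMeasurable hu.1)).mul hGv.1)
      ((hφ.continuous.memLp_of_hasCompactSupport (p := 2) hc).norm.integrable_mul hGv.norm)
      (fun k => Eventually.of_forall fun x => ?_) (Eventually.of_forall fun x => ?_)
    · rw [norm_mul, norm_mul, Real.norm_eq_abs (smoothPosDeriv _ _),
        abs_of_nonneg (smoothPosDeriv_nonneg _ _)]
      gcongr
      exact mul_le_of_le_one_right (norm_nonneg _) (smoothPosDeriv_le_one _ _)
    · exact ((tendsto_smoothPosDeriv (u x)).const_mul _).mul_const _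
  have hk := fun k : ℕ => hasWeakGrad_smoothPos (hpos k) h hu hG hφ hc v
  simp only [hk] at l1
  have := tendsto_nhds_unique l1 l2.neg
  simp only [mul_comm (posPartFun u _)]
  rw [this]
  congr 2
  ext x
  by_cases hx : 0 < u x <;> simp [hx, Set.indicator]

/-- The positive part of a `W^{1,2}` function, and its gradient. -/
theorem HasWeakGrad.posPart (h : HasWeakGrad u G)
    (hu : ∀ K : Set (EuclideanSpace ℝ (Fin n)), IsCompact K → MemLp u 2 (volume.restrict K))
    (hG : MemLp G 2 volume) :
    HasWeakGrad (posPartFun u) ({x | 0 < u x}.indicator G) := by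
  have hum := h.1.aestronglyMeasurable
  have hup : LocallyIntegrable (posPartFun u) volume := by
    refine h.1.mono (aestronglyMeasurable_const.sup hum) (Eventually.of_forall fun x => ?_)
    rw [posPartFun, Real.norm_of_nonneg (le_max_left _ _)]
    exact max_le (norm_nonneg _) (le_abs_self _)
  have hGp : LocallyIntegrable ({x | 0 < u x}.indicator G) volume := by
    refine h.2.1.mono (hG.1.indicator₀ (AEStronglyMeasurable.nullMeasurableSet_pos hum))
      (Eventually.of_forall fun x => ?_)
    exact norm_indicator_le_norm_self _ _
  refine ⟨hup, hGp, fun φ hφ hc v => ?_⟩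
  obtain ⟨R, hR0, hR⟩ : ∃ R > 0, tsupport φ ⊆ ball 0 R := by
    obtain ⟨R, hR⟩ := hc.isCompact.isBounded.subset_ball 0
    exact ⟨max R 1, by positivity, hR.trans (ball_subset_ball (le_max_left _ _))⟩
  obtain ⟨C, hC0, hcut⟩ := exists_isCutoffConstant
  -- Since θ = 1 on a ball containing the support of the test function, θu has the same positive
  -- part there, and θu is globally in L².
  obtain ⟨θ, hθ, hθ0, hθ1, hθe, hθz, hθc, hθg⟩ := hcut n 0 R (R + 1) hR0 (by linarith)
  have hθgrad : ∀ x ∈ ball (0 : EuclideanSpace ℝ (Fin n)) R, gradient θ x = 0 := by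
    intro x hx
    have : θ =ᶠ[𝓝 x] fun _ => 1 := by
      filter_upwards [isOpen_ball.mem_nhds hx] with y hy
      exact hθe y (ball_subset_closedBall hy)
    rw [this.gradient_eq]
    simp [gradient]
  have hcpt := isCompact_closedBall (0 : EuclideanSpace ℝ (Fin n)) (R + 1)
  have hloc : ∀ {F : Type} [NormedAddCommGroup F] [NormedSpace ℝ F]
      {a : EuclideanSpace ℝ (Fin n) → F}, Continuous a →
      (∀ x, x ∉ closedBall (0 : EuclideanSpace ℝ (Fin n)) (R + 1) → a x = 0) → ∀ C : ℝ,
      (∀ x, ‖a x‖ ≤ C) → MemLp (fun x => u x • a x) 2 volume := by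
    intro F _ _ a ha ha0 C haC
    have h1 : MemLp ((closedBall (0 : EuclideanSpace ℝ (Fin n)) (R + 1)).indicator
        (fun x => C * u x)) 2 volume :=
      (memLp_indicator_iff_restrict hcpt.measurableSet).2 ((hu _ hcpt).const_mul C)
    refine h1.of_le (hum.smul ha.aestronglyMeasurable) (Eventually.of_forall fun x => ?_)
    by_cases hx : x ∈ closedBall (0 : EuclideanSpace ℝ (Fin n)) (R + 1)
    · rw [Set.indicator_of_mem hx, norm_smul, norm_mul, mul_comm]
      gcongr
      exact (haC x).trans (le_abs_self _)
    · simp [ha0 x hx]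
  have hθz' : ∀ x, x ∉ closedBall (0 : EuclideanSpace ℝ (Fin n)) (R + 1) → θ x = 0 := fun x hx =>
    hθz x fun h' => hx (ball_subset_closedBall h')
  have hθgz : ∀ x, x ∉ closedBall (0 : EuclideanSpace ℝ (Fin n)) (R + 1) → gradient θ x = 0 := by
    intro x hx
    have : θ =ᶠ[𝓝 x] fun _ => 0 := by
      filter_upwards [isClosed_closedBall.isOpen_compl.mem_nhds hx] with y hy
      exact hθz' y hy
    rw [this.gradient_eq]
    simp [gradient]
  have hprod := h.mul_contDiff hθ
  have hL1 : MemLp (fun x => θ x * u x) 2 volume := by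
    have := hloc hθ.continuous hθz' 1 fun x => by
      rw [Real.norm_of_nonneg (hθ0 x)]; exact hθ1 x
    simpa [mul_comm] using this
  have hL2 : MemLp (fun x => θ x • G x + u x • gradient θ x) 2 volume := by
    refine MemLp.add (hG.of_le (hθ.continuous.aestronglyMeasurable.smul hG.1)
      (Eventually.of_forall fun x => ?_)) (hloc (continuous_gradient hθ) hθgz _ hθg)
    rw [norm_smul, Real.norm_of_nonneg (hθ0 x)]
    exact mul_le_of_le_one_left (norm_nonneg _) (hθ1 x)
  have hmain := (hprod.posPart_of_memLp hL1 hL2).2.2 φ hφ hc v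
  have hout : ∀ x, x ∉ ball (0 : EuclideanSpace ℝ (Fin n)) R → φ x = 0 ∧ fderiv ℝ φ x = 0 := by
    intro x hx
    exact ⟨image_eq_zero_of_notMem_tsupport fun h' => hx (hR h'),
      image_eq_zero_of_notMem_tsupport fun h' => hx (hR (tsupport_fderiv_subset ℝ h'))⟩
  have hone : ∀ x ∈ ball (0 : EuclideanSpace ℝ (Fin n)) R, θ x = 1 := fun x hx =>
    hθe x (ball_subset_closedBall hx)
  have e1 : ∀ x, posPartFun u x * fderiv ℝ φ x v =
      posPartFun (fun x => θ x * u x) x * fderiv ℝ φ x v := by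
    intro x
    by_cases hx : x ∈ ball (0 : EuclideanSpace ℝ (Fin n)) R
    · simp [posPartFun, hone x hx]
    · simp [(hout x hx).2]
  have e2 : ∀ x, φ x * inner ℝ ({x | 0 < u x}.indicator G x) v = φ x * inner ℝ
      ({x | 0 < θ x * u x}.indicator (fun x => θ x • G x + u x • gradient θ x) x) v := by
    intro x
    by_cases hx : x ∈ ball (0 : EuclideanSpace ℝ (Fin n)) R
    · by_cases hux : 0 < u x <;> simp [hone x hx, hθgrad x hx, Set.indicator, hux]
    · simp [(hout x hx).1]
  simp only [e1, e2]
  exact hmain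

end PositivePart

/-! ### Poincaré and Faber–Krahn inequalities by translation. -/

section Translation

variable {n : ℕ} {u : EuclideanSpace ℝ (Fin n) → ℝ}
  {G : EuclideanSpace ℝ (Fin n) → EuclideanSpace ℝ (Fin n)}

/-- The fundamental theorem of calculus along the segment from a to a + y, then Cauchy–Schwarz in t.
-/
theorem enorm_sub_sq_le_of_contDiff {v : EuclideanSpace ℝ (Fin n) → ℝ}
    {g : EuclideanSpace ℝ (Fin n) → EuclideanSpace ℝ (Fin n)} (hv : ContDiff ℝ ∞ v)
    (hg : Continuous g) (hvg : ∀ x w, fderiv ℝ v x w = inner ℝ (g x) w)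
    (a y : EuclideanSpace ℝ (Fin n)) :
    ‖v (a + y) - v a‖ₑ ^ 2 ≤ ‖y‖ₑ ^ 2 * ∫⁻ t in Set.Ioc (0 : ℝ) 1, ‖g (a + t • y)‖ₑ ^ 2 := by
  have hd : ∀ t : ℝ, HasDerivAt (fun t : ℝ => v (a + t • y)) (inner ℝ (g (a + t • y)) y) t := by
    intro t
    have h1 : HasDerivAt (fun t : ℝ => a + t • y) y t := by
      simpa using ((hasDerivAt_id t).smul_const y).const_add a
    have h2 := ((hv.differentiable (by simp)) (a + t • y)).hasFDerivAt.comp_hasDerivAt t h1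
    rwa [hvg] at h2
  have hgc : Continuous fun t : ℝ => g (a + t • y) := hg.comp (by fun_prop)
  have hc : Continuous fun t : ℝ => inner ℝ (g (a + t • y)) y := hgc.inner continuous_const
  have hFTC : ∫ t in (0 : ℝ)..1, inner ℝ (g (a + t • y)) y = v (a + y) - v a := by
    rw [intervalIntegral.integral_eq_sub_of_hasDerivAt (fun t _ => hd t)
      (hc.intervalIntegrable _ _)]
    simp
  rw [intervalIntegral.integral_of_le zero_le_one] at hFTC
  have h1 : ‖v (a + y) - v a‖ₑ ≤ ‖y‖ₑ * ∫⁻ t in Set.Ioc (0 : ℝ) 1, 1 * ‖g (a + t • y)‖ₑ := by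
    rw [← hFTC, ← lintegral_const_mul' _ _ enorm_ne_top]
    refine (enorm_integral_le_lintegral_enorm _).trans (lintegral_mono fun t => ?_)
    rw [one_mul, mul_comm]
    have := norm_inner_le_norm (𝕜 := ℝ) (g (a + t • y)) y
    rw [← ofReal_norm, ← ofReal_norm, ← ofReal_norm, ← ENNReal.ofReal_mul (norm_nonneg _)]
    exact ENNReal.ofReal_le_ofReal this
  calc _ ≤ _ := pow_le_pow_left' h1 2
    _ ≤ _ := by
      rw [mul_pow]
      gcongr
      have := sq_lintegral_mul_le_of_weight (μ := volume.restrict (Set.Ioc (0 : ℝ) 1))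
        (w := fun _ => 1) (a := fun t => ‖g (a + t • y)‖ₑ) aemeasurable_const
        hgc.measurable.enorm.aemeasurable
      simpa using this

/-- The `L²` modulus of continuity of a function is controlled by its gradient. -/
theorem HasWeakGrad.lintegral_translate_sub_sq_le (h : HasWeakGrad u G) (hG : MemLp G 2 volume)
    {C : Set (EuclideanSpace ℝ (Fin n))} (hC : Convex ℝ C) (hCm : MeasurableSet C)
    (y : EuclideanSpace ℝ (Fin n)) :
    ∫⁻ a in {a | a ∈ C ∧ a + y ∈ C}, ‖u (a + y) - u a‖ₑ ^ 2 ≤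
      ‖y‖ₑ ^ 2 * ∫⁻ a in C, ‖G a‖ₑ ^ 2 := by
  set D := {a | a ∈ C ∧ a + y ∈ C} with hD
  have hDm : MeasurableSet D := hCm.inter ((measurable_add_const y) hCm)
  have hsmooth : ∀ k, ∫⁻ a in D, ‖mollify k u (a + y) - mollify k u a‖ₑ ^ 2 ≤
      ‖y‖ₑ ^ 2 * ∫⁻ a in C, ‖mollify k G a‖ₑ ^ 2 := by
    intro k
    have hgc := (contDiff_mollify k h.2.1).continuous
    calc _ ≤ ∫⁻ a in D, ‖y‖ₑ ^ 2 * ∫⁻ t in Set.Ioc (0 : ℝ) 1, ‖mollify k G (a + t • y)‖ₑ ^ 2 :=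
          lintegral_mono fun a =>
            enorm_sub_sq_le_of_contDiff (contDiff_mollify k h.1) hgc (h.fderiv_mollify k) a y
      _ = ‖y‖ₑ ^ 2 * ∫⁻ t in Set.Ioc (0 : ℝ) 1, ∫⁻ a in D, ‖mollify k G (a + t • y)‖ₑ ^ 2 := by
        rw [lintegral_const_mul' _ _ (by simp), lintegral_lintegral_swap]
        refine Measurable.aemeasurable ?_
        refine Measurable.pow_const ?_ 2
        refine Measurable.enorm (Continuous.measurable ?_)
        exact hgc.comp (by fun_prop)
      _ ≤ ‖y‖ₑ ^ 2 * ∫⁻ t in Set.Ioc (0 : ℝ) 1, ∫⁻ a in C, ‖mollify k G a‖ₑ ^ 2 := by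
        refine mul_le_mul_right ?_ _
        refine setLIntegral_mono' (measurableSet_Ioc (a := (0 : ℝ)) (b := 1)) fun t ht => ?_
        -- By convexity the whole segment stays in C, so translating by ty maps the domain of
        -- integration into C.
        rw [← lintegral_indicator hDm, ← lintegral_indicator hCm,
          ← lintegral_add_right_eq_self (C.indicator fun a => ‖mollify k G a‖ₑ ^ 2) (t • y)]
        refine lintegral_mono fun a => ?_
        by_cases ha : a ∈ D
        · have : a + t • y ∈ C := hC.add_smul_mem ha.1 ha.2 ⟨ht.1.le, ht.2⟩
          simp [ha, this]
        · simp [ha]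
      _ = _ := by simp
  -- Mollifying G on C uses values of G outside of C; the excess is controlled by the global L²
  -- convergence and disappears in the limit.
  have hGk : ∀ k, ∫⁻ a in C, ‖mollify k G a‖ₑ ^ 2 ≤
      (eLpNorm G 2 (volume.restrict C) + eLpNorm (mollify k G - G) 2 volume) ^ 2 := by
    intro k
    rw [← eLpNorm_two_sq]
    gcongr
    have h1 : mollify k G = G + (mollify k G - G) := by simp
    calc eLpNorm (mollify k G) 2 (volume.restrict C)
        = eLpNorm (G + (mollify k G - G)) 2 (volume.restrict C) := by rw [← h1]
      _ ≤ _ := eLpNorm_add_le hG.1.restrict ((memLp_mollify k hG).1.sub hG.1).restrict (by norm_num)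
      _ ≤ _ := by
        gcongr
        exact Measure.restrict_le_self
  have hlim : Tendsto (fun k => ‖y‖ₑ ^ 2 *
      (eLpNorm G 2 (volume.restrict C) + eLpNorm (mollify k G - G) 2 volume) ^ 2) atTop
      (𝓝 (‖y‖ₑ ^ 2 * (eLpNorm G 2 (volume.restrict C) + 0) ^ 2)) := by
    refine ENNReal.Tendsto.const_mul ?_ (Or.inr (by simp))
    exact (ENNReal.continuous_pow 2).continuousAt.tendsto.comp
      (tendsto_const_nhds.add (tendsto_eLpNorm_mollify_sub hG))
  have hae := ae_tendsto_mollify h.1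
  have hae' : ∀ᵐ a ∂volume, Tendsto (fun k => mollify k u (a + y)) atTop (𝓝 (u (a + y))) :=
    (measurePreserving_add_right volume y).quasiMeasurePreserving.ae hae
  have hmeas : ∀ k, Measurable fun a => ‖mollify k u (a + y) - mollify k u a‖ₑ ^ 2 := fun k => by
    have hc := (contDiff_mollify k h.1).continuous
    exact ((hc.comp (by fun_prop)).sub hc).measurable.enorm.pow_const 2
  calc ∫⁻ a in D, ‖u (a + y) - u a‖ₑ ^ 2
      ≤ ∫⁻ a in D, liminf (fun k => ‖mollify k u (a + y) - mollify k u a‖ₑ ^ 2) atTop := by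
        refine lintegral_mono_ae (ae_restrict_of_ae ?_)
        filter_upwards [hae, hae'] with a h1 h2
        refine le_of_eq (Tendsto.liminf_eq ?_).symm
        exact (ENNReal.continuous_pow 2).continuousAt.tendsto.comp (h2.sub h1).enorm
    _ ≤ liminf (fun k => ∫⁻ a in D, ‖mollify k u (a + y) - mollify k u a‖ₑ ^ 2) atTop :=
        lintegral_liminf_le hmeas
    _ ≤ liminf (fun k => ‖y‖ₑ ^ 2 *
      (eLpNorm G 2 (volume.restrict C) + eLpNorm (mollify k G - G) 2 volume) ^ 2) atTop :=
        liminf_le_liminf (Eventually.of_forall fun k => (hsmooth k).trans (by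
          gcongr; exact hGk k))
    _ = _ := by rw [hlim.liminf_eq, add_zero, eLpNorm_two_sq]

theorem enorm_sq_le_two_mul_sub_sq_add (a b : ℝ) {M : ℝ≥0} (hb : |b| ≤ M) :
    ‖a‖ₑ ^ 2 ≤ 2 * ‖b - a‖ₑ ^ 2 + 2 * (M : ℝ≥0∞) ^ 2 := by
  have h : ‖a‖ ^ 2 ≤ 2 * ‖b - a‖ ^ 2 + 2 * (M : ℝ) ^ 2 := by
    simp only [Real.norm_eq_abs, sq_abs]
    have := sq_le_sq' (by linarith [abs_le.1 hb |>.1]) (abs_le.1 hb).2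
    nlinarith [sq_nonneg (a - 2 * b)]
  have := ENNReal.ofReal_le_ofReal h
  rw [ENNReal.ofReal_add (by positivity) (by positivity), ENNReal.ofReal_mul (by norm_num),
    ENNReal.ofReal_mul (by norm_num), ENNReal.ofReal_pow (norm_nonneg _),
    ENNReal.ofReal_pow (norm_nonneg _), ENNReal.ofReal_pow M.coe_nonneg, ofReal_norm,
    ofReal_norm, ENNReal.ofReal_coe_nnreal] at this
  simpa using this

/-- A Poincaré inequality for functions that are bounded by `M` on a set `T ⊆ C` which meets many
of the translates of `Y`. -/
theorem HasWeakGrad.poincare (h : HasWeakGrad u G) (hG : MemLp G 2 volume)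
    {C T Y : Set (EuclideanSpace ℝ (Fin n))} (hC : Convex ℝ C) (hCm : MeasurableSet C)
    (hTm : MeasurableSet T) (hTC : T ⊆ C) (hYm : MeasurableSet Y) {R M : ℝ≥0} {m : ℝ≥0∞}
    (hY : ∀ y ∈ Y, ‖y‖ ≤ R) (hm : ∀ a ∈ C, m ≤ volume {y | y ∈ Y ∧ a + y ∈ T})
    (hT : ∀ a ∈ T, |u a| ≤ M) :
    m * ∫⁻ a in C, ‖u a‖ₑ ^ 2 ≤ 2 * (volume Y * (R : ℝ≥0∞) ^ 2 * ∫⁻ a in C, ‖G a‖ₑ ^ 2) +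
      2 * (M : ℝ≥0∞) ^ 2 * (volume T * volume C) := by
  have hum : AEStronglyMeasurable u volume := h.1.aestronglyMeasurable
  set D : Set (EuclideanSpace ℝ (Fin n) × EuclideanSpace ℝ (Fin n)) :=
    {p | p.1 ∈ C ∧ p.2 ∈ Y ∧ p.1 + p.2 ∈ C} with hD
  have hDm : MeasurableSet D := (measurable_fst hCm).inter
    ((measurable_snd hYm).inter (measurable_add hCm))
  set I : EuclideanSpace ℝ (Fin n) → EuclideanSpace ℝ (Fin n) → ℝ≥0∞ := fun a y =>
    D.indicator (fun p => ‖u (p.1 + p.2) - u p.1‖ₑ ^ 2) (a, y) with hI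
  have hIm : AEMeasurable (Function.uncurry I) (volume.prod volume) := by
    refine AEMeasurable.indicator ?_ hDm
    refine (AEStronglyMeasurable.enorm ?_).pow_const 2
    exact (hum.comp_quasiMeasurePreserving (quasiMeasurePreserving_add volume volume)).sub
      (hum.comp_quasiMeasurePreserving Measure.quasiMeasurePreserving_fst)
  -- Compare u(a) with u(a + y) for those y ∈ Y with a + y ∈ T: there |u(a + y)| ≤ M, and these y
  -- fill at least measure m. Integrating in a and exchanging the integrals leaves the L²
  -- differences of translates, one for each y.
  have hpt : ∀ a ∈ C, m * ‖u a‖ₑ ^ 2 ≤ 2 * (∫⁻ y, I a y) + 2 * (M : ℝ≥0∞) ^ 2 * volume T := by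
    intro a ha
    set Z := {y | y ∈ Y ∧ a + y ∈ T} with hZ
    have hZm : MeasurableSet Z := hYm.inter ((measurable_const_add a) hTm)
    have hZT : volume Z ≤ volume T := by
      rw [← measure_preimage_add volume a T]
      exact measure_mono fun y hy => hy.2
    calc m * ‖u a‖ₑ ^ 2 ≤ volume Z * ‖u a‖ₑ ^ 2 := by gcongr; exact hm a ha
      _ = ∫⁻ y in Z, ‖u a‖ₑ ^ 2 := by rw [setLIntegral_const, mul_comm]
      _ ≤ ∫⁻ y in Z, (2 * I a y + 2 * (M : ℝ≥0∞) ^ 2) := by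
        refine setLIntegral_mono' hZm fun y hy => ?_
        have : (a, y) ∈ D := ⟨ha, hy.1, hTC hy.2⟩
        simp only [hI, this, Set.indicator_of_mem]
        exact enorm_sq_le_two_mul_sub_sq_add _ _ (hT _ hy.2)
      _ = 2 * (∫⁻ y in Z, I a y) + 2 * (M : ℝ≥0∞) ^ 2 * volume Z := by
        rw [lintegral_add_right _ measurable_const, lintegral_const_mul' _ _ (by norm_num),
          setLIntegral_const]
      _ ≤ _ := by
        gcongr
        exact Measure.restrict_le_self
  calc m * ∫⁻ a in C, ‖u a‖ₑ ^ 2 = ∫⁻ a in C, m * ‖u a‖ₑ ^ 2 := by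
        rw [lintegral_const_mul'' _ (hum.restrict.enorm.pow_const 2)]
    _ ≤ ∫⁻ a in C, (2 * (∫⁻ y, I a y) + 2 * (M : ℝ≥0∞) ^ 2 * volume T) :=
        setLIntegral_mono' hCm hpt
    _ = 2 * (∫⁻ a in C, ∫⁻ y, I a y) + 2 * (M : ℝ≥0∞) ^ 2 * volume T * volume C := by
        rw [lintegral_add_right _ measurable_const, lintegral_const_mul' _ _ (by norm_num),
          setLIntegral_const]
    _ ≤ 2 * (∫⁻ a, ∫⁻ y, I a y) + 2 * (M : ℝ≥0∞) ^ 2 * volume T * volume C := by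
        gcongr
        exact Measure.restrict_le_self
    _ = 2 * (∫⁻ y, ∫⁻ a, I a y) + 2 * (M : ℝ≥0∞) ^ 2 * volume T * volume C := by
        rw [lintegral_lintegral_swap hIm]
    _ ≤ 2 * (∫⁻ y, Y.indicator (fun _ => (R : ℝ≥0∞) ^ 2 * ∫⁻ a in C, ‖G a‖ₑ ^ 2) y) +
          2 * (M : ℝ≥0∞) ^ 2 * volume T * volume C := by
        gcongr with y
        by_cases hy : y ∈ Y
        · have hE : MeasurableSet {a | a ∈ C ∧ a + y ∈ C} :=
            hCm.inter ((measurable_add_const y) hCm)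
          have e : ∫⁻ a, I a y = ∫⁻ a in {a | a ∈ C ∧ a + y ∈ C}, ‖u (a + y) - u a‖ₑ ^ 2 := by
            rw [← lintegral_indicator hE]
            refine lintegral_congr fun a => ?_
            by_cases ha : a ∈ {a | a ∈ C ∧ a + y ∈ C}
            · rw [Set.indicator_of_mem ha]
              exact Set.indicator_of_mem (s := D) (a := (a, y)) ⟨ha.1, hy, ha.2⟩ _
            · rw [Set.indicator_of_notMem ha]
              exact Set.indicator_of_notMem (s := D) (a := (a, y)) (fun h => ha ⟨h.1, h.2.2⟩) _
          rw [Set.indicator_of_mem hy, e]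
          refine (h.lintegral_translate_sub_sq_le hG hC hCm y).trans ?_
          gcongr
          rw [← ofReal_norm, ← ENNReal.ofReal_coe_nnreal]
          exact ENNReal.ofReal_le_ofReal (hY y hy)
        · simp [hI, hD, hy]
    _ = _ := by
        rw [lintegral_indicator hYm, setLIntegral_const]
        ring

/-- The Faber–Krahn inequality, with a non optimal constant. -/
theorem HasWeakGrad.faberKrahn (h : HasWeakGrad u G) (hG : MemLp G 2 volume)
    {S : Set (EuclideanSpace ℝ (Fin n))} (hS : MeasurableSet S) (hu : ∀ a, a ∉ S → u a = 0)
    {R : ℝ≥0} (hSR : 2 * volume S ≤ volume (closedBall (0 : EuclideanSpace ℝ (Fin n)) R))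
    (hR : 0 < R) :
    ∫⁻ a, ‖u a‖ₑ ^ 2 ≤ 4 * (R : ℝ≥0∞) ^ 2 * ∫⁻ a, ‖G a‖ₑ ^ 2 := by
  set V := volume (closedBall (0 : EuclideanSpace ℝ (Fin n)) R) with hV
  have hVtop : V ≠ ⊤ := measure_closedBall_lt_top.ne
  have hV0 : V ≠ 0 := (measure_closedBall_pos _ _ (by exact_mod_cast hR)).ne'
  have hSV : volume S ≤ V / 2 := by
    rw [ENNReal.le_div_iff_mul_le (by simp) (by simp), mul_comm]
    exact hSR
  have hStop : volume S ≠ ⊤ := ne_top_of_le_ne_top (by finiteness) hSV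
  -- The ball Y has at least twice the volume of S, so every translate of it has at least half of
  -- its volume outside S, where u = 0. With M = 0 the last term of the inequality is zero even
  -- though T and C have infinite measure.
  have key := h.poincare hG (C := Set.univ) (T := Sᶜ)
    (Y := closedBall (0 : EuclideanSpace ℝ (Fin n)) R) (R := R) (M := 0) (m := V / 2) convex_univ
    MeasurableSet.univ hS.compl (Set.subset_univ _) measurableSet_closedBall
    (fun y hy => by simpa using hy) (fun a _ => ?_) (fun a ha => by simp [hu a ha])
  · simp only [Measure.restrict_univ, ENNReal.coe_zero] at key
    rw [zero_pow (by norm_num), mul_zero, zero_mul, add_zero, ← hV] at key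
    have h2 : V / 2 * ∫⁻ a, ‖u a‖ₑ ^ 2 ≤
        V / 2 * (4 * (R : ℝ≥0∞) ^ 2 * ∫⁻ a, ‖G a‖ₑ ^ 2) := by
      refine key.trans (le_of_eq ?_)
      have : V = V / 2 * 2 := (ENNReal.div_mul_cancel (by simp) (by simp)).symm
      conv_lhs => rw [this]
      ring
    exact (ENNReal.mul_le_mul_iff_right (by simpa using hV0)
      (ENNReal.div_ne_top hVtop (by simp))).1 h2
  · have e1 : volume ((fun y => a + y) ⁻¹' S) = volume S := measure_preimage_add volume a S
    have e2 : {y | y ∈ closedBall (0 : EuclideanSpace ℝ (Fin n)) R ∧ a + y ∈ Sᶜ} =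
        closedBall 0 R \ ((fun y => a + y) ⁻¹' S) := rfl
    rw [e2]
    refine le_trans ?_ (le_measure_sdiff)
    rw [e1, ← hV]
    refine ENNReal.le_sub_of_add_le_left hStop ?_
    calc volume S + V / 2 ≤ V / 2 + V / 2 := by gcongr
      _ = V := ENNReal.add_halves V

end Translation

/-! ### Competitors within W^{1,2}, and the pointwise cutoff inequality. -/

section SobolevClass

variable {n : ℕ} {u q : EuclideanSpace ℝ (Fin n) → ℝ}
  {G H : EuclideanSpace ℝ (Fin n) → EuclideanSpace ℝ (Fin n)}

theorem MemW12.hasWeakGrad_weakGrad (h : MemW12 u) : HasWeakGrad u (weakGrad u) := by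
  rw [weakGrad, dif_pos h]
  exact h.2.choose_spec.2

theorem MemW12.memLp_weakGrad (h : MemW12 u) : MemLp (weakGrad u) 2 volume := by
  rw [weakGrad, dif_pos h]
  exact h.2.choose_spec.1

theorem MemW12.weakGrad_ae_eq (h : MemW12 u) (hG : HasWeakGrad u G) :
    weakGrad u =ᵐ[volume] G :=
  h.hasWeakGrad_weakGrad.ae_eq hG

theorem memLp_smul_of_hasCompactSupport {F : Type*} [NormedAddCommGroup F] [NormedSpace ℝ F]
    (hum : AEStronglyMeasurable u volume)
    (hu : ∀ K : Set (EuclideanSpace ℝ (Fin n)), IsCompact K → MemLp u 2 (volume.restrict K))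
    {a : EuclideanSpace ℝ (Fin n) → F} (ha : Continuous a) (hc : HasCompactSupport a) :
    MemLp (fun x => u x • a x) 2 volume := by
  obtain ⟨C, hC⟩ := ha.bounded_above_of_compact_support hc
  have hm : MeasurableSet (tsupport a) := (isClosed_tsupport a).measurableSet
  have h1 : MemLp ((tsupport a).indicator (fun x => C * u x)) 2 volume :=
    (memLp_indicator_iff_restrict hm).2 ((hu _ hc).const_mul C)
  refine h1.of_le (hum.smul ha.aestronglyMeasurable) (Eventually.of_forall fun x => ?_)
  by_cases hx : x ∈ tsupport a
  · rw [Set.indicator_of_mem hx, norm_smul, norm_mul, mul_comm]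
    gcongr
    exact (hC x).trans (le_abs_self _)
  · simp [image_eq_zero_of_notMem_tsupport hx]

theorem memLp_smul_of_bounded {F : Type*} [NormedAddCommGroup F] [NormedSpace ℝ F]
    {b : EuclideanSpace ℝ (Fin n) → F} (hb : MemLp b 2 volume)
    {a : EuclideanSpace ℝ (Fin n) → ℝ} (ha : Continuous a) (hc : HasCompactSupport a) :
    MemLp (fun x => a x • b x) 2 volume := by
  obtain ⟨C, hC⟩ := ha.bounded_above_of_compact_support hc
  refine (hb.const_smul C).of_le (ha.aestronglyMeasurable.smul hb.1)
    (Eventually.of_forall fun x => ?_)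
  rw [norm_smul, Pi.smul_apply, norm_smul]
  gcongr
  exact (hC x).trans (le_abs_self _)

theorem memLp_restrict_of_hasCompactSupport {F : Type*} [NormedAddCommGroup F]
    {a : EuclideanSpace ℝ (Fin n) → F} (ha : Continuous a) (hc : HasCompactSupport a)
    (K : Set (EuclideanSpace ℝ (Fin n))) : MemLp a 2 (volume.restrict K) :=
  (ha.memLp_of_hasCompactSupport hc).restrict K

theorem MemW12.posPart (h : MemW12 u) : MemW12 (posPartFun u) ∧
    HasWeakGrad (posPartFun u) ({x | 0 < u x}.indicator (weakGrad u)) := by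
  have h1 := h.hasWeakGrad_weakGrad.posPart h.1 h.memLp_weakGrad
  have hum := h.hasWeakGrad_weakGrad.1.aestronglyMeasurable
  refine ⟨⟨fun K hK => ?_, _, ?_, h1⟩, h1⟩
  · refine (h.1 K hK).of_le (aestronglyMeasurable_const.sup hum).restrict
      (Eventually.of_forall fun x => ?_)
    rw [posPartFun, Real.norm_of_nonneg (le_max_left _ _)]
    exact max_le (norm_nonneg _) (le_abs_self _)
  · refine h.memLp_weakGrad.of_le (h.memLp_weakGrad.1.indicator₀
      (AEStronglyMeasurable.nullMeasurableSet_pos hum)) (Eventually.of_forall fun x => ?_)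
    exact norm_indicator_le_norm_self _ _

theorem MemW12.sub_mul (h : MemW12 u) (hq : MemW12 q) (hqH : HasWeakGrad q H)
    {ζ : EuclideanSpace ℝ (Fin n) → ℝ} (hζ : ContDiff ℝ ∞ ζ) (hc : HasCompactSupport ζ) :
    MemW12 (fun x => u x - ζ x * q x) ∧ weakGrad (fun x => u x - ζ x * q x) =ᵐ[volume]
      fun x => weakGrad u x - (ζ x • H x + q x • gradient ζ x) := by
  have hH : MemLp H 2 volume := hq.memLp_weakGrad.ae_eq (hq.weakGrad_ae_eq hqH)
  have h1 := h.hasWeakGrad_weakGrad.sub (hqH.mul_contDiff hζ)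
  have h2 : MemW12 (fun x => u x - ζ x * q x) := by
    refine ⟨fun K hK => (h.1 K hK).sub ?_, _, ?_, h1⟩
    · have := memLp_smul_of_hasCompactSupport hqH.1.aestronglyMeasurable hq.1 hζ.continuous hc
      simpa [mul_comm] using this.restrict K
    · refine h.memLp_weakGrad.sub (MemLp.add ?_ ?_)
      · exact memLp_smul_of_bounded hH hζ.continuous hc
      · exact memLp_smul_of_hasCompactSupport hqH.1.aestronglyMeasurable hq.1
          (continuous_gradient hζ) (gradient_hasCompactSupport hc)
  exact ⟨h2, h2.weakGrad_ae_eq h1⟩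

theorem MemW12.add_const_mul (h : MemW12 u) {Φ : EuclideanSpace ℝ (Fin n) → ℝ}
    (hΦ : ContDiff ℝ ∞ Φ) (hc : HasCompactSupport Φ) (t : ℝ) :
    MemW12 (fun x => u x + t * Φ x) ∧ weakGrad (fun x => u x + t * Φ x) =ᵐ[volume]
      fun x => weakGrad u x + t • gradient Φ x := by
  have h1 := h.hasWeakGrad_weakGrad.add ((hasWeakGrad_of_contDiff hΦ).const_mul t)
  have h2 : MemW12 (fun x => u x + t * Φ x) := by
    refine ⟨fun K hK => (h.1 K hK).add
      ((memLp_restrict_of_hasCompactSupport hΦ.continuous hc K).const_mul t), _, ?_, h1⟩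
    exact h.memLp_weakGrad.add (((continuous_gradient hΦ).memLp_of_hasCompactSupport
      (gradient_hasCompactSupport hc)).const_smul t)
  exact ⟨h2, h2.weakGrad_ae_eq h1⟩

theorem gradient_sq {ξ : EuclideanSpace ℝ (Fin n) → ℝ} (hξ : ContDiff ℝ ∞ ξ)
    (x : EuclideanSpace ℝ (Fin n)) :
    gradient (fun x => ξ x ^ 2) x = (2 * ξ x) • gradient ξ x := by
  refine ext_inner_right ℝ fun v => ?_
  have h := ((hξ.differentiable (by simp) x).hasFDerivAt.pow 2).fderiv
  rw [inner_gradient_left, inner_smul_left, inner_gradient_left, h]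
  simp

/-- The pointwise core of the Caccioppoli inequality: g, v, s, k stand for ∇u, u, ξ, ∇ξ. Since (1 -
s²)² ≤ 1 - s², the cutoff gains s²|g|². Young's inequality spends half of it on the cross term, at
the price 8D²v², and the square of the last term adds 4D²v². Cutting with ξ² rather than ξ puts the
factor s in the cross term that makes this absorption possible. -/
theorem sq_norm_cutoff_le {E : Type*} [NormedAddCommGroup E] [InnerProductSpace ℝ E] (g k : E)
    (v s D : ℝ) (hs0 : 0 ≤ s) (hs1 : s ≤ 1) (hk : ‖k‖ ≤ D) :
    ‖g - (s ^ 2 • g + v • ((2 * s) • k))‖ ^ 2 ≤ ‖g‖ ^ 2 - s ^ 2 * ‖g‖ ^ 2 / 2 + 12 * D ^ 2 * v ^ 2 := by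
  have h1 : ‖g - (s ^ 2 • g + v • ((2 * s) • k))‖ ≤ (1 - s ^ 2) * ‖g‖ + 2 * s * |v| * D := by
    have e : g - (s ^ 2 • g + v • ((2 * s) • k)) = (1 - s ^ 2) • g - (v * (2 * s)) • k := by
      rw [sub_smul, one_smul, smul_smul]; abel
    rw [e]
    refine (norm_sub_le _ _).trans ?_
    rw [norm_smul, norm_smul, Real.norm_of_nonneg (by nlinarith : (0 : ℝ) ≤ 1 - s ^ 2),
      Real.norm_eq_abs, abs_mul, abs_of_nonneg (by linarith : (0 : ℝ) ≤ 2 * s)]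
    have : |v| * (2 * s) * ‖k‖ ≤ |v| * (2 * s) * D := by gcongr
    linarith
  have hD : 0 ≤ D := (norm_nonneg k).trans hk
  have h2 : (1 - s ^ 2) * ‖g‖ + 2 * s * |v| * D ≥ 0 := (norm_nonneg _).trans h1
  have hv : |v| ^ 2 = v ^ 2 := sq_abs v
  have ha := norm_nonneg g
  calc _ ≤ ((1 - s ^ 2) * ‖g‖ + 2 * s * |v| * D) ^ 2 := by gcongr
    _ = (1 - s ^ 2) ^ 2 * ‖g‖ ^ 2 + 2 * ((1 - s ^ 2) * (s * ‖g‖)) * (2 * (|v| * D))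
        + 4 * s ^ 2 * (D ^ 2 * v ^ 2) := by rw [← hv]; ring
    _ ≤ (1 - s ^ 2) * ‖g‖ ^ 2 + (s ^ 2 * ‖g‖ ^ 2 / 2 + 8 * (D ^ 2 * v ^ 2))
        + 4 * (D ^ 2 * v ^ 2) := by
      gcongr ?_ + ?_ + ?_
      · have : (1 - s ^ 2) ^ 2 ≤ 1 - s ^ 2 := by
          have h0 : 0 ≤ s ^ 2 * (1 - s ^ 2) := mul_nonneg (sq_nonneg _) (by nlinarith)
          nlinarith
        gcongr
      · have h3 : (1 - s ^ 2) * (s * ‖g‖) ≤ s * ‖g‖ := by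
          refine mul_le_of_le_one_left (by positivity) (by nlinarith)
        have h4 : 2 * ((1 - s ^ 2) * (s * ‖g‖)) * (2 * (|v| * D)) ≤
            2 * (s * ‖g‖) * (2 * (|v| * D)) := by gcongr
        have h5 : 0 ≤ (s * ‖g‖ - 4 * (|v| * D)) ^ 2 := sq_nonneg _
        rw [← hv]
        nlinarith
      · have : s ^ 2 ≤ 1 := by nlinarith
        have h6 : 0 ≤ D ^ 2 * v ^ 2 := by positivity
        nlinarith
    _ = _ := by ring

end SobolevClass

/-! ### The cost of a single component, and how it reacts to perturbations. -/

namespace FBProblem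

variable {n N : ℕ} (P : FBProblem n N)

/-- The contribution of the component `v = u_j` to the functional. -/
noncomputable def cost (j : Fin N) (v : EuclideanSpace ℝ (Fin n) → ℝ) : ℝ :=
  (∫ x, ‖weakGrad v x‖ ^ 2) + ∫ x in P.Ω, (v x ^ 2 * P.f j x - v x * P.g j x)

theorem J_eq_sum_cost (u : Fin N → EuclideanSpace ℝ (Fin n) → ℝ)
    (W : Fin N → Set (EuclideanSpace ℝ (Fin n))) :
    P.J u W = (∑ j, P.cost j (u j)) + P.F W := by
  simp only [J, energy, M, cost, Finset.sum_add_distrib]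

variable {P} {j : Fin N} {Kf Kg : ℝ}

theorem integrable_mul_of_boundedOn {h a : EuclideanSpace ℝ (Fin n) → ℝ} {K : ℝ}
    (hh : P.BoundedOn h K) (ha : Integrable a volume) :
    IntegrableOn (fun x => a x * h x) P.Ω volume :=
  ha.restrict.mul_bdd hh.1 hh.2

/-- The effect on the cost of cutting off the restriction `q` of `v` to a set `S`. -/
theorem cost_sub_mul_le (hf : P.BoundedOn (P.f j) Kf) (hg : P.BoundedOn (P.g j) Kg) (hKf : 0 ≤ Kf)
    (hKg : 0 ≤ Kg) {v q : EuclideanSpace ℝ (Fin n) → ℝ} {S : Set (EuclideanSpace ℝ (Fin n))}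
    (hv : MemW12 v) (hconv : IntegrableOn (fun x => v x ^ 2 * P.f j x - v x * P.g j x) P.Ω volume)
    (hqS : q = S.indicator v) (hq : MemW12 q) (hqH : HasWeakGrad q (S.indicator (weakGrad v)))
    {ξ : EuclideanSpace ℝ (Fin n) → ℝ} (hξ : ContDiff ℝ ∞ ξ) (hξ0 : ∀ x, 0 ≤ ξ x)
    (hξ1 : ∀ x, ξ x ≤ 1) (hξc : HasCompactSupport ξ) {D : ℝ} (hD : ∀ x, ‖gradient ξ x‖ ≤ D)
    {z : EuclideanSpace ℝ (Fin n)} {s s' : ℝ} (hξs : ∀ x ∈ closedBall z s, ξ x = 1)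
    (hξs' : ∀ x, x ∉ ball z s' → ξ x = 0) :
    MemW12 (fun x => v x - ξ x ^ 2 * q x) ∧
    IntegrableOn (fun x => (v x - ξ x ^ 2 * q x) ^ 2 * P.f j x - (v x - ξ x ^ 2 * q x) * P.g j x)
      P.Ω volume ∧
    P.cost j (fun x => v x - ξ x ^ 2 * q x) + (∫ x in ball z s, ‖weakGrad q x‖ ^ 2) / 2 ≤
      P.cost j v + (12 * D ^ 2 + Kf) * (∫ x in ball z s', q x ^ 2) +
        Kg * ∫ x in ball z s', |q x| := by
  have hζ : ContDiff ℝ ∞ (fun x => ξ x ^ 2) := hξ.pow 2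
  have hζc : HasCompactSupport (fun x => ξ x ^ 2) :=
    hξc.comp_left (g := fun t : ℝ => t ^ 2) (by norm_num)
  obtain ⟨hw, hwg⟩ := hv.sub_mul hq hqH hζ hζc
  have hD0 : 0 ≤ D := (norm_nonneg _).trans (hD z)
  have hqm : AEStronglyMeasurable q volume := hqH.1.aestronglyMeasurable
  have hqL : MemLp q 2 (volume.restrict (ball z s')) :=
    (hq.1 _ (isCompact_closedBall z s')).mono_measure
      (Measure.restrict_mono ball_subset_closedBall le_rfl)
  have hq2 : IntegrableOn (fun x => q x ^ 2) (ball z s') volume := hqL.integrable_sq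
  have hq1 : IntegrableOn (fun x => |q x|) (ball z s') volume := by
    have : IsFiniteMeasure (volume.restrict (ball z s')) := ⟨by simp [measure_ball_lt_top]⟩
    exact (hqL.integrable (by norm_num)).norm
  have hind2 : Integrable ((ball z s').indicator fun x => q x ^ 2) volume :=
    hq2.integrable_indicator measurableSet_ball
  have hind1 : Integrable ((ball z s').indicator fun x => |q x|) volume :=
    hq1.integrable_indicator measurableSet_ball
  -- the zero order terms
  set a : EuclideanSpace ℝ (Fin n) → ℝ := fun x => (ξ x ^ 2 * ξ x ^ 2 - 2 * ξ x ^ 2) * q x ^ 2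
  set b : EuclideanSpace ℝ (Fin n) → ℝ := fun x => ξ x ^ 2 * q x
  have hξsq : ∀ x, ξ x ^ 2 ≤ 1 := fun x => pow_le_one₀ (hξ0 x) (hξ1 x)
  have ha_le : ∀ x, |a x| ≤ (ball z s').indicator (fun x => q x ^ 2) x := by
    intro x
    by_cases hx : x ∈ ball z s'
    · rw [Set.indicator_of_mem hx, abs_mul, abs_of_nonneg (sq_nonneg (q x))]
      refine mul_le_of_le_one_left (sq_nonneg _) (abs_le.2 ⟨?_, ?_⟩) <;>
        nlinarith [sq_nonneg (ξ x), hξsq x, sq_nonneg (1 - ξ x ^ 2)]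
    · rw [Set.indicator_of_notMem hx]; simp [a, hξs' x hx]
  have hb_le : ∀ x, |b x| ≤ (ball z s').indicator (fun x => |q x|) x := by
    intro x
    by_cases hx : x ∈ ball z s'
    · rw [Set.indicator_of_mem hx, abs_mul, abs_of_nonneg (sq_nonneg (ξ x))]
      exact mul_le_of_le_one_left (abs_nonneg _) (hξsq x)
    · rw [Set.indicator_of_notMem hx]; simp [b, hξs' x hx]
  have hξcont := hξ.continuous
  have haI : Integrable a volume := hind2.mono'
    ((Continuous.aestronglyMeasurable (by fun_prop)).mul (hqm.pow 2)) (Eventually.of_forall ha_le)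
  have hbI : Integrable b volume := hind1.mono'
    ((Continuous.aestronglyMeasurable (by fun_prop)).mul hqm) (Eventually.of_forall hb_le)
  -- Because q is the restriction of v to S, the quadratic term changes by (ξ⁴ - 2ξ²)q², whose
  -- coefficient lies in [-1, 0].
  have hqv : ∀ x, q x * v x = q x ^ 2 := by
    intro x
    rw [hqS]
    by_cases hx : x ∈ S
    · simp [hx, sq]
    · simp [hx]
  have hdec : ∀ x, (v x - ξ x ^ 2 * q x) ^ 2 * P.f j x - (v x - ξ x ^ 2 * q x) * P.g j x =
      (v x ^ 2 * P.f j x - v x * P.g j x) + (a x * P.f j x + b x * P.g j x) := by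
    intro x
    simp only [a, b]
    linear_combination (-2 * ξ x ^ 2 * P.f j x) * hqv x
  have hab : IntegrableOn (fun x => a x * P.f j x + b x * P.g j x) P.Ω volume :=
    (integrable_mul_of_boundedOn hf haI).add (integrable_mul_of_boundedOn hg hbI)
  refine ⟨hw, ?_, ?_⟩
  · simp only [hdec]
    exact hconv.add hab
  have hM : ∫ x in P.Ω, ((v x - ξ x ^ 2 * q x) ^ 2 * P.f j x - (v x - ξ x ^ 2 * q x) * P.g j x) ≤
      (∫ x in P.Ω, (v x ^ 2 * P.f j x - v x * P.g j x)) + (Kf * (∫ x in ball z s', q x ^ 2) +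
        Kg * ∫ x in ball z s', |q x|) := by
    simp only [hdec]
    rw [integral_add hconv hab]
    gcongr
    have hI : Integrable (fun x => Kf * (ball z s').indicator (fun x => q x ^ 2) x +
        Kg * (ball z s').indicator (fun x => |q x|) x) volume :=
      (hind2.const_mul _).add (hind1.const_mul _)
    calc ∫ x in P.Ω, (a x * P.f j x + b x * P.g j x)
        ≤ ∫ x in P.Ω, (Kf * (ball z s').indicator (fun x => q x ^ 2) x +
          Kg * (ball z s').indicator (fun x => |q x|) x) := by
          refine integral_mono_ae hab hI.restrict ?_
          filter_upwards [hf.2, hg.2] with x hfx hgx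
          have h1 : a x * P.f j x ≤ (ball z s').indicator (fun x => q x ^ 2) x * Kf := by
            refine (le_abs_self _).trans ?_
            rw [abs_mul]
            exact mul_le_mul (ha_le x) hfx (abs_nonneg _) ((abs_nonneg _).trans (ha_le x))
          have h2 : b x * P.g j x ≤ (ball z s').indicator (fun x => |q x|) x * Kg := by
            refine (le_abs_self _).trans ?_
            rw [abs_mul]
            exact mul_le_mul (hb_le x) hgx (abs_nonneg _) ((abs_nonneg _).trans (hb_le x))
          linarith
      _ ≤ ∫ x, (Kf * (ball z s').indicator (fun x => q x ^ 2) x +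
          Kg * (ball z s').indicator (fun x => |q x|) x) := by
          refine setIntegral_le_integral hI (Eventually.of_forall fun x => ?_)
          have h1 := (abs_nonneg _).trans (ha_le x)
          have h2 := (abs_nonneg _).trans (hb_le x)
          simp only [Pi.zero_apply]
          positivity
      _ = _ := by
          rw [integral_add (hind2.const_mul _) (hind1.const_mul _), integral_const_mul,
            integral_const_mul, integral_indicator measurableSet_ball,
            integral_indicator measurableSet_ball]
  -- the gradient terms
  have hGI : Integrable (fun x => ‖weakGrad v x‖ ^ 2) volume := hv.memLp_weakGrad.integrable_norm_pow (by norm_num)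
  have hqI : Integrable (fun x => ‖weakGrad q x‖ ^ 2) volume := hq.memLp_weakGrad.integrable_norm_pow (by norm_num)
  have hwI : Integrable (fun x => ‖weakGrad (fun x => v x - ξ x ^ 2 * q x) x‖ ^ 2) volume :=
    hw.memLp_weakGrad.integrable_norm_pow (by norm_num)
  have hqIi : Integrable ((ball z s).indicator fun x => ‖weakGrad q x‖ ^ 2) volume :=
    hqI.indicator measurableSet_ball
  have hE : (∫ x, ‖weakGrad (fun x => v x - ξ x ^ 2 * q x) x‖ ^ 2) +
      (∫ x in ball z s, ‖weakGrad q x‖ ^ 2) / 2 ≤ (∫ x, ‖weakGrad v x‖ ^ 2) +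
        12 * D ^ 2 * ∫ x in ball z s', q x ^ 2 := by
    rw [← integral_indicator (f := fun x => ‖weakGrad q x‖ ^ 2) measurableSet_ball,
      ← integral_indicator (f := fun x => q x ^ 2) measurableSet_ball, ← integral_div,
      ← integral_const_mul, ← integral_add hwI (hqIi.div_const 2),
      ← integral_add hGI (hind2.const_mul _)]
    refine integral_mono_ae (hwI.add (hqIi.div_const 2)) (hGI.add (hind2.const_mul _)) ?_
    filter_upwards [hwg, hq.weakGrad_ae_eq hqH] with x hx hqx
    simp only [hx, gradient_sq hξ]
    -- On S, where q = v, this is `sq_norm_cutoff_le`; off S both q and its gradient vanish and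
    -- nothing has changed.
    by_cases hxS : x ∈ S
    · have e : q x = v x := by rw [hqS, Set.indicator_of_mem hxS]
      have h1 := sq_norm_cutoff_le (weakGrad v x) (gradient ξ x) (q x) (ξ x) D (hξ0 x) (hξ1 x) (hD x)
      simp only [Set.indicator_of_mem hxS] at h1 ⊢
      by_cases hxs : x ∈ ball z s'
      · rw [Set.indicator_of_mem hxs]
        have h2 : (ball z s).indicator (fun x => ‖weakGrad q x‖ ^ 2) x ≤
            ξ x ^ 2 * ‖weakGrad v x‖ ^ 2 := by
          by_cases hxb : x ∈ ball z s
          · rw [Set.indicator_of_mem hxb, hqx, Set.indicator_of_mem hxS,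
              hξs x (ball_subset_closedBall hxb)]
            simp
          · rw [Set.indicator_of_notMem hxb]
            positivity
        linarith
      · have hxb : x ∉ ball z s := fun hxb => by
          have := hξs x (ball_subset_closedBall hxb)
          rw [hξs' x hxs] at this
          norm_num at this
        simp [hξs' x hxs, hxs, hxb]
    · have e : q x = 0 := by rw [hqS, Set.indicator_of_notMem hxS]
      have h3 : (ball z s).indicator (fun x => ‖weakGrad q x‖ ^ 2) x = 0 := by
        by_cases hxb : x ∈ ball z s
        · rw [Set.indicator_of_mem hxb, hqx, Set.indicator_of_notMem hxS]
          simp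
        · rw [Set.indicator_of_notMem hxb]
      have h4 : (ball z s').indicator (fun x => q x ^ 2) x = 0 := by
        by_cases hxb : x ∈ ball z s'
        · rw [Set.indicator_of_mem hxb, e]
          simp
        · rw [Set.indicator_of_notMem hxb]
      simp [h3, h4, e, hxS]
  unfold cost
  linarith

/-- The effect on the cost of adding a test function. -/
theorem cost_add_mul (hf : P.BoundedOn (P.f j) Kf) (hg : P.BoundedOn (P.g j) Kg)
    {v : EuclideanSpace ℝ (Fin n) → ℝ} (hv : MemW12 v)
    (hconv : IntegrableOn (fun x => v x ^ 2 * P.f j x - v x * P.g j x) P.Ω volume)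
    {Φ : EuclideanSpace ℝ (Fin n) → ℝ} (hΦ : ContDiff ℝ ∞ Φ) (hc : HasCompactSupport Φ) (t : ℝ) :
    MemW12 (fun x => v x + t * Φ x) ∧
    IntegrableOn (fun x => (v x + t * Φ x) ^ 2 * P.f j x - (v x + t * Φ x) * P.g j x)
      P.Ω volume ∧
    P.cost j (fun x => v x + t * Φ x) = P.cost j v + 2 * t * (∫ x, inner ℝ (weakGrad v x) (gradient Φ x))
      + t ^ 2 * (∫ x, ‖gradient Φ x‖ ^ 2) + ∫ x in P.Ω, ((2 * t * (v x * Φ x) + t ^ 2 * Φ x ^ 2) *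
        P.f j x - t * Φ x * P.g j x) := by
  obtain ⟨hw, hwg⟩ := hv.add_const_mul hΦ hc t
  have hvΦ : Integrable (fun x => v x * Φ x) volume :=
    hv.hasWeakGrad_weakGrad.1.integrable_smul_right_of_hasCompactSupport hΦ.continuous hc
  have hΦ2 : Integrable (fun x => Φ x ^ 2) volume :=
    (hΦ.continuous.memLp_of_hasCompactSupport (p := 2) hc).integrable_sq
  have hΦ1 : Integrable Φ volume := hΦ.continuous.integrable_of_hasCompactSupport hc
  have hI : IntegrableOn (fun x => (2 * t * (v x * Φ x) + t ^ 2 * Φ x ^ 2) * P.f j x -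
      t * Φ x * P.g j x) P.Ω volume :=
    (integrable_mul_of_boundedOn hf ((hvΦ.const_mul _).add (hΦ2.const_mul _))).sub
      (integrable_mul_of_boundedOn hg (hΦ1.const_mul t))
  have hdec : ∀ x, (v x + t * Φ x) ^ 2 * P.f j x - (v x + t * Φ x) * P.g j x =
      (v x ^ 2 * P.f j x - v x * P.g j x) +
      ((2 * t * (v x * Φ x) + t ^ 2 * Φ x ^ 2) * P.f j x - t * Φ x * P.g j x) := fun x => by ring
  refine ⟨hw, ?_, ?_⟩
  · simp only [hdec]
    exact hconv.add hI
  have hgΦ : MemLp (gradient Φ) 2 volume :=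
    (continuous_gradient hΦ).memLp_of_hasCompactSupport (gradient_hasCompactSupport hc)
  have i1 : Integrable (fun x => ‖weakGrad v x‖ ^ 2) volume :=
    hv.memLp_weakGrad.integrable_norm_pow (by norm_num)
  have i2 : Integrable (fun x => inner ℝ (weakGrad v x) (gradient Φ x)) volume := by
    refine (hv.memLp_weakGrad.norm.integrable_mul hgΦ.norm).mono'
      (hv.memLp_weakGrad.1.inner hgΦ.1) (Eventually.of_forall fun x => ?_)
    exact norm_inner_le_norm _ _
  have i3 : Integrable (fun x => ‖gradient Φ x‖ ^ 2) volume := hgΦ.integrable_norm_pow (by norm_num)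
  have hE : ∫ x, ‖weakGrad (fun x => v x + t * Φ x) x‖ ^ 2 = (∫ x, ‖weakGrad v x‖ ^ 2) +
      2 * t * (∫ x, inner ℝ (weakGrad v x) (gradient Φ x)) + t ^ 2 * ∫ x, ‖gradient Φ x‖ ^ 2 := by
    have i12 : Integrable (fun x => ‖weakGrad v x‖ ^ 2 +
        2 * t * inner ℝ (weakGrad v x) (gradient Φ x)) volume := i1.add (i2.const_mul _)
    rw [← integral_const_mul, ← integral_const_mul, ← integral_add i1 (i2.const_mul _),
      ← integral_add i12 (i3.const_mul _)]
    refine integral_congr_ae ?_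
    filter_upwards [hwg] with x hx
    rw [hx, norm_add_sq_real, inner_smul_right, norm_smul, mul_pow, Real.norm_eq_abs, sq_abs]
    ring
  unfold cost
  simp only [hdec]
  rw [hE, integral_add hconv hI]
  ring

end FBProblem

/-! ### Ball volumes, real-valued integrals and a local Faber–Krahn inequality. -/

section RealIntegrals

theorem lintegral_enorm_sq_eq_ofReal {α F : Type*} [MeasurableSpace α] {μ : Measure α}
    [NormedAddCommGroup F] {v : α → F} (hv : MemLp v 2 μ) :
    ∫⁻ x, ‖v x‖ₑ ^ 2 ∂μ = ENNReal.ofReal (∫ x, ‖v x‖ ^ 2 ∂μ) := by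
  rw [ofReal_integral_eq_lintegral_ofReal (hv.integrable_norm_pow (by norm_num))
    (Eventually.of_forall fun x => by positivity)]
  refine lintegral_congr fun x => ?_
  rw [ENNReal.ofReal_pow (norm_nonneg _), ofReal_norm]

variable {n : ℕ}

/-- The volume of the unit ball. -/
noncomputable def unitBallVolume (n : ℕ) : ℝ :=
  volume.real (ball (0 : EuclideanSpace ℝ (Fin n)) 1)

theorem unitBallVolume_pos (n : ℕ) : 0 < unitBallVolume n :=
  ENNReal.toReal_pos (measure_ball_pos _ _ one_pos).ne' measure_ball_lt_top.ne

theorem volume_real_ball (z : EuclideanSpace ℝ (Fin n)) {r : ℝ} (hr : 0 < r) :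
    volume.real (ball z r) = unitBallVolume n * r ^ n := by
  rw [Measure.real, Measure.addHaar_ball_of_pos _ _ hr, ENNReal.toReal_mul,
    ENNReal.toReal_ofReal (by positivity), finrank_euclideanSpace_fin, mul_comm]
  rfl

theorem volume_ball_eq (z : EuclideanSpace ℝ (Fin n)) {r : ℝ} (hr : 0 < r) :
    volume (ball z r) = ENNReal.ofReal (unitBallVolume n * r ^ n) := by
  rw [← volume_real_ball z hr, Measure.real, ENNReal.ofReal_toReal measure_ball_lt_top.ne]

theorem volume_closedBall_eq (z : EuclideanSpace ℝ (Fin n)) {r : ℝ} (hr : 0 < r) :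
    volume (closedBall z r) = ENNReal.ofReal (unitBallVolume n * r ^ n) := by
  rw [← volume_ball_eq z hr, Measure.addHaar_closedBall _ _ hr.le, Measure.addHaar_ball_of_pos _ _ hr]

variable {q : EuclideanSpace ℝ (Fin n) → ℝ}

theorem MemW12.memLp_ball (hq : MemW12 q) (z : EuclideanSpace ℝ (Fin n)) (s : ℝ) :
    MemLp q 2 (volume.restrict (ball z s)) :=
  (hq.1 _ (isCompact_closedBall z s)).mono_measure
    (Measure.restrict_mono ball_subset_closedBall le_rfl)

theorem MemW12.integrableOn_sq (hq : MemW12 q) (z : EuclideanSpace ℝ (Fin n)) (s : ℝ) :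
    IntegrableOn (fun x => q x ^ 2) (ball z s) volume := (hq.memLp_ball z s).integrable_sq

theorem MemW12.integrableOn_ball (hq : MemW12 q) (z : EuclideanSpace ℝ (Fin n)) (s : ℝ) :
    IntegrableOn q (ball z s) volume := by
  have : IsFiniteMeasure (volume.restrict (ball z s)) := ⟨by simp [measure_ball_lt_top]⟩
  exact (hq.memLp_ball z s).integrable (by norm_num)

theorem MemW12.integrable_weakGrad_sq (hq : MemW12 q) :
    Integrable (fun x => ‖weakGrad q x‖ ^ 2) volume :=
  hq.memLp_weakGrad.integrable_norm_pow (by norm_num)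

theorem MemW12.setIntegral_sq_mono (hq : MemW12 q) {A : Set (EuclideanSpace ℝ (Fin n))}
    {z : EuclideanSpace ℝ (Fin n)} {s : ℝ} (h : A ⊆ ball z s) :
    ∫ x in A, q x ^ 2 ≤ ∫ x in ball z s, q x ^ 2 :=
  setIntegral_mono_set (hq.integrableOn_sq z s) (Eventually.of_forall fun _ => sq_nonneg _)
    h.eventuallyLE

/-- Apply `HasWeakGrad.faberKrahn` to ηq with η a cutoff between the two balls; the product vanishes
off S everywhere. The constant 8 is 4 times the 2 from squaring the sum in the product rule. -/
theorem MemW12.faberKrahn_ball {C : ℝ} (hcut : IsCutoffConstant C) (hq : MemW12 q)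
    {z : EuclideanSpace ℝ (Fin n)} {s s' R : ℝ} (hs : 0 < s) (hs' : s < s') (hR : 0 < R)
    {S : Set (EuclideanSpace ℝ (Fin n))} (hS : MeasurableSet S) (hqS : ∀ a ∈ ball z s', a ∉ S → q a = 0)
    (hSfin : volume S ≠ ⊤) (hSR : 2 * volume.real S ≤ unitBallVolume n * R ^ n) :
    ∫ x in ball z s, q x ^ 2 ≤ 8 * R ^ 2 * ((∫ x in ball z s', ‖weakGrad q x‖ ^ 2) +
      (C / (s' - s)) ^ 2 * ∫ x in ball z s', q x ^ 2) := by
  lift R to ℝ≥0 using hR.le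
  obtain ⟨η, hη, hη0, hη1, hηs, hηs', hηc, hηg⟩ := hcut n z s s' hs hs'
  set D := C / (s' - s)
  have hD0 : 0 ≤ D := (norm_nonneg _).trans (hηg z)
  have hw := hq.hasWeakGrad_weakGrad.mul_contDiff hη
  have hqm := hq.hasWeakGrad_weakGrad.1.aestronglyMeasurable
  have hwL : MemLp (fun x => η x • weakGrad q x + q x • gradient η x) 2 volume :=
    (memLp_smul_of_bounded hq.memLp_weakGrad hη.continuous hηc).add
      (memLp_smul_of_hasCompactSupport hqm hq.1 (continuous_gradient hη)
        (gradient_hasCompactSupport hηc))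
  have hvL : MemLp (fun x => η x * q x) 2 volume := by
    have := memLp_smul_of_hasCompactSupport hqm hq.1 hη.continuous hηc
    simpa [mul_comm] using this
  have hgz : ∀ x, x ∉ ball z s' → gradient η x = 0 := by
    intro x hx
    have hmin : IsLocalMin η x := Eventually.of_forall fun y => by rw [hηs' x hx]; exact hη0 y
    rw [gradient, hmin.fderiv_eq_zero, map_zero]
  have key := hw.faberKrahn hwL hS (fun a ha => ?_) ?_ (by exact_mod_cast hR)
  · rw [lintegral_enorm_sq_eq_ofReal hvL, lintegral_enorm_sq_eq_ofReal hwL] at key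
    have e : 4 * (R : ℝ≥0∞) ^ 2 = ENNReal.ofReal (4 * (R : ℝ) ^ 2) := by
      rw [ENNReal.ofReal_mul (by norm_num), ENNReal.ofReal_pow hR.le, ENNReal.ofReal_coe_nnreal]
      simp
    rw [e, ← ENNReal.ofReal_mul (by positivity)] at key
    have hnn : 0 ≤ 4 * (R : ℝ) ^ 2 * ∫ x, ‖η x • weakGrad q x + q x • gradient η x‖ ^ 2 := by positivity
    rw [ENNReal.ofReal_le_ofReal_iff hnn] at key
    have h1 : ∫ x in ball z s, q x ^ 2 ≤ ∫ x, ‖η x * q x‖ ^ 2 := by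
      calc ∫ x in ball z s, q x ^ 2 = ∫ x in ball z s, ‖η x * q x‖ ^ 2 := by
            refine setIntegral_congr_fun measurableSet_ball fun x hx => ?_
            simp [hηs x (ball_subset_closedBall hx)]
        _ ≤ _ := setIntegral_le_integral (hvL.integrable_norm_pow (by norm_num))
            (Eventually.of_forall fun x => by simp only [Pi.zero_apply]; positivity)
    have i1 : IntegrableOn (fun x => ‖weakGrad q x‖ ^ 2) (ball z s') volume :=
      hq.integrable_weakGrad_sq.integrableOn
    have i2 := hq.integrableOn_sq z s'
    have h2 : ∫ x, ‖η x • weakGrad q x + q x • gradient η x‖ ^ 2 ≤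
        2 * ((∫ x in ball z s', ‖weakGrad q x‖ ^ 2) + D ^ 2 * ∫ x in ball z s', q x ^ 2) := by
      have e1 : ∫ x, ‖η x • weakGrad q x + q x • gradient η x‖ ^ 2 =
          ∫ x in ball z s', ‖η x • weakGrad q x + q x • gradient η x‖ ^ 2 := by
        rw [setIntegral_eq_integral_of_forall_compl_eq_zero]
        intro x hx
        simp [hηs' x hx, hgz x hx]
      rw [e1, ← integral_const_mul, ← integral_add i1 (i2.const_mul _), ← integral_const_mul]
      refine integral_mono (hwL.integrable_norm_pow (by norm_num)).integrableOn
        ((i1.add (i2.const_mul _)).const_mul 2) fun x => ?_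
      have h3 : ‖η x • weakGrad q x + q x • gradient η x‖ ≤ ‖weakGrad q x‖ + D * |q x| := by
        refine (norm_add_le _ _).trans (add_le_add ?_ ?_)
        · rw [norm_smul, Real.norm_of_nonneg (hη0 x)]
          exact mul_le_of_le_one_left (norm_nonneg _) (hη1 x)
        · rw [norm_smul, Real.norm_eq_abs, mul_comm]
          gcongr
          exact hηg x
      calc _ ≤ (‖weakGrad q x‖ + D * |q x|) ^ 2 := by gcongr
        _ ≤ 2 * (‖weakGrad q x‖ ^ 2 + D ^ 2 * q x ^ 2) := by
          rw [← sq_abs (q x)]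
          nlinarith [sq_nonneg (‖weakGrad q x‖ - D * |q x|)]
    calc _ ≤ _ := h1
      _ ≤ _ := key
      _ ≤ 4 * (R : ℝ) ^ 2 * (2 * ((∫ x in ball z s', ‖weakGrad q x‖ ^ 2) +
          D ^ 2 * ∫ x in ball z s', q x ^ 2)) := by gcongr
      _ = _ := by ring
  · by_cases h : a ∈ ball z s'
    · simp [hqS a h ha]
    · simp [hηs' a h]
  · show 2 * volume S ≤ volume (closedBall (0 : EuclideanSpace ℝ (Fin n)) R)
    have e2 : 2 * volume S = ENNReal.ofReal (2 * volume.real S) := by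
      rw [ENNReal.ofReal_mul (by norm_num), Measure.real, ENNReal.ofReal_toReal hSfin]
      simp
    rw [volume_closedBall_eq _ hR, e2]
    exact ENNReal.ofReal_le_ofReal hSR

end RealIntegrals

/-! ### Minimality and the Caccioppoli inequality for a good phase. -/

namespace FBProblem

variable {n N : ℕ} {P : FBProblem n N} {u : Fin N → EuclideanSpace ℝ (Fin n) → ℝ}
  {W : Fin N → Set (EuclideanSpace ℝ (Fin n))} {i : Fin N} {lam ε Kf Kg : ℝ}

/-- Minimality, tested with competitors for which a single component of `u` changes. -/
theorem IsMinimizer.cost_add_le (h : P.IsMinimizer u W) {v : EuclideanSpace ℝ (Fin n) → ℝ}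
    {W' : Fin N → Set (EuclideanSpace ℝ (Fin n))} (hW' : P.IsTuple W') (hv : MemW12 v)
    (hv0 : ∀ᵐ x ∂volume, x ∉ W' i → v x = 0) (hsub : ∀ j, j ≠ i → W j ⊆ W' j)
    (hconv : IntegrableOn (fun x => v x ^ 2 * P.f i x - v x * P.g i x) P.Ω volume) :
    P.cost i (u i) + P.F W ≤ P.cost i v + P.F W' := by
  obtain ⟨⟨hW, hu⟩, hM, hJ⟩ := h
  have h1 := hJ (Function.update u i v) W' ⟨hW', fun j => ?_⟩ fun j => ?_
  · rw [J_eq_sum_cost, J_eq_sum_cost, ← Finset.add_sum_erase _ _ (Finset.mem_univ i),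
      ← Finset.add_sum_erase _ (fun j => P.cost j (Function.update u i v j)) (Finset.mem_univ i),
      Function.update_self] at h1
    have h2 : ∑ j ∈ Finset.univ.erase i, P.cost j (Function.update u i v j) =
        ∑ j ∈ Finset.univ.erase i, P.cost j (u j) := Finset.sum_congr rfl fun j hj => by
      rw [Function.update_of_ne (Finset.ne_of_mem_erase hj)]
    rw [h2] at h1
    linarith
  · by_cases hj : j = i
    · subst hj
      rw [Function.update_self]
      exact ⟨hv, hv0⟩
    · rw [Function.update_of_ne hj]
      refine ⟨(hu j).1, ?_⟩
      filter_upwards [(hu j).2] with x hx hxW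
      exact hx fun h' => hxW (hsub j hj h')
  · by_cases hj : j = i
    · subst hj
      simpa only [Function.update_self] using hconv
    · simpa only [Function.update_of_ne hj] using hM j

/-- A minimizer for which `W i` is a good region, with bounded coefficients `f i` and `g i`. -/
structure IsGoodMinimizer (P : FBProblem n N) (u : Fin N → EuclideanSpace ℝ (Fin n) → ℝ)
    (W : Fin N → Set (EuclideanSpace ℝ (Fin n))) (i : Fin N) (lam ε Kf Kg : ℝ) : Prop where
  isMinimizer : P.IsMinimizer u W
  boundedOn_f : P.BoundedOn (P.f i) Kf
  boundedOn_g : P.BoundedOn (P.g i) Kg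
  isGoodIndex : P.IsGoodIndex W i lam ε

theorem IsMinimizer.memW12 (h : P.IsMinimizer u W) (j : Fin N) : MemW12 (u j) := (h.1.2 j).1

/-- Turns the good-region condition into an admissible competitor. Null sets A, to which the
condition does not apply, are handled by keeping W. -/
theorem IsGoodIndex.exists_tuple (h : P.IsGoodIndex W i lam ε) (hW : P.IsTuple W)
    {A : Set (EuclideanSpace ℝ (Fin n))} (hA : MeasurableSet A) (hAW : A ⊆ W i)
    (hAε : volume A ≤ ENNReal.ofReal ε) :
    ∃ W' : Fin N → Set (EuclideanSpace ℝ (Fin n)), P.IsTuple W' ∧ W i \ A ⊆ W' i ∧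
      (∀ j, j ≠ i → W j ⊆ W' j) ∧ P.F W' ≤ P.F W - lam * volume.real A := by
  rcases eq_or_ne (volume A) 0 with h0 | h0
  · exact ⟨W, hW, Set.sdiff_subset, fun j _ => le_rfl, by simp [Measure.real, h0]⟩
  obtain ⟨A', hA', hdisj, hF⟩ := h A hA hAW (pos_iff_ne_zero.2 h0) hAε
  refine ⟨_, ⟨fun j => ?_, fun j => ?_, fun j k hjk => ?_⟩, ?_, fun j hj => ?_, hF⟩
  · split_ifs with hj
    · exact MeasurableSet.diff (hW.1 i) hA
    · exact MeasurableSet.union (hW.1 j) (hA' j hj).1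
  · split_ifs with hj
    · exact Set.sdiff_subset.trans (hW.2.1 i)
    · exact Set.union_subset (hW.2.1 j) ((hA' j hj).2.trans (hAW.trans (hW.2.1 i)))
  · have key : ∀ k, k ≠ i → Disjoint (W i \ A) (W k ∪ A' k) := by
      intro k hk
      refine Set.disjoint_union_right.2 ⟨(hW.2.2 hk.symm).mono_left Set.sdiff_subset, ?_⟩
      exact Set.disjoint_sdiff_left.mono_right (hA' k hk).2
    simp only
    split_ifs with hj hk hk
    · exact absurd (hj.trans hk.symm) hjk
    · exact key k hk
    · exact (key j hj).symm
    · refine Set.disjoint_union_left.2 ⟨Set.disjoint_union_right.2 ⟨hW.2.2 hjk, ?_⟩,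
        Set.disjoint_union_right.2 ⟨?_, hdisj j k hj hk hjk⟩⟩
      · exact (hW.2.2 hj).mono_right ((hA' k hk).2.trans hAW)
      · exact ((hW.2.2 hk).mono_right ((hA' j hj).2.trans hAW)).symm
  · simp
  · simp only [if_neg hj]
    exact Set.subset_union_left

theorem measurableSet_pos_inter_ball {v : EuclideanSpace ℝ (Fin n) → ℝ}
    {z : EuclideanSpace ℝ (Fin n)} {s : ℝ} (hc : ContinuousOn v (ball z s)) :
    MeasurableSet ({x | 0 < v x} ∩ ball z s) := by
  rw [Set.inter_comm]
  exact (hc.isOpen_inter_preimage isOpen_ball isOpen_Ioi).measurableSet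

theorem posPartFun_eq_indicator (v : EuclideanSpace ℝ (Fin n) → ℝ) :
    posPartFun v = {x | 0 < v x}.indicator v := by
  ext x
  by_cases hx : 0 < v x
  · rw [Set.indicator_of_mem (show x ∈ {x | 0 < v x} from hx)]
    exact max_eq_right hx.le
  · rw [Set.indicator_of_notMem (show x ∉ {x | 0 < v x} from hx)]
    exact max_eq_left (not_lt.1 hx)

theorem posPartFun_nonneg (v : EuclideanSpace ℝ (Fin n) → ℝ) (x : EuclideanSpace ℝ (Fin n)) :
    0 ≤ posPartFun v x := le_max_left _ _

theorem IsMinimizer.ae_mem_of_pos (h : P.IsMinimizer u W) (j : Fin N) :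
    ∀ᵐ x ∂volume, u j x ≠ 0 → x ∈ W j := by
  filter_upwards [(h.1.2 j).2] with x hx h0
  by_contra hxW
  exact h0 (hx hxW)

/-- The competitor u - ξ²u₊ vanishes on {u > 0} ∩ B(z, s), so that set can be removed from the
phase. The gain λ times its measure appears on the left next to the gradient term of the usual
energy estimate. -/
theorem IsGoodMinimizer.caccioppoli (h : P.IsGoodMinimizer u W i lam ε Kf Kg) (hKf : 0 ≤ Kf)
    (hKg : 0 ≤ Kg) {C : ℝ} (hcut : IsCutoffConstant C) {z : EuclideanSpace ℝ (Fin n)} {s s' : ℝ} (hs : 0 < s)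
    (hs' : s < s') (hc : ContinuousOn (u i) (ball z s)) (hε : volume (ball z s) ≤ ENNReal.ofReal ε) :
    lam * volume.real ({x | 0 < u i x} ∩ ball z s) +
      (∫ x in ball z s, ‖weakGrad (posPartFun (u i)) x‖ ^ 2) / 2 ≤
      (12 * (C / (s' - s)) ^ 2 + Kf) * (∫ x in ball z s', posPartFun (u i) x ^ 2) +
        Kg * ∫ x in ball z s', posPartFun (u i) x := by
  obtain ⟨ξ, hξ, hξ0, hξ1, hξs, hξs', hξc, hξg⟩ := hcut n z s s' hs hs'
  have hmin := h.isMinimizer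
  have hui := hmin.memW12 i
  obtain ⟨hp, hpg⟩ := hui.posPart
  obtain ⟨hw, hwconv, hwcost⟩ := cost_sub_mul_le h.boundedOn_f h.boundedOn_g hKf hKg hui (hmin.2.1 i)
    (posPartFun_eq_indicator (u i)) hp hpg hξ hξ0 hξ1 hξc hξg hξs hξs'
  -- Only subsets of `W i` may be removed; the intersection loses a null set, as `u i` vanishes a.e.
  -- off `W i`.
  set A := ({x | 0 < u i x} ∩ ball z s) ∩ W i with hA
  have hAm : MeasurableSet A := (measurableSet_pos_inter_ball hc).inter (hmin.1.1.1 i)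
  have hAvol : volume A = volume ({x | 0 < u i x} ∩ ball z s) := by
    refine measure_congr ?_
    filter_upwards [hmin.ae_mem_of_pos i] with x hx
    refine propext ⟨fun h' => h'.1, fun h' => ⟨h', hx ?_⟩⟩
    exact ne_of_gt h'.1
  obtain ⟨W', hW', hWi, hWj, hF⟩ := h.isGoodIndex.exists_tuple hmin.1.1 hAm Set.inter_subset_right
    ((measure_mono (Set.inter_subset_left.trans Set.inter_subset_right)).trans hε)
  have hle := hmin.cost_add_le hW' hw ?_ hWj hwconv
  · have e : volume.real A = volume.real ({x | 0 < u i x} ∩ ball z s) := by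
      rw [Measure.real, Measure.real, hAvol]
    rw [e] at hF
    have e2 : ∫ x in ball z s', |posPartFun (u i) x| = ∫ x in ball z s', posPartFun (u i) x := by
      congr 1
      ext x
      exact abs_of_nonneg (posPartFun_nonneg _ _)
    rw [e2] at hwcost
    linarith
  · filter_upwards [(hmin.1.2 i).2] with x hx hxW
    by_cases hxi : x ∈ W i
    · have hxA : x ∈ A := by
        by_contra hxA
        exact hxW (hWi ⟨hxi, hxA⟩)
      have h1 : posPartFun (u i) x = u i x := max_eq_right (le_of_lt hxA.1.1)
      rw [hξs x (ball_subset_closedBall hxA.1.2), h1]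
      ring
    · have h1 := hx hxi
      simp [posPartFun, h1]

end FBProblem

/-! ### De Giorgi iteration and nondegeneracy. -/

namespace FBProblem

variable {n N : ℕ} {P : FBProblem n N} {u : Fin N → EuclideanSpace ℝ (Fin n) → ℝ}
  {W : Fin N → Set (EuclideanSpace ℝ (Fin n))} {i : Fin N} {lam ε Kf Kg : ℝ}

/-- Young's inequality v ≤ v²/(2a) + a/2 on {v > 0}. It expresses the linear term of the Caccioppoli
inequality through the two quantities that the iteration follows. -/
theorem setIntegral_posPartFun_le {v : EuclideanSpace ℝ (Fin n) → ℝ} (hv : MemW12 v)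
    {z : EuclideanSpace ℝ (Fin n)} {s a : ℝ} (hm : MeasurableSet ({x | 0 < v x} ∩ ball z s))
    (ha : 0 < a) :
    ∫ x in ball z s, posPartFun v x ≤ (∫ x in ball z s, posPartFun v x ^ 2) / (2 * a) +
      a / 2 * volume.real ({x | 0 < v x} ∩ ball z s) := by
  set A := {x | 0 < v x} ∩ ball z s with hA
  have hAfin : volume A ≠ ⊤ := ne_top_of_le_ne_top measure_ball_lt_top.ne
    (measure_mono (Set.inter_subset_right (s := {x | 0 < v x}) (t := ball z s)))
  have i1 : IntegrableOn (fun x => posPartFun v x ^ 2 / (2 * a)) (ball z s) volume :=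
    (hv.posPart.1.integrableOn_sq z s).div_const _
  have i2 : Integrable (A.indicator fun _ => a / 2) volume :=
    (integrable_indicator_iff hm).2 (integrableOn_const hAfin)
  have e : ∫ x in ball z s, A.indicator (fun _ => a / 2) x = a / 2 * volume.real A := by
    rw [setIntegral_indicator hm, setIntegral_const, Set.inter_eq_right.2 Set.inter_subset_right,
      smul_eq_mul, mul_comm]
  rw [← e, ← integral_div, ← integral_add i1 i2.integrableOn]
  refine setIntegral_mono_on (hv.posPart.1.integrableOn_ball z s) (i1.add i2.integrableOn)
    measurableSet_ball fun x hx => ?_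
  by_cases hp : 0 < v x
  · rw [Set.indicator_of_mem (show x ∈ A from ⟨hp, hx⟩)]
    have := sq_nonneg (posPartFun v x - a)
    rw [div_add_div _ _ (by positivity) (by norm_num), le_div_iff₀ (by positivity)]
    nlinarith
  · have : posPartFun v x = 0 := max_eq_left (not_lt.1 hp)
    rw [this, Set.indicator_of_notMem (show x ∉ A from fun h => hp h.1)]
    simp

set_option maxHeartbeats 400000 in
/-- One step of the De Giorgi iteration. -/
theorem IsGoodMinimizer.halving (h : P.IsGoodMinimizer u W i lam ε Kf Kg) (hKf : 0 ≤ Kf)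
    (hKg : 0 ≤ Kg) (hlam : 0 < lam) {C c κ t τ σ : ℝ} (hcut : IsCutoffConstant C)
    (hcl : 2 ^ n * c ≤ lam) (hc1 : 2 ^ n * (2 * c) ≤ 1) (hκ : 0 < κ) (ht : 0 < t) (hσ : 0 ≤ σ)
    (hτ : 2 * τ = unitBallVolume n * t ^ n)
    (h1 : (768 * C ^ 2 + Kf) * σ + Kg * (σ / (2 * κ) + κ * τ / 2) ≤ c * τ)
    (h2 : 16 * t ^ 2 * τ ≤ σ)
    {z : EuclideanSpace ℝ (Fin n)} {s d : ℝ} (hs : 0 < s) (hd : 0 < d) (hd1 : d ≤ 1)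
    (hc : ContinuousOn (u i) (ball z (s + d / 4)))
    (hε : volume (ball z (s + d / 4)) ≤ ENNReal.ofReal ε)
    (hU : ∫ x in ball z (s + d / 4), posPartFun (u i) x ^ 2 ≤ σ * d ^ (n + 2))
    (hA : volume.real ({x | 0 < u i x} ∩ ball z (s + d / 4)) ≤ τ * d ^ n) :
    ∫ x in ball z s, posPartFun (u i) x ^ 2 ≤ σ * (d / 2) ^ (n + 2) ∧
      volume.real ({x | 0 < u i x} ∩ ball z s) ≤ τ * (d / 2) ^ n := by
  have hmin := h.isMinimizer
  have hui := hmin.memW12 i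
  have hp := hui.posPart.1
  have hτ0 : 0 ≤ τ := by
    have : 0 ≤ unitBallVolume n * t ^ n := by have := unitBallVolume_pos n; positivity
    linarith
  -- The shell of width d/4 is split in two: the outer half is used by the Caccioppoli inequality,
  -- the inner half by Faber–Krahn.
  have hm1 : ball z (s + d / 8) ⊆ ball z (s + d / 4) := ball_subset_ball (by linarith)
  have hm2 : ball z s ⊆ ball z (s + d / 8) := ball_subset_ball (by linarith)
  have hcac := h.caccioppoli hKf hKg hcut (z := z) (s := s + d / 8) (s' := s + d / 4)
    (by positivity) (by linarith) (hc.mono hm1) ((measure_mono hm1).trans hε)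
  have hI := setIntegral_posPartFun_le hui (measurableSet_pos_inter_ball hc) (mul_pos hκ hd)
  set U := ∫ x in ball z (s + d / 4), posPartFun (u i) x ^ 2
  set A := volume.real ({x | 0 < u i x} ∩ ball z (s + d / 4))
  set A' := volume.real ({x | 0 < u i x} ∩ ball z (s + d / 8)) with hA'
  set E := ∫ x in ball z (s + d / 8), ‖weakGrad (posPartFun (u i)) x‖ ^ 2
  have hE0 : 0 ≤ E := integral_nonneg fun x => by positivity
  have hA0 : 0 ≤ A' := measureReal_nonneg
  have hdn : 0 < d ^ n := by positivity
  -- The gap d/8 turns 12 into 12 · 64 = 768, and d² cancels against the extra power in the bound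
  -- for U. Spare powers of d in the lower order terms are dropped since d ≤ 1.
  have hB : (12 * (C / (s + d / 4 - (s + d / 8))) ^ 2 + Kf) * U +
      Kg * (∫ x in ball z (s + d / 4), posPartFun (u i) x) ≤ c * τ * d ^ n := by
    have e : s + d / 4 - (s + d / 8) = d / 8 := by ring
    rw [e]
    have b1 : (12 * (C / (d / 8)) ^ 2 + Kf) * U ≤ (768 * C ^ 2 + Kf) * σ * d ^ n := by
      calc _ ≤ (12 * (C / (d / 8)) ^ 2 + Kf) * (σ * d ^ (n + 2)) := by gcongr
        _ = (768 * C ^ 2 + Kf * d ^ 2) * σ * d ^ n := by field_simp; ring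
        _ ≤ (768 * C ^ 2 + Kf * 1) * σ * d ^ n := by
          gcongr
          exact pow_le_one₀ hd.le hd1
        _ = _ := by ring
    have b2 : ∫ x in ball z (s + d / 4), posPartFun (u i) x ≤ (σ / (2 * κ) + κ * τ / 2) * d ^ n := by
      calc _ ≤ _ := hI
        _ ≤ σ * d ^ (n + 2) / (2 * (κ * d)) + κ * d / 2 * (τ * d ^ n) := by gcongr
        _ = (σ / (2 * κ) + κ * τ / 2) * d ^ n * d := by field_simp; ring
        _ ≤ (σ / (2 * κ) + κ * τ / 2) * d ^ n * 1 := by gcongr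
        _ = _ := mul_one _
    calc _ ≤ (768 * C ^ 2 + Kf) * σ * d ^ n + Kg * ((σ / (2 * κ) + κ * τ / 2) * d ^ n) := by gcongr
      _ = ((768 * C ^ 2 + Kf) * σ + Kg * (σ / (2 * κ) + κ * τ / 2)) * d ^ n := by ring
      _ ≤ _ := by gcongr
  have hsum := hcac.trans hB
  have e2 : τ * (d / 2) ^ n * 2 ^ n = τ * d ^ n := by rw [div_pow]; field_simp
  have h2n : (0 : ℝ) < 2 ^ n := by positivity
  have hτd : 0 ≤ τ * d ^ n := by positivity
  have hA'b : A' ≤ τ * (d / 2) ^ n := by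
    have : lam * A' ≤ c * τ * d ^ n := by linarith
    have h3 : lam * (A' * 2 ^ n) ≤ lam * (τ * (d / 2) ^ n * 2 ^ n) := by
      rw [e2]
      calc lam * (A' * 2 ^ n) = 2 ^ n * (lam * A') := by ring
        _ ≤ 2 ^ n * (c * τ * d ^ n) := by gcongr
        _ = (2 ^ n * c) * (τ * d ^ n) := by ring
        _ ≤ lam * (τ * d ^ n) := by gcongr
    exact le_of_mul_le_mul_right (le_of_mul_le_mul_left h3 hlam) h2n
  have hEb : E ≤ τ * (d / 2) ^ n := by
    have : E ≤ 2 * c * (τ * d ^ n) := by nlinarith [mul_nonneg hlam.le hA0]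
    refine le_of_mul_le_mul_right ?_ h2n
    rw [e2]
    calc E * 2 ^ n ≤ 2 * c * (τ * d ^ n) * 2 ^ n := by gcongr
      _ = (2 ^ n * (2 * c)) * (τ * d ^ n) := by ring
      _ ≤ 1 * (τ * d ^ n) := by gcongr
      _ = _ := one_mul _
  have hAfin : volume ({x | 0 < u i x} ∩ ball z (s + d / 8)) ≠ ⊤ :=
    ne_top_of_le_ne_top measure_ball_lt_top.ne
      (measure_mono (Set.inter_subset_right (s := {x | 0 < u i x}) (t := ball z (s + d / 8))))
  -- The radius is the one for which the measure bound τ(d/2)^n is exactly half of the volume of the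
  -- ball.
  have hFK := hp.faberKrahn_ball hcut (z := z) (s := s) (s' := s + d / 8) (R := t * (d / 2)) hs
    (by linarith) (by positivity) (measurableSet_pos_inter_ball (hc.mono hm1))
    (fun a ha ha' => max_eq_left (not_lt.1 fun h0 => ha' ⟨h0, ha⟩)) hAfin (by
      rw [mul_pow, ← mul_assoc, ← hτ, mul_assoc]
      gcongr)
  have hU' : ∫ x in ball z (s + d / 8), posPartFun (u i) x ^ 2 ≤ σ * d ^ (n + 2) :=
    (hp.setIntegral_sq_mono hm1).trans hU
  refine ⟨?_, (measureReal_mono (Set.inter_subset_inter_right _ hm2) hAfin).trans hA'b⟩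
  have h64 : (C / (s + d / 8 - s)) ^ 2 * ∫ x in ball z (s + d / 8), posPartFun (u i) x ^ 2 ≤
      τ * (d / 2) ^ n := by
    have e : s + d / 8 - s = d / 8 := by ring
    rw [e]
    have h64' : 64 * C ^ 2 * σ ≤ c * τ := by
      have : 0 ≤ Kg * (σ / (2 * κ) + κ * τ / 2) := by positivity
      have k2 : 0 ≤ C ^ 2 * σ := by positivity
      have k3 : 0 ≤ Kf * σ := mul_nonneg hKf hσ
      have k4 : (768 * C ^ 2 + Kf) * σ = 768 * (C ^ 2 * σ) + Kf * σ := by ring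
      have k5 : 64 * C ^ 2 * σ = 64 * (C ^ 2 * σ) := by ring
      linarith
    calc _ ≤ (C / (d / 8)) ^ 2 * (σ * d ^ (n + 2)) := by gcongr
      _ = 64 * C ^ 2 * σ * d ^ n := by field_simp; ring
      _ ≤ c * τ * d ^ n := by gcongr
      _ ≤ τ * (d / 2) ^ n := by
        refine le_of_mul_le_mul_right ?_ h2n
        rw [e2]
        have hc0 : 2 ^ n * c ≤ 1 := by
          have k1 : 2 ^ n * (2 * c) = 2 * (2 ^ n * c) := by ring
          linarith
        calc c * τ * d ^ n * 2 ^ n = (2 ^ n * c) * (τ * d ^ n) := by ring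
          _ ≤ 1 * (τ * d ^ n) := by gcongr
          _ = _ := one_mul _
  calc _ ≤ _ := hFK
    _ ≤ 8 * (t * (d / 2)) ^ 2 * (τ * (d / 2) ^ n + τ * (d / 2) ^ n) := by gcongr
    _ = 16 * t ^ 2 * τ * (d / 2) ^ (n + 2) := by ring
    _ ≤ _ := by gcongr

/-- Choose c from λ and n, then the Young parameter κ with Kg·κ ≤ c, then a small η, and set t =
η/4, σ = ητ. The inequalities involving τ become linear in τ, and 16t² = η² ≤ η settles the last
one. -/
theorem exists_deGiorgi_constants (n : ℕ) {C lam Kf Kg : ℝ} (hlam : 0 < lam) (hKf : 0 ≤ Kf)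
    (hKg : 0 ≤ Kg) : ∃ c κ t τ σ : ℝ, 2 ^ n * c ≤ lam ∧ 2 ^ n * (2 * c) ≤ 1 ∧ 0 < κ ∧ 0 < t ∧ 0 < σ ∧
      0 < τ ∧ 2 * τ = unitBallVolume n * t ^ n ∧
      (768 * C ^ 2 + Kf) * σ + Kg * (σ / (2 * κ) + κ * τ / 2) ≤ c * τ ∧ 16 * t ^ 2 * τ ≤ σ := by
  have h2n : (0 : ℝ) < 2 ^ n := by positivity
  set c := min lam (1 / 2) / 2 ^ n with hc
  have hc0 : 0 < c := by positivity
  set κ := c / (Kg + 1) with hκ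
  have hκ0 : 0 < κ := by positivity
  set B := 768 * C ^ 2 + Kf + Kg / (2 * κ) with hB
  have hB0 : 0 ≤ B := by positivity
  set η := min (c / (2 * (B + 1))) 1 with hη
  have hη0 : 0 < η := by positivity
  have hη1 : η ≤ 1 := min_le_right _ _
  have hBη : B * η ≤ c / 2 := by
    have : η * (2 * (B + 1)) ≤ c := (le_div_iff₀ (by positivity)).1 (min_le_left _ _)
    nlinarith
  have hκc : Kg * κ ≤ c := by
    rw [hκ, mul_div_assoc', div_le_iff₀ (by positivity)]
    nlinarith
  set τ := unitBallVolume n * (η / 4) ^ n / 2 with hτ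
  have hτ0 : 0 < τ := by have := unitBallVolume_pos n; positivity
  refine ⟨c, κ, η / 4, τ, η * τ, ?_, ?_, hκ0, by positivity, by positivity, hτ0, by rw [hτ]; ring,
    ?_, ?_⟩
  · rw [hc, mul_div_cancel₀ _ h2n.ne']
    exact min_le_left _ _
  · have : 2 ^ n * (2 * c) = 2 * min lam (1 / 2) := by rw [hc]; field_simp
    rw [this]
    linarith [min_le_right lam (1 / 2)]
  · calc _ = (B * η + Kg * κ / 2) * τ := by rw [hB]; ring
      _ ≤ (c / 2 + c / 2) * τ := by gcongr
      _ = _ := by ring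
  · have : 16 * (η / 4) ^ 2 ≤ η := by nlinarith
    gcongr

/-- Nondegeneracy: near a point where `u i` is positive, `u i` is not too small on average. -/
theorem exists_nondegeneracy (n : ℕ) {lam Kf Kg : ℝ} (hlam : 0 < lam) (hKf : 0 ≤ Kf)
    (hKg : 0 ≤ Kg) : ∃ c > (0 : ℝ), ∀ {N : ℕ} {P : FBProblem n N}
      {u : Fin N → EuclideanSpace ℝ (Fin n) → ℝ} {W : Fin N → Set (EuclideanSpace ℝ (Fin n))}
      {i : Fin N} {ε : ℝ}, P.IsGoodMinimizer u W i lam ε Kf Kg →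
      ∀ {z : EuclideanSpace ℝ (Fin n)} {ρ : ℝ}, 0 < ρ → ρ ≤ 1 → ContinuousOn (u i) (ball z ρ) →
        volume (ball z ρ) ≤ ENNReal.ofReal ε → 0 < u i z →
        c * ρ ^ (n + 2) ≤ ∫ x in ball z ρ, posPartFun (u i) x ^ 2 := by
  obtain ⟨C, hC0, hcut⟩ := exists_isCutoffConstant
  obtain ⟨c, κ, t, τ, σ, hcl, hc1, hκ, ht, hσ, hτ0, hτ, h1, h2⟩ :=
    exists_deGiorgi_constants n (C := C) hlam hKf hKg
  have hω := unitBallVolume_pos n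
  -- the constants for the first step
  set a := lam * τ / (2 ^ n * (2 * (Kg * unitBallVolume n + 1))) with ha
  have ha0 : 0 < a := by positivity
  set B := 48 * C ^ 2 + Kf + Kg / (2 * a) with hB
  have hB0 : 0 ≤ B := by positivity
  set c' := min (lam * τ / (2 ^ n * (2 * (B + 1)))) (σ / 2 ^ (n + 2)) with hc'
  have hc'0 : 0 < c' := by positivity
  refine ⟨c', hc'0, ?_⟩
  intro N P u W i ε h z ρ hρ hρ1 hcont hε hz
  by_contra hcon
  rw [not_le] at hcon
  have hui := h.isMinimizer.memW12 i
  have hp := hui.posPart.1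
  -- The radii s k decrease from ρ/2 to ρ/4, with s (k + 1) + d k / 4 = s k, which is the geometry
  -- of `IsGoodMinimizer.halving`.
  set d : ℕ → ℝ := fun k => (ρ / 2) * (1 / 2) ^ k with hd
  set s : ℕ → ℝ := fun k => ρ / 4 + d k / 2 with hs
  have hd0 : ∀ k, 0 < d k := fun k => by positivity
  have hdle : ∀ k, d k ≤ ρ / 2 := fun k =>
    mul_le_of_le_one_right (by positivity) (pow_le_one₀ (by norm_num) (by norm_num))
  have hdsucc : ∀ k, d (k + 1) = d k / 2 := fun k => by simp only [hd, pow_succ]; ring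
  have hssucc : ∀ k, s (k + 1) + d k / 4 = s k := fun k => by
    simp only [hs, hdsucc]; ring
  have hsball : ∀ k, ball z (s k) ⊆ ball z ρ := fun k =>
    ball_subset_ball (by have := hdle k; simp only [hs]; linarith)
  have hiter : ∀ k, ∫ x in ball z (s k), posPartFun (u i) x ^ 2 ≤ σ * d k ^ (n + 2) ∧
      volume.real ({x | 0 < u i x} ∩ ball z (s k)) ≤ τ * d k ^ n := by
    intro k
    induction k with
    | zero =>
      have hd0' : d 0 = ρ / 2 := by simp [hd]
      have hs0' : s 0 = ρ / 2 := by simp only [hs, hd0']; ring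
      have hsub : ball z (ρ / 2) ⊆ ball z ρ := ball_subset_ball (by linarith)
      rw [hd0', hs0']
      constructor
      · calc _ ≤ _ := hp.setIntegral_sq_mono hsub
          _ ≤ c' * ρ ^ (n + 2) := hcon.le
          _ ≤ σ / 2 ^ (n + 2) * ρ ^ (n + 2) := by
            gcongr
            exact min_le_right _ _
          _ = _ := by rw [div_pow]; ring
      -- To start, |{u > 0}| is not known to be small. One Caccioppoli step from ρ to ρ/2, with the
      -- trivial volume bound and the small Young parameter aρ, makes it so.
      · have hcac := h.caccioppoli hKf hKg hcut (z := z) (s := ρ / 2) (s' := ρ)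
          (by positivity) (by linarith) (hcont.mono hsub) ((measure_mono hsub).trans hε)
        have hI := setIntegral_posPartFun_le hui (measurableSet_pos_inter_ball hcont)
          (mul_pos ha0 hρ)
        have hE0 : 0 ≤ ∫ x in ball z (ρ / 2), ‖weakGrad (posPartFun (u i)) x‖ ^ 2 :=
          integral_nonneg fun x => by positivity
        have hA1 : volume.real ({x | 0 < u i x} ∩ ball z ρ) ≤ unitBallVolume n * ρ ^ n := by
          rw [← volume_real_ball z hρ]
          exact measureReal_mono Set.inter_subset_right measure_ball_lt_top.ne
        set U := ∫ x in ball z ρ, posPartFun (u i) x ^ 2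
        have b1 : (12 * (C / (ρ - ρ / 2)) ^ 2 + Kf) * U ≤ (48 * C ^ 2 + Kf) * c' * ρ ^ n := by
          calc _ ≤ (12 * (C / (ρ - ρ / 2)) ^ 2 + Kf) * (c' * ρ ^ (n + 2)) := by gcongr
            _ = (48 * C ^ 2 + Kf * ρ ^ 2) * c' * ρ ^ n := by
              have : ρ - ρ / 2 = ρ / 2 := by ring
              rw [this]
              field_simp
              ring
            _ ≤ (48 * C ^ 2 + Kf * 1) * c' * ρ ^ n := by
              gcongr
              exact pow_le_one₀ hρ.le hρ1
            _ = _ := by ring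
        have b2 : ∫ x in ball z ρ, posPartFun (u i) x ≤
            (c' / (2 * a) + a * unitBallVolume n / 2) * ρ ^ n := by
          calc _ ≤ _ := hI
            _ ≤ c' * ρ ^ (n + 2) / (2 * (a * ρ)) + a * ρ / 2 * (unitBallVolume n * ρ ^ n) := by gcongr
            _ = (c' / (2 * a) + a * unitBallVolume n / 2) * ρ ^ n * ρ := by field_simp; ring
            _ ≤ (c' / (2 * a) + a * unitBallVolume n / 2) * ρ ^ n * 1 := by gcongr
            _ = _ := mul_one _
        have b3 : B * c' ≤ lam * τ / (2 ^ n * 2) := by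
          calc B * c' ≤ (B + 1) * (lam * τ / (2 ^ n * (2 * (B + 1)))) := by
                gcongr
                · linarith
                · exact min_le_left _ _
            _ = _ := by field_simp
        have b4 : Kg * (a * unitBallVolume n / 2) ≤ lam * τ / (2 ^ n * 2) := by
          calc Kg * (a * unitBallVolume n / 2) ≤ (Kg * unitBallVolume n + 1) * a := by
                nlinarith [mul_nonneg hKg hω.le]
            _ = _ := by rw [ha]; field_simp
        have b5 : lam * volume.real ({x | 0 < u i x} ∩ ball z (ρ / 2)) ≤
            lam * (τ * (ρ / 2) ^ n) := by
          calc _ ≤ (48 * C ^ 2 + Kf) * c' * ρ ^ n +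
                Kg * ((c' / (2 * a) + a * unitBallVolume n / 2) * ρ ^ n) := by
                have := mul_le_mul_of_nonneg_left b2 hKg
                linarith
            _ = (B * c' + Kg * (a * unitBallVolume n / 2)) * ρ ^ n := by rw [hB]; ring
            _ ≤ (lam * τ / (2 ^ n * 2) + lam * τ / (2 ^ n * 2)) * ρ ^ n := by gcongr
            _ = _ := by rw [div_pow]; field_simp; ring
        exact le_of_mul_le_mul_left b5 hlam
    | succ k ih =>
      have := h.halving hKf hKg hlam hcut hcl hc1 hκ ht hσ.le hτ h1 h2 (z := z) (s := s (k + 1))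
        (d := d k) (by have := hd0 (k + 1); simp only [hs]; positivity) (hd0 k)
        (by have := hdle k; linarith) (by rw [hssucc]; exact hcont.mono (hsball k))
        (by rw [hssucc]; exact (measure_mono (hsball k)).trans hε) (by rw [hssucc]; exact ih.1)
        (by rw [hssucc]; exact ih.2)
      rw [hdsucc]
      exact this
  have hlim : Tendsto (fun k => σ * d k ^ (n + 2)) atTop (𝓝 0) := by
    have e1 : Tendsto d atTop (𝓝 0) := by
      have := (tendsto_pow_atTop_nhds_zero_of_lt_one (r := (1 / 2 : ℝ)) (by norm_num)
        (by norm_num)).const_mul (ρ / 2)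
      rwa [mul_zero] at this
    have := (e1.pow (n + 2)).const_mul σ
    simpa using this
  -- All the balls contain B(z, ρ/4), so u₊ = 0 a.e. there; but {u > 0} meets it in an open set
  -- containing z.
  have hU0 : ∫ x in ball z (ρ / 4), posPartFun (u i) x ^ 2 ≤ 0 := by
    refine ge_of_tendsto' hlim fun k => le_trans (hp.setIntegral_sq_mono ?_) (hiter k).1
    exact ball_subset_ball (by have := hd0 k; simp only [hs]; linarith)
  have hzero : (fun x => posPartFun (u i) x ^ 2) =ᵐ[volume.restrict (ball z (ρ / 4))] 0 :=
    (setIntegral_eq_zero_iff_of_nonneg_ae (Eventually.of_forall fun x => sq_nonneg _)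
      (hp.integrableOn_sq z (ρ / 4))).1 (le_antisymm hU0 (integral_nonneg fun x => sq_nonneg _))
  have hsub : ball z (ρ / 4) ⊆ ball z ρ := ball_subset_ball (by linarith)
  have hopen : IsOpen (ball z (ρ / 4) ∩ u i ⁻¹' Set.Ioi 0) :=
    (hcont.mono hsub).isOpen_inter_preimage isOpen_ball isOpen_Ioi
  have hpos : 0 < volume (ball z (ρ / 4) ∩ u i ⁻¹' Set.Ioi 0) :=
    hopen.measure_pos volume ⟨z, mem_ball_self (by positivity), hz⟩
  have hnull : volume (ball z (ρ / 4) ∩ u i ⁻¹' Set.Ioi 0) = 0 := by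
    rw [EventuallyEq, ae_restrict_iff' measurableSet_ball] at hzero
    rw [← compl_compl (ball z (ρ / 4) ∩ u i ⁻¹' Set.Ioi 0)]
    refine mem_ae_iff.1 ?_
    filter_upwards [hzero] with x hx hx'
    have h3 := hx hx'.1
    have h4 : posPartFun (u i) x = u i x := max_eq_right (le_of_lt hx'.2)
    simp only [Pi.zero_apply, h4] at h3
    have h5 : 0 < u i x := hx'.2
    have : u i x = 0 := by simpa using h3
    exact absurd this h5.ne'
  exact hpos.ne' hnull

end FBProblem

/-! ### Poincaré inequality on a ball. -/

section BallPoincare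

variable {n : ℕ} {q : EuclideanSpace ℝ (Fin n) → ℝ}

/-- With Y = B(0, 2r), every point of T is reached from every point of B(x, r), so the constant m of
`HasWeakGrad.poincare` is the full measure of T. -/
theorem MemW12.poincare_ball (hq : MemW12 q) {x : EuclideanSpace ℝ (Fin n)} {r : ℝ} (hr : 0 < r)
    {T : Set (EuclideanSpace ℝ (Fin n))} (hT : MeasurableSet T) (hTb : T ⊆ ball x r) {M : ℝ}
    (hM : 0 ≤ M) (hqM : ∀ a ∈ T, |q a| ≤ M) :
    volume.real T * ∫ y in ball x r, q y ^ 2 ≤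
      2 ^ (n + 3) * unitBallVolume n * r ^ (n + 2) * (∫ y in ball x r, ‖weakGrad q y‖ ^ 2) +
        2 * M ^ 2 * (volume.real T * (unitBallVolume n * r ^ n)) := by
  lift M to ℝ≥0 using hM
  have hω := unitBallVolume_pos n
  have hTfin : volume T ≠ ⊤ := ne_top_of_le_ne_top measure_ball_lt_top.ne (measure_mono hTb)
  have key := hq.hasWeakGrad_weakGrad.poincare hq.memLp_weakGrad (C := ball x r) (T := T)
    (Y := ball 0 (2 * r)) (R := (2 * r).toNNReal) (m := volume T) (convex_ball x r)
    measurableSet_ball hT hTb measurableSet_ball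
    (fun y hy => (mem_ball_zero_iff.1 hy).le.trans (Real.le_coe_toNNReal _)) (fun a ha => ?_) hqM
  · have e1 : ∫⁻ a in ball x r, ‖q a‖ₑ ^ 2 = ENNReal.ofReal (∫ y in ball x r, q y ^ 2) := by
      rw [lintegral_enorm_sq_eq_ofReal (hq.memLp_ball x r)]
      simp
    have e2 : ∫⁻ a in ball x r, ‖weakGrad q a‖ₑ ^ 2 =
        ENNReal.ofReal (∫ y in ball x r, ‖weakGrad q y‖ ^ 2) :=
      lintegral_enorm_sq_eq_ofReal (hq.memLp_weakGrad.restrict _)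
    have e3 : volume T = ENNReal.ofReal (volume.real T) := (ENNReal.ofReal_toReal hTfin).symm
    have e4 : ((2 * r).toNNReal : ℝ≥0∞) = ENNReal.ofReal (2 * r) := rfl
    have e5 : (M : ℝ≥0∞) = ENNReal.ofReal M := ENNReal.ofReal_coe_nnreal.symm
    have h2 : (2 : ℝ≥0∞) = ENNReal.ofReal 2 := by simp
    have hE : 0 ≤ ∫ y in ball x r, ‖weakGrad q y‖ ^ 2 := integral_nonneg fun _ => by positivity
    have hV : 0 ≤ volume.real T := measureReal_nonneg
    rw [e1, e2, e3, e4, e5, volume_ball_eq x hr, volume_ball_eq 0 (by positivity : 0 < 2 * r)] at key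
    generalize (∫ y in ball x r, ‖weakGrad q y‖ ^ 2) = E at *
    generalize (∫ y in ball x r, q y ^ 2) = U at *
    generalize volume.real T = V at *
    rw [h2, ← ENNReal.ofReal_pow (by positivity), ← ENNReal.ofReal_pow (by positivity),
      ← ENNReal.ofReal_mul (by positivity), ← ENNReal.ofReal_mul (by positivity),
      ← ENNReal.ofReal_mul (by positivity), ← ENNReal.ofReal_mul (by positivity),
      ← ENNReal.ofReal_mul (by positivity), ← ENNReal.ofReal_mul (by positivity),
      ← ENNReal.ofReal_mul (by positivity), ← ENNReal.ofReal_add (by positivity) (by positivity),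
      ENNReal.ofReal_le_ofReal_iff (by positivity)] at key
    calc _ ≤ _ := key
      _ = _ := by ring
  · have : {y | y ∈ ball (0 : EuclideanSpace ℝ (Fin n)) (2 * r) ∧ a + y ∈ T} =
        (fun y => a + y) ⁻¹' T := by
      ext y
      refine ⟨fun h => h.2, fun h => ⟨?_, h⟩⟩
      have h1 : dist (a + y) x < r := hTb h
      have h2 : dist a x < r := ha
      rw [mem_ball_zero_iff]
      have h3 : ‖y‖ = dist (a + y) a := by simp
      have := dist_triangle_right (a + y) a x
      linarith
    rw [this, measure_preimage_add]

end BallPoincare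

/-! ### Density and gradient bounds near the free boundary. -/

namespace FBProblem

variable {n N : ℕ} {P : FBProblem n N} {u : Fin N → EuclideanSpace ℝ (Fin n) → ℝ}
  {W : Fin N → Set (EuclideanSpace ℝ (Fin n))} {i : Fin N} {lam ε Kf Kg : ℝ}

/-- A negative value would keep positive values away from y. A positive value would make y an
interior point of the positivity set, because v > 0 forces membership in Ω inside the ball. -/
theorem eq_zero_of_mem_frontier_posSet {v : EuclideanSpace ℝ (Fin n) → ℝ}
    {x y : EuclideanSpace ℝ (Fin n)} {r : ℝ} (hc : ContinuousOn v (ball x r))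
    (hv : ∀ a ∈ ball x r, a ∉ P.Ω → v a = 0) (hy : y ∈ ball x r) (hf : y ∈ frontier (P.posSet v)) :
    v y = 0 := by
  have hb : ball x r ∈ 𝓝 y := isOpen_ball.mem_nhds hy
  have hcy : ContinuousAt v y := hc.continuousAt hb
  rcases lt_trichotomy (v y) 0 with h | h | h
  · exfalso
    have : (P.posSet v)ᶜ ∈ 𝓝 y := by
      filter_upwards [hcy.eventually_lt_const h] with a ha h'
      exact lt_asymm ha h'.2
    exact mem_closure_iff_nhds.1 hf.1 _ this |>.elim fun a ha => ha.1 ha.2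
  · exact h
  · exfalso
    refine hf.2 (mem_interior_iff_mem_nhds.2 ?_)
    filter_upwards [hcy.eventually_const_lt h, hb] with a ha hab
    refine ⟨?_, ha⟩
    by_contra hΩ
    exact ha.ne' (hv a hab hΩ)

theorem exists_mem_posSet {v : EuclideanSpace ℝ (Fin n) → ℝ} {B : Set (EuclideanSpace ℝ (Fin n))}
    (hB : IsOpen B) (h : (B ∩ frontier (P.posSet v)).Nonempty) : ∃ z ∈ B, 0 < v z := by
  obtain ⟨y, hyB, hy⟩ := h
  obtain ⟨z, hzB, hz⟩ := mem_closure_iff_nhds.1 hy.1 B (hB.mem_nhds hyB)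
  exact ⟨z, hzB, hz.2⟩

/-- The volume bound makes balls of radius ar admissible for the good-region condition when r ≤
ε^(1/n); the bound 1/4 keeps B(z, ar) in B(x, 3r/4) when z ∈ B(x, r/2). -/
theorem exists_radius_factor (hn : n ≠ 0) : ∃ a > (0 : ℝ), a ≤ 1 / 4 ∧ unitBallVolume n * a ^ n ≤ 1 := by
  have hω := unitBallVolume_pos n
  refine ⟨min (1 / 4) (1 / (unitBallVolume n + 1)), by positivity, min_le_left _ _, ?_⟩
  have h1 : min (1 / 4) (1 / (unitBallVolume n + 1)) ≤ 1 := (min_le_left _ _).trans (by norm_num)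
  calc _ ≤ unitBallVolume n * min (1 / 4) (1 / (unitBallVolume n + 1)) := by
        gcongr
        exact pow_le_of_le_one (by positivity) h1 hn
    _ ≤ (unitBallVolume n + 1) * (1 / (unitBallVolume n + 1)) := by
        gcongr
        · linarith
        · exact min_le_right _ _
    _ = 1 := by field_simp

theorem volume_ball_le_of_radius {r a : ℝ} (hn : n ≠ 0) (hε : 0 < ε) (hr : 0 < r)
    (hrε : r ≤ ε ^ (1 / (n : ℝ))) (ha : 0 < a) (haω : unitBallVolume n * a ^ n ≤ 1)
    (z : EuclideanSpace ℝ (Fin n)) : volume (ball z (a * r)) ≤ ENNReal.ofReal ε := by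
  rw [volume_ball_eq z (by positivity)]
  refine ENNReal.ofReal_le_ofReal ?_
  have h1 : r ^ n ≤ ε := by
    calc r ^ n ≤ (ε ^ (1 / (n : ℝ))) ^ n := by gcongr
      _ = ε := by rw [one_div, Real.rpow_inv_natCast_pow hε.le hn]
  calc unitBallVolume n * (a * r) ^ n = unitBallVolume n * a ^ n * r ^ n := by rw [mul_pow]; ring
    _ ≤ 1 * r ^ n := by gcongr
    _ ≤ ε := by rwa [one_mul]

/-- The integral is over B(x, 3r/4) rather than B(x, r) to leave room for a cutoff in
`exists_density_bounds`. -/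
theorem exists_nondegeneracy_near (hn : n ≠ 0) {lam Kf Kg : ℝ} (hlam : 0 < lam) (hKf : 0 ≤ Kf)
    (hKg : 0 ≤ Kg) : ∃ c > (0 : ℝ), ∀ {N : ℕ} {P : FBProblem n N}
      {u : Fin N → EuclideanSpace ℝ (Fin n) → ℝ} {W : Fin N → Set (EuclideanSpace ℝ (Fin n))}
      {i : Fin N} {ε : ℝ}, P.IsGoodMinimizer u W i lam ε Kf Kg → 0 < ε →
      ∀ {x z : EuclideanSpace ℝ (Fin n)} {r : ℝ}, 0 < r → r ≤ min 1 (ε ^ (1 / (n : ℝ))) →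
        ContinuousOn (u i) (ball x r) → z ∈ ball x (r / 2) → 0 < u i z →
        c * r ^ (n + 2) ≤ ∫ y in ball x (3 / 4 * r), posPartFun (u i) y ^ 2 := by
  obtain ⟨c, hc, H⟩ := exists_nondegeneracy n hlam hKf hKg
  obtain ⟨a, ha, ha4, haω⟩ := exists_radius_factor hn
  refine ⟨c * a ^ (n + 2), by positivity, ?_⟩
  intro N P u W i ε h hε x z r hr hrε hcont hz hpos
  have hr1 : r ≤ 1 := hrε.trans (min_le_left _ _)
  have hsub : ball z (a * r) ⊆ ball x (3 / 4 * r) := by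
    refine ball_subset_ball' ?_
    have : dist z x < r / 2 := hz
    nlinarith
  have := H h (z := z) (ρ := a * r) (by positivity) (by nlinarith)
    (hcont.mono (hsub.trans (ball_subset_ball (by linarith))))
    (volume_ball_le_of_radius hn hε hr (hrε.trans (min_le_right _ _)) ha haω z) hpos
  calc c * a ^ (n + 2) * r ^ (n + 2) = c * (a * r) ^ (n + 2) := by rw [mul_pow]; ring
    _ ≤ _ := this
    _ ≤ _ := (h.isMinimizer.memW12 i).posPart.1.setIntegral_sq_mono hsub

theorem setAverage_ball_eq (f : EuclideanSpace ℝ (Fin n) → ℝ) (x : EuclideanSpace ℝ (Fin n)) {r : ℝ}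
    (hr : 0 < r) : ∫ y in ball x r, f y = unitBallVolume n * r ^ n * ⨍ y in ball x r, f y := by
  rw [setAverage_eq, volume_real_ball x hr, smul_eq_mul, mul_inv_cancel_left₀]
  have := unitBallVolume_pos n
  positivity

theorem IsMinimizer.posSet_ae_eq (h : P.IsMinimizer u W) (i : Fin N) :
    P.posSet (u i) =ᵐ[volume] {x | 0 < u i x} := by
  filter_upwards [h.ae_mem_of_pos i] with x hx
  exact propext ⟨fun h' => h'.2, fun h' => ⟨h.1.1.2.1 i (hx (ne_of_gt h')), h'⟩⟩

/-- Lower bounds for the size of `u₊` and for the density of `{u > 0}` near a boundary point. -/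
theorem exists_density_bounds (hn : n ≠ 0) {lam Kf Kg Lam : ℝ} (hlam : 0 < lam) (hKf : 0 ≤ Kf)
    (hKg : 0 ≤ Kg) (hLam : 0 ≤ Lam) : ∃ c₁ > (0 : ℝ), ∃ c₂ > (0 : ℝ), ∀ {N : ℕ} {P : FBProblem n N}
      {u : Fin N → EuclideanSpace ℝ (Fin n) → ℝ} {W : Fin N → Set (EuclideanSpace ℝ (Fin n))}
      {i : Fin N} {ε : ℝ}, P.IsGoodMinimizer u W i lam ε Kf Kg → 0 < ε →
      ∀ {x : EuclideanSpace ℝ (Fin n)} {r : ℝ}, 0 < r → ContinuousOn (u i) (ball x r) →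
        r ≤ min 1 (ε ^ (1 / (n : ℝ))) →
        (ball x (r / 2) ∩ frontier (P.posSet (u i))).Nonempty →
        ⨍ y in ball x r, ‖weakGrad (posPartFun (u i)) y‖ ^ 2 ≤ Lam →
        c₁ * r ^ 2 ≤ ⨍ y in ball x r, posPartFun (u i) y ^ 2 ∧
        ENNReal.ofReal (c₂ * r ^ n) ≤ volume (P.posSet (u i) ∩ ball x r) := by
  obtain ⟨c, hc, H⟩ := exists_nondegeneracy_near hn hlam hKf hKg
  obtain ⟨C, hC0, hcut⟩ := exists_isCutoffConstant
  have hω := unitBallVolume_pos n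
  -- The bound 8b²K anticipates Faber–Krahn with radius br below; 2^(n+8) is the Poincaré constant
  -- 2^(n+4) times 16, from the cutoff gap r/4.
  set K := Lam * unitBallVolume n * (1 + 2 ^ (n + 8) * C ^ 2) with hK
  have hK0 : 0 ≤ K := by positivity
  set b := min 1 (c / (8 * (K + 1))) with hb
  have hb0 : 0 < b := by positivity
  have hb1 : b ≤ 1 := min_le_left _ _
  have hbK : 8 * b ^ 2 * K < c := by
    have h1 : b * (8 * (K + 1)) ≤ c := (le_div_iff₀ (by positivity)).1 (min_le_right _ _)
    have h2 : b ^ 2 ≤ b := pow_le_of_le_one hb0.le hb1 (by norm_num)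
    have h3 : b ^ 2 * K ≤ b * K := by gcongr
    linarith
  refine ⟨c / unitBallVolume n, by positivity, unitBallVolume n * b ^ n / 2, by positivity, ?_⟩
  intro N P u W i ε h hε x r hr hcont hrε hfr hL
  have hp := (h.isMinimizer.memW12 i).posPart.1
  obtain ⟨z, hz, hpos⟩ := exists_mem_posSet isOpen_ball hfr
  have hND := H h hε hr hrε hcont hz hpos
  constructor
  · have h1 := hND.trans (hp.setIntegral_sq_mono (ball_subset_ball (by linarith : 3 / 4 * r ≤ r)))
    rw [setAverage_ball_eq _ x hr] at h1
    have h2 : r ^ n * (c * r ^ 2) ≤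
        r ^ n * (unitBallVolume n * ⨍ y in ball x r, posPartFun (u i) y ^ 2) := by
      calc _ = c * r ^ (n + 2) := by ring
        _ ≤ _ := h1
        _ = _ := by ring
    have h3 := le_of_mul_le_mul_left h2 (by positivity)
    rw [div_mul_eq_mul_div, div_le_iff₀ hω]
    linarith
  · set A := {x | 0 < u i x} ∩ ball x r with hA
    have hAm : MeasurableSet A := measurableSet_pos_inter_ball hcont
    have hAb : A ⊆ ball x r := Set.inter_subset_right
    have hAfin : volume A ≠ ⊤ := ne_top_of_le_ne_top measure_ball_lt_top.ne (measure_mono hAb)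
    have hvol : volume (P.posSet (u i) ∩ ball x r) = volume A :=
      measure_congr ((h.isMinimizer.posSet_ae_eq i).inter (ae_eq_refl _))
    rw [hvol, ENNReal.ofReal_le_iff_le_toReal hAfin]
    by_contra hcon
    rw [not_le] at hcon
    change volume.real A < _ at hcon
    -- If {u > 0} is too thin, u₊ = 0 on at least half of the ball. Poincaré bounds ∫u₊² by a
    -- multiple of Lam · r^(n+2), then Faber–Krahn on the thin set improves this by the factor b²
    -- and contradicts nondegeneracy.
    set T := ball x r \ A with hT
    have hTm : MeasurableSet T := MeasurableSet.diff measurableSet_ball hAm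
    have hTvol : unitBallVolume n / 2 * r ^ n ≤ volume.real T := by
      rw [hT, measureReal_sdiff hAb hAm, volume_real_ball x hr]
      have : b ^ n ≤ 1 := pow_le_one₀ hb0.le hb1
      have : unitBallVolume n * b ^ n / 2 * r ^ n ≤ unitBallVolume n * 1 / 2 * r ^ n := by gcongr
      linarith
    have hpoin := hp.poincare_ball hr hTm Set.sdiff_subset (M := 0) le_rfl (fun a ha => by
      have : posPartFun (u i) a = 0 := max_eq_left (not_lt.1 fun h0 => ha.2 ⟨h0, ha.1⟩)
      simp [this])
    set U := ∫ y in ball x r, posPartFun (u i) y ^ 2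
    have hU0 : 0 ≤ U := integral_nonneg fun _ => by positivity
    set E := ∫ y in ball x r, ‖weakGrad (posPartFun (u i)) y‖ ^ 2 with hEdef
    have hE : E ≤ unitBallVolume n * r ^ n * Lam := by
      rw [hEdef, setAverage_ball_eq _ x hr]
      gcongr
    have hU : U ≤ 2 ^ (n + 4) * unitBallVolume n * Lam * r ^ (n + 2) := by
      have h1 : unitBallVolume n / 2 * r ^ n * U ≤
          unitBallVolume n / 2 * r ^ n * (2 ^ (n + 4) * unitBallVolume n * Lam * r ^ (n + 2)) := by
        calc _ ≤ volume.real T * U := by gcongr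
          _ ≤ _ := hpoin
          _ = 2 ^ (n + 3) * unitBallVolume n * r ^ (n + 2) * E := by ring
          _ ≤ 2 ^ (n + 3) * unitBallVolume n * r ^ (n + 2) * (unitBallVolume n * r ^ n * Lam) := by
            gcongr
          _ = _ := by ring
      exact le_of_mul_le_mul_left h1 (by positivity)
    have hFK := hp.faberKrahn_ball hcut (z := x) (s := 3 / 4 * r) (s' := r) (R := b * r)
      (by positivity) (by linarith) (by positivity) hAm
      (fun a ha ha' => max_eq_left (not_lt.1 fun h0 => ha' ⟨h0, ha⟩)) hAfin (by
        rw [mul_pow]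
        linarith)
    have h4 : ∫ y in ball x (3 / 4 * r), posPartFun (u i) y ^ 2 ≤ 8 * b ^ 2 * K * r ^ (n + 2) := by
      calc _ ≤ _ := hFK
        _ ≤ 8 * (b * r) ^ 2 * (unitBallVolume n * r ^ n * Lam + (C / (r - 3 / 4 * r)) ^ 2 *
            (2 ^ (n + 4) * unitBallVolume n * Lam * r ^ (n + 2))) := by gcongr
        _ = _ := by
          have : r - 3 / 4 * r = r / 4 := by ring
          rw [this, hK]
          field_simp
          ring
    have h5 : c * r ^ (n + 2) ≤ 8 * b ^ 2 * K * r ^ (n + 2) := hND.trans h4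
    exact absurd (le_of_mul_le_mul_right h5 (by positivity)) (not_le.2 hbK)

/-- Lower bound for the gradient of `u₊` near a boundary point. -/
theorem exists_gradient_bound (hn : n ≠ 0) {lam Kf Kg : ℝ} {C₀ : ℝ≥0} (hlam : 0 < lam) (hKf : 0 ≤ Kf)
    (hKg : 0 ≤ Kg) (hC₀ : 0 < C₀) : ∃ c₃ > (0 : ℝ), ∀ {N : ℕ} {P : FBProblem n N}
      {u : Fin N → EuclideanSpace ℝ (Fin n) → ℝ} {W : Fin N → Set (EuclideanSpace ℝ (Fin n))}
      {i : Fin N} {ε : ℝ}, P.IsGoodMinimizer u W i lam ε Kf Kg → 0 < ε →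
      ∀ {x : EuclideanSpace ℝ (Fin n)} {r : ℝ}, 0 < r → ContinuousOn (u i) (ball x r) →
        r ≤ min 1 (ε ^ (1 / (n : ℝ))) →
        (ball x (r / 2) ∩ frontier (P.posSet (u i))).Nonempty →
        ((LipschitzOnWith C₀ (u i) (ball x r) ∧ ∀ y ∈ ball x r, y ∉ P.Ω → u i y = 0) ∨
          ENNReal.ofReal ((C₀ : ℝ)⁻¹ * r ^ n) ≤ volume (ball x r \ P.posSet (u i))) →
        c₃ ≤ ⨍ y in ball x r, ‖weakGrad (posPartFun (u i)) y‖ ^ 2 := by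
  obtain ⟨c, hc, H⟩ := exists_nondegeneracy_near hn hlam hKf hKg
  have hω := unitBallVolume_pos n
  have hC : (0 : ℝ) < C₀ := hC₀
  -- On B(y, τr) around a free boundary point y one has u₊ ≤ C₀τr. This τ makes the corresponding
  -- Poincaré term at most half of the nondegeneracy bound.
  set τ := min (1 / 2) (c / (4 * (C₀ : ℝ) ^ 2 * unitBallVolume n)) with hτ
  have hτ0 : 0 < τ := by positivity
  have hτ2 : τ ≤ 1 / 2 := min_le_left _ _
  have hτc : 2 * (C₀ : ℝ) ^ 2 * τ ^ 2 * unitBallVolume n ≤ c / 2 := by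
    have h1 : τ * (4 * (C₀ : ℝ) ^ 2 * unitBallVolume n) ≤ c :=
      (le_div_iff₀ (by positivity)).1 (min_le_right _ _)
    have h2 : τ ^ 2 ≤ τ := pow_le_of_le_one hτ0.le (by linarith) (by norm_num)
    calc _ ≤ 2 * (C₀ : ℝ) ^ 2 * τ * unitBallVolume n := by gcongr
      _ ≤ _ := by linarith
  refine ⟨min (c * τ ^ n / (2 ^ (n + 4) * unitBallVolume n))
    (c / (C₀ * 2 ^ (n + 3) * unitBallVolume n ^ 2)), by positivity, ?_⟩
  intro N P u W i ε h hε x r hr hcont hrε hfr hor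
  have hp := (h.isMinimizer.memW12 i).posPart.1
  obtain ⟨z, hz, hpos⟩ := exists_mem_posSet isOpen_ball hfr
  have hND := (H h hε hr hrε hcont hz hpos).trans
    (hp.setIntegral_sq_mono (ball_subset_ball (by linarith : 3 / 4 * r ≤ r)))
  rcases hor with ⟨hlip, hΩ⟩ | hvol
  · obtain ⟨y, hy, hyf⟩ := hfr
    have hyx : dist y x < r / 2 := hy
    have hyr : y ∈ ball x r := ball_subset_ball (by linarith) hy
    have hy0 : u i y = 0 := eq_zero_of_mem_frontier_posSet hcont hΩ hyr hyf
    have hsub : ball y (τ * r) ⊆ ball x r := ball_subset_ball' (by nlinarith)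
    have hpoin := hp.poincare_ball hr measurableSet_ball hsub (M := C₀ * (τ * r)) (by positivity)
      (fun a ha => by
        rw [abs_of_nonneg (posPartFun_nonneg _ _)]
        refine max_le (by positivity) ?_
        have h1 := hlip.dist_le_mul a (hsub ha) y hyr
        rw [hy0, Real.dist_0_eq_abs] at h1
        refine (le_abs_self _).trans (h1.trans ?_)
        gcongr
        exact (mem_ball.1 ha).le)
    refine (min_le_left _ _).trans ?_
    rw [volume_real_ball y (by positivity), setAverage_ball_eq (fun y => ‖_‖ ^ 2) x hr] at hpoin
    set E := ⨍ y in ball x r, ‖weakGrad (posPartFun (u i)) y‖ ^ 2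
    rw [div_le_iff₀ (by positivity)]
    have h1 : (unitBallVolume n * r ^ (2 * n + 2)) * (τ ^ n * c) ≤ (unitBallVolume n * r ^ (2 * n + 2)) *
        (2 ^ (n + 3) * unitBallVolume n * E + (2 * (C₀ : ℝ) ^ 2 * τ ^ 2 * unitBallVolume n) * τ ^ n) := by
      calc _ = unitBallVolume n * (τ * r) ^ n * (c * r ^ (n + 2)) := by ring
        _ ≤ unitBallVolume n * (τ * r) ^ n * ∫ y in ball x r, posPartFun (u i) y ^ 2 := by gcongr
        _ ≤ _ := hpoin
        _ = _ := by ring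
    have h2 := le_of_mul_le_mul_left h1 (by positivity)
    have h3 : (2 * (C₀ : ℝ) ^ 2 * τ ^ 2 * unitBallVolume n) * τ ^ n ≤ c / 2 * τ ^ n := by gcongr
    have h4 : (2 : ℝ) ^ (n + 4) = 2 * 2 ^ (n + 3) := by ring
    rw [h4]
    linarith
  -- Here u₊ vanishes on T, which has measure at least r^n/C₀, so the Poincaré inequality is used
  -- with M = 0.
  · set T := ball x r \ ({x | 0 < u i x} ∩ ball x r) with hT
    have hTm : MeasurableSet T :=
      MeasurableSet.diff measurableSet_ball (measurableSet_pos_inter_ball hcont)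
    have hTfin : volume T ≠ ⊤ :=
      ne_top_of_le_ne_top measure_ball_lt_top.ne (measure_mono Set.sdiff_subset)
    have e : volume (ball x r \ P.posSet (u i)) = volume T := by
      refine measure_congr ?_
      filter_upwards [h.isMinimizer.posSet_ae_eq i] with a ha
      have ha' : a ∈ P.posSet (u i) ↔ 0 < u i a := iff_of_eq ha
      refine propext ⟨fun h1 => ⟨h1.1, fun h2 => h1.2 (ha'.2 h2.1)⟩,
        fun h1 => ⟨h1.1, fun h2 => h1.2 ⟨ha'.1 h2, h1.1⟩⟩⟩
    rw [e, ENNReal.ofReal_le_iff_le_toReal hTfin] at hvol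
    change _ ≤ volume.real T at hvol
    have hpoin := hp.poincare_ball hr hTm Set.sdiff_subset (M := 0) le_rfl (fun a ha => by
      have : posPartFun (u i) a = 0 := max_eq_left (not_lt.1 fun h0 => ha.2 ⟨h0, ha.1⟩)
      simp [this])
    refine (min_le_right _ _).trans ?_
    rw [setAverage_ball_eq (fun y => ‖_‖ ^ 2) x hr] at hpoin
    set E := ⨍ y in ball x r, ‖weakGrad (posPartFun (u i)) y‖ ^ 2
    rw [div_le_iff₀ (by positivity)]
    have h1 : r ^ (2 * n + 2) * ((C₀ : ℝ)⁻¹ * c) ≤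
        r ^ (2 * n + 2) * (2 ^ (n + 3) * unitBallVolume n ^ 2 * E) := by
      calc _ = (C₀ : ℝ)⁻¹ * r ^ n * (c * r ^ (n + 2)) := by ring
        _ ≤ volume.real T * ∫ y in ball x r, posPartFun (u i) y ^ 2 := by gcongr
        _ ≤ _ := hpoin
        _ = _ := by ring
    have h2 := le_of_mul_le_mul_left h1 (by positivity)
    calc c = C₀ * ((C₀ : ℝ)⁻¹ * c) := by field_simp
      _ ≤ C₀ * (2 ^ (n + 3) * unitBallVolume n ^ 2 * E) := by gcongr
      _ = _ := by ring

end FBProblem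

/-! ### Construction of the radial barrier. -/

section Barrier

theorem exists_smooth_cutoff_profile : ∃ χ : ℝ → ℝ, ContDiff ℝ ∞ χ ∧ (∀ q, 0 ≤ χ q) ∧ (∀ q, χ q ≤ 1) ∧
    (∀ q, q ≤ 1 / 4 → χ q = 1) ∧ (∀ q, 1 ≤ q → χ q = 0) ∧ ∀ q, deriv χ q ≤ 0 := by
  refine ⟨fun q => Real.smoothTransition ((1 - q) * (4 / 3)),
    Real.smoothTransition.contDiff.comp (by fun_prop), fun q => Real.smoothTransition.nonneg _,
    fun q => Real.smoothTransition.le_one _, fun q hq => Real.smoothTransition.one_of_one_le (by linarith),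
    fun q hq => Real.smoothTransition.zero_of_nonpos (by linarith), fun q => ?_⟩
  refine Antitone.deriv_nonpos fun a b hab => Real.smoothTransition.monotone ?_
  linarith

/-- The radial profile of a function whose Laplacian is positive away from the origin. -/
theorem exists_radial_profile (n : ℕ) (hn : n ≠ 0) : ∃ c > (0 : ℝ), ∀ κ > (0 : ℝ), ∃ s > (0 : ℝ),
    s ≤ 1 / 2 ∧ s ≤ κ ∧ ∃ A : ℝ, 0 ≤ A ∧ A * s ^ (n + 1) ≤ κ ∧ ∃ k : ℝ → ℝ, ContDiff ℝ ∞ k ∧ (∀ q, 0 ≤ k q) ∧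
      (∀ q, 1 ≤ q → k q = 0) ∧ (∀ q, s ^ 2 ≤ q → n * k q + 2 * q * deriv k q ≤ 0) ∧
      (∀ q, s ^ 2 ≤ q → q ≤ 1 / 4 → n * k q + 2 * q * deriv k q ≤ -c) ∧
      ∀ q, 0 ≤ q → q ≤ s ^ 2 → n * k q + 2 * q * deriv k q ≤ A := by
  obtain ⟨χ, hχ, hχ0, hχ1, hχone, hχzero, hχd⟩ := exists_smooth_cutoff_profile
  have hn0 : (0 : ℝ) < n := by exact_mod_cast Nat.pos_of_ne_zero hn
  have hn1 : (1 : ℝ) ≤ n := by exact_mod_cast Nat.one_le_iff_ne_zero.2 hn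
  -- With q = |x|², the field q^(-n/2)x is divergence free. The profile behaves like q^(-2p) with 4p
  -- = n + 1/2, slightly more singular, so n k + 2 q k' = -k/2 away from the origin and the cutoff.
  set p : ℝ := (n + 1 / 2) / 4 with hp
  have hp0 : 0 < p := by positivity
  refine ⟨2 ^ (-p - 3), by positivity, fun κ hκ => ?_⟩
  set D : ℝ := n * (4 * n) ^ p with hD
  have hD0 : 0 < D := by positivity
  set s : ℝ := min (1 / 2) (min κ ((κ / D) ^ 2)) with hs
  have hs0 : 0 < s := by positivity
  have hs2 : s ≤ 1 / 2 := min_le_left _ _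
  -- The regularised profile satisfies n(b + q²) - 4pq² = nb - q²/2, and nb = s⁴/4 makes this
  -- negative as soon as q ≥ s². At the centre the price is A = D·s^(-(n+1/2)), so As^(n+1) = D√s is
  -- still small.
  set b : ℝ := s ^ 4 / (4 * n) with hb
  have hb0 : 0 < b := by positivity
  have hB : ∀ q : ℝ, 0 < b + q ^ 2 := fun q => by positivity
  have hsmooth : ContDiff ℝ ∞ fun q : ℝ => (b + q ^ 2) ^ (-p) :=
    ContDiff.rpow_const_of_ne (by fun_prop) fun q => (hB q).ne'
  have hderiv : ∀ q, deriv (fun q => χ q * (b + q ^ 2) ^ (-p)) q =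
      deriv χ q * (b + q ^ 2) ^ (-p) + χ q * (2 * q * -p * (b + q ^ 2) ^ (-p - 1)) := by
    intro q
    have h1 : HasDerivAt (fun q : ℝ => b + q ^ 2) (2 * q) q := by
      simpa using (hasDerivAt_pow 2 q).const_add b
    have h2 := h1.rpow_const (p := -p) (Or.inl (hB q).ne')
    exact ((hχ.differentiable (by simp) q).hasDerivAt.mul h2).deriv
  have hkey : ∀ q, 0 ≤ q → n * (χ q * (b + q ^ 2) ^ (-p)) +
      2 * q * deriv (fun q => χ q * (b + q ^ 2) ^ (-p)) q ≤
        χ q * ((b + q ^ 2) ^ (-p - 1) * (s ^ 4 / 4 - q ^ 2 / 2)) := by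
    intro q hq
    rw [hderiv]
    have e1 : (b + q ^ 2) ^ (-p) = (b + q ^ 2) ^ (-p - 1) * (b + q ^ 2) := by
      rw [Real.rpow_sub_one (hB q).ne', div_mul_cancel₀ _ (hB q).ne']
    have h3 : 0 ≤ 2 * q * (-deriv χ q * (b + q ^ 2) ^ (-p)) := by
      have := hχd q
      have : 0 ≤ -deriv χ q := by linarith
      positivity
    have e2 : n * (χ q * (b + q ^ 2) ^ (-p)) + 2 * q * (χ q * (2 * q * -p * (b + q ^ 2) ^ (-p - 1))) =
        χ q * ((b + q ^ 2) ^ (-p - 1) * (s ^ 4 / 4 - q ^ 2 / 2)) := by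
      have e3 : n * b = s ^ 4 / 4 := by rw [hb]; field_simp
      rw [e1, ← e3, hp]
      ring
    linarith
  refine ⟨s, hs0, hs2, (min_le_right _ _).trans (min_le_left _ _), D * s ^ (-(n + 1 / 2 : ℝ)), by positivity, ?_,
    fun q => χ q * (b + q ^ 2) ^ (-p), hχ.mul hsmooth, fun q => mul_nonneg (hχ0 q)
      (Real.rpow_nonneg (hB q).le _), fun q hq => by simp [hχzero q hq], fun q hq => ?_,
    fun q hq hq4 => ?_, fun q hq hqs => ?_⟩
  · have e : s ^ (-(n + 1 / 2 : ℝ)) * s ^ (n + 1) = Real.sqrt s := by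
      rw [← Real.rpow_natCast, ← Real.rpow_add hs0, Real.sqrt_eq_rpow]
      congr 1
      push_cast
      ring
    rw [mul_assoc, e]
    calc D * Real.sqrt s ≤ D * Real.sqrt ((κ / D) ^ 2) := by
          gcongr
          exact (min_le_right _ _).trans (min_le_right _ _)
      _ = κ := by
        rw [Real.sqrt_sq (by positivity)]
        field_simp
  · have hq0 : 0 ≤ q := (sq_nonneg s).trans hq
    refine (hkey q hq0).trans (mul_nonpos_of_nonneg_of_nonpos (hχ0 q)
      (mul_nonpos_of_nonneg_of_nonpos (Real.rpow_nonneg (hB q).le _) ?_))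
    have : (s ^ 2) ^ 2 ≤ q ^ 2 := by gcongr
    have e : (s ^ 2) ^ 2 = s ^ 4 := by ring
    have := sq_nonneg q
    linarith
  · have hq0 : 0 < q := lt_of_lt_of_le (by positivity) hq
    refine (hkey q hq0.le).trans ?_
    rw [hχone q hq4, one_mul]
    have h1 : s ^ 4 ≤ q ^ 2 := by
      calc s ^ 4 = (s ^ 2) ^ 2 := by ring
        _ ≤ q ^ 2 := by gcongr
    have h2 : b + q ^ 2 ≤ 2 * q ^ 2 := by
      have : b ≤ s ^ 4 := div_le_self (by positivity) (by linarith)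
      linarith
    have h3 : (2 * q ^ 2) ^ (-p - 1) ≤ (b + q ^ 2) ^ (-p - 1) :=
      Real.rpow_le_rpow_of_nonpos (hB q) h2 (by linarith)
    have h4 : (2 * q ^ 2) ^ (-p - 1) * (q ^ 2 / 4) = 2 ^ (-p - 3) * (q ^ 2) ^ (-p) := by
      rw [Real.mul_rpow (by norm_num) (by positivity), Real.rpow_sub_one (by positivity : q ^ 2 ≠ 0),
        show -p - 1 = -p - 3 + 2 by ring, Real.rpow_add (by norm_num)]
      field_simp
      norm_num
    have h5 : 1 ≤ (q ^ 2) ^ (-p) :=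
      Real.one_le_rpow_of_pos_of_le_one_of_nonpos (by positivity) (by nlinarith) (by linarith)
    have h6 : (b + q ^ 2) ^ (-p - 1) * (q ^ 2 / 4) ≤ (b + q ^ 2) ^ (-p - 1) * (q ^ 2 / 2 - s ^ 4 / 4) := by
      gcongr
      linarith
    have h7 : (2 * q ^ 2) ^ (-p - 1) * (q ^ 2 / 4) ≤ (b + q ^ 2) ^ (-p - 1) * (q ^ 2 / 4) := by
      gcongr
    have h8 : (2 : ℝ) ^ (-p - 3) * 1 ≤ 2 ^ (-p - 3) * (q ^ 2) ^ (-p) := by gcongr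
    linarith
  · refine (hkey q hq).trans ?_
    have h1 : (b + q ^ 2) ^ (-p - 1) ≤ b ^ (-p - 1) :=
      Real.rpow_le_rpow_of_nonpos hb0 (by have := sq_nonneg q; linarith) (by linarith)
    have e : b ^ (-p - 1) * (s ^ 4 / 4) = D * s ^ (-(n + 1 / 2 : ℝ)) := by
      have e1 : s ^ 4 / 4 = b * n := by rw [hb]; field_simp
      rw [e1, Real.rpow_sub_one hb0.ne', ← mul_assoc, div_mul_cancel₀ _ hb0.ne', hb,
        Real.div_rpow (by positivity) (by positivity), Real.rpow_neg (by positivity : (0 : ℝ) ≤ 4 * n),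
        ← Real.rpow_natCast s 4, ← Real.rpow_mul hs0.le, hD]
      have : ((4 : ℕ) : ℝ) * -p = -(n + 1 / 2 : ℝ) := by rw [hp]; push_cast; ring
      rw [this, div_inv_eq_mul]
      ring
    rw [← e]
    calc _ ≤ χ q * ((b + q ^ 2) ^ (-p - 1) * (s ^ 4 / 4)) := by
          gcongr
          · exact hχ0 q
          · have := sq_nonneg q
            linarith
      _ ≤ 1 * (b ^ (-p - 1) * (s ^ 4 / 4)) := by
          gcongr
          exact hχ1 q
      _ = _ := one_mul _

variable {n : ℕ}

/-- `Φ` is a nonnegative bump in `B(y, ρ)` whose Laplacian `L` is at least `c / ρ²` on most of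
`B(y, ρ / 2)`, and may only be negative in `B(y, sρ)`. -/
structure IsBarrier (y : EuclideanSpace ℝ (Fin n)) (ρ s c A K : ℝ)
    (Φ L : EuclideanSpace ℝ (Fin n) → ℝ) : Prop where
  contDiff : ContDiff ℝ ∞ Φ
  nonneg : ∀ x, 0 ≤ Φ x
  le : ∀ x, Φ x ≤ K
  eq_zero : ∀ x, x ∉ ball y ρ → Φ x = 0
  hasCompactSupport : HasCompactSupport Φ
  norm_gradient_le : ∀ x, ‖gradient Φ x‖ ≤ K / ρ
  gradient_eq_zero : ∀ x, x ∉ ball y ρ → gradient Φ x = 0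
  continuous : Continuous L
  lap_eq_zero : ∀ x, x ∉ ball y ρ → L x = 0
  abs_lap_le : ∀ x, |L x| ≤ K / ρ ^ 2
  lap_nonneg : ∀ x, x ∉ ball y (s * ρ) → 0 ≤ L x
  le_lap : ∀ x ∈ ball y (ρ / 2), x ∉ ball y (s * ρ) → c / ρ ^ 2 ≤ L x
  neg_le_lap : ∀ x ∈ ball y (s * ρ), -(A / ρ ^ 2) ≤ L x
  integral_mul : ∀ u : EuclideanSpace ℝ (Fin n) → ℝ, MemW12 u →
    ∫ x, u x * L x = -∫ x, inner ℝ (weakGrad u x) (gradient Φ x)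

/-- Integrate from q = 1, so that the primitive vanishes beyond 1 and is nonnegative before. The
factor 1/2 cancels the 2 in the derivative of ‖x‖². -/
theorem exists_primitive_profile {k : ℝ → ℝ} (hk : ContDiff ℝ ∞ k) (hk0 : ∀ q, 0 ≤ k q)
    (hk1 : ∀ q, 1 ≤ q → k q = 0) : ∃ Ψ : ℝ → ℝ, ContDiff ℝ ∞ Ψ ∧ (∀ q, HasDerivAt Ψ (-k q / 2) q) ∧
      (∀ q, 0 ≤ Ψ q) ∧ ∀ q, 1 ≤ q → Ψ q = 0 := by
  have hd : ∀ q, HasDerivAt (fun q => -(∫ t in (1 : ℝ)..q, k t) / 2) (-k q / 2) q := fun q =>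
    ((intervalIntegral.integral_hasDerivAt_right (hk.continuous.intervalIntegrable _ _)
      (hk.continuous.stronglyMeasurableAtFilter _ _) hk.continuous.continuousAt).neg.div_const 2)
  have hz : ∀ q, 1 ≤ q → -(∫ t in (1 : ℝ)..q, k t) / 2 = 0 := by
    intro q hq
    rw [intervalIntegral.integral_congr (g := fun _ => 0)]
    · simp
    · intro t ht
      rw [Set.uIcc_of_le hq] at ht
      exact hk1 t ht.1
  refine ⟨_, contDiff_infty_iff_deriv.2 ⟨fun q => (hd q).differentiableAt, ?_⟩, hd, fun q => ?_, hz⟩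
  · rw [funext fun q => (hd q).deriv]
    exact hk.neg.div_const 2
  · rcases le_total 1 q with h | h
    · exact (hz q h).ge
    · rw [← intervalIntegral.integral_symm]
      have := intervalIntegral.integral_nonneg h (fun t _ => hk0 t) (μ := volume)
      linarith

theorem hasCompactSupport_of_eq_zero_off_ball {F : Type*} [Zero F] {y : EuclideanSpace ℝ (Fin n)}
    {ρ : ℝ} {f : EuclideanSpace ℝ (Fin n) → F} (h : ∀ x, x ∉ ball y ρ → f x = 0) :
    HasCompactSupport f :=
  HasCompactSupport.intro (isCompact_closedBall y ρ) fun x hx => h x fun h' => hx (ball_subset_closedBall h')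

/-- Each component of V is a test function for the corresponding coordinate direction; sum over the
directions. Applied to V = ∇Φ this is Green's formula. -/
theorem HasWeakGrad.integral_mul_divergence {u : EuclideanSpace ℝ (Fin n) → ℝ}
    {G : EuclideanSpace ℝ (Fin n) → EuclideanSpace ℝ (Fin n)} (h : HasWeakGrad u G)
    {V : EuclideanSpace ℝ (Fin n) → EuclideanSpace ℝ (Fin n)} (hV : ContDiff ℝ ∞ V)
    (hc : HasCompactSupport V) :
    ∫ x, u x * ∑ i, fderiv ℝ (fun x => V x i) x (EuclideanSpace.single i 1) =
      -∫ x, inner ℝ (G x) (V x) := by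
  have hVi : ∀ i, ContDiff ℝ ∞ fun x => V x i := fun i => by
    exact (EuclideanSpace.proj (𝕜 := ℝ) i).contDiff.comp hV
  have hci : ∀ i, HasCompactSupport fun x => V x i := fun i =>
    hc.comp_left (g := fun v : EuclideanSpace ℝ (Fin n) => v i) rfl
  have e1 : ∀ x, inner ℝ (G x) (V x) = ∑ i, V x i * inner ℝ (G x) (EuclideanSpace.single i 1) := by
    intro x
    rw [PiLp.inner_apply]
    refine Finset.sum_congr rfl fun i _ => ?_
    rw [EuclideanSpace.inner_single_right]
    simp
  simp_rw [e1, Finset.mul_sum]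
  rw [integral_finsetSum, integral_finsetSum, ← Finset.sum_neg_distrib]
  · exact Finset.sum_congr rfl fun i _ => h.2.2 _ (hVi i) (hci i) _
  · intro i _
    have := (h.2.1.integrable_smul_left_of_hasCompactSupport (hVi i).continuous
      (hci i)).inner_const (𝕜 := ℝ) (EuclideanSpace.single i 1)
    simpa only [inner_smul_left, conj_trivial] using this
  · intro i _
    have hcont : Continuous fun x => fderiv ℝ (fun x => V x i) x (EuclideanSpace.single i 1) :=
      ((hVi i).continuous_fderiv (by simp)).clm_apply continuous_const
    exact h.1.integrable_smul_right_of_hasCompactSupport hcont ((hci i).fderiv_apply (𝕜 := ℝ) _)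

/-- Take Φ = Ψ(Q) with Q = |x - y|²/ρ² and Ψ' = -k/2. Then ∇Φ = -k(Q)(x - y)/ρ² and ΔΦ = -(n k +
2Qk')(Q)/ρ². The constant c is fixed before κ and s, which later avoids a circular choice; K bounds
the fixed profiles on [0, 1] and so does not depend on y or ρ. -/
theorem exists_barrier (n : ℕ) (hn : n ≠ 0) : ∃ c > (0 : ℝ), ∀ κ > (0 : ℝ), ∃ s > (0 : ℝ), s ≤ 1 / 2 ∧ s ≤ κ ∧
    ∃ A K : ℝ, 0 ≤ A ∧ A * s ^ (n + 1) ≤ κ ∧ 0 ≤ K ∧ ∀ (y : EuclideanSpace ℝ (Fin n)) (ρ : ℝ), 0 < ρ →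
      ∃ Φ L : EuclideanSpace ℝ (Fin n) → ℝ, IsBarrier y ρ s c A K Φ L := by
  obtain ⟨c, hc, H⟩ := exists_radial_profile n hn
  refine ⟨c, hc, fun κ hκ => ?_⟩
  obtain ⟨s, hs, hs2, hsκ, A, hA, hAs, k, hk, hk0, hk1, hkn, hkc, hkA⟩ := H κ hκ
  obtain ⟨Ψ, hΨ, hΨd, hΨ0, hΨ1⟩ := exists_primitive_profile hk hk0 hk1
  have hk' : Continuous (deriv k) := hk.continuous_deriv (by simp)
  have hk'1 : ∀ q, 1 ≤ q → deriv k q = 0 := by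
    intro q hq
    have : IsLocalMin k q := Eventually.of_forall fun t => by rw [hk1 q hq]; exact hk0 t
    exact this.deriv_eq_zero
  obtain ⟨K₁, hK₁⟩ := isCompact_Icc.exists_bound_of_continuousOn (s := Set.Icc (0 : ℝ) 1)
    hΨ.continuous.continuousOn
  obtain ⟨K₂, hK₂⟩ := isCompact_Icc.exists_bound_of_continuousOn (s := Set.Icc (0 : ℝ) 1)
    hk.continuous.continuousOn
  obtain ⟨K₃, hK₃⟩ := isCompact_Icc.exists_bound_of_continuousOn (s := Set.Icc (0 : ℝ) 1)
    (f := fun q => n * k q + 2 * q * deriv k q)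
    ((hk.continuous.const_mul _).add ((continuous_const.mul continuous_id).mul hk')).continuousOn
  set K := max K₁ (max K₂ (max K₃ 0)) with hK
  have hK0 : 0 ≤ K := by simp [hK]
  have h1K : K₁ ≤ K := by simp [hK]
  have h2K : K₂ ≤ K := by simp [hK]
  have h3K : K₃ ≤ K := by simp [hK]
  refine ⟨s, hs, hs2, hsκ, A, K, hA, hAs, hK0, fun y ρ hρ => ?_⟩
  set Q : EuclideanSpace ℝ (Fin n) → ℝ := fun x => ‖x - y‖ ^ 2 / ρ ^ 2 with hQ
  have hQ0 : ∀ x, 0 ≤ Q x := fun x => by positivity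
  have hQs : ContDiff ℝ ∞ Q := ((contDiff_id.sub contDiff_const).norm_sq ℝ).div_const _
  have hQd : ∀ x, HasFDerivAt Q ((2 / ρ ^ 2) • innerSL ℝ (x - y)) x := by
    intro x
    have h1 := (((hasFDerivAt_id x).sub_const y).norm_sq).mul_const ((ρ ^ 2)⁻¹)
    refine h1.congr_fderiv ?_
    ext w
    simp
    ring
  have hQout : ∀ x, x ∉ ball y ρ → 1 ≤ Q x := by
    intro x hx
    rw [mem_ball, dist_eq_norm, not_lt] at hx
    rw [hQ, le_div_iff₀ (by positivity), one_mul]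
    gcongr
  have hQin : ∀ x t, 0 < t → (Q x < t ^ 2 ↔ x ∈ ball y (t * ρ)) := by
    intro x t ht
    rw [hQ, mem_ball, dist_eq_norm, div_lt_iff₀ (by positivity), ← mul_pow]
    exact pow_lt_pow_iff_left₀ (norm_nonneg _) (by positivity) (by norm_num)
  set V : EuclideanSpace ℝ (Fin n) → EuclideanSpace ℝ (Fin n) :=
    fun x => (-(k (Q x) / ρ ^ 2)) • (x - y) with hV
  have hVs : ContDiff ℝ ∞ V :=
    (((hk.comp hQs).div_const _).neg).smul (contDiff_id.sub contDiff_const)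
  have hgrad : ∀ x, gradient (fun x => Ψ (Q x)) x = V x := by
    intro x
    refine ext_inner_right ℝ fun v => ?_
    have h1 : HasFDerivAt (fun x => Ψ (Q x)) _ x := (hΨd (Q x)).comp_hasFDerivAt x (hQd x)
    rw [inner_gradient_left, h1.fderiv, hV]
    simp [inner_smul_left, inner_sub_left]
    ring
  set L : EuclideanSpace ℝ (Fin n) → ℝ := fun x => -(n * k (Q x) + 2 * Q x * deriv k (Q x)) / ρ ^ 2
    with hL
  have hdiv : ∀ x, ∑ i, fderiv ℝ (fun x => V x i) x (EuclideanSpace.single i 1) = L x := by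
    intro x
    have h1 : ∀ i, fderiv ℝ (fun x => V x i) x (EuclideanSpace.single i 1) =
        -(k (Q x) / ρ ^ 2) - 2 * deriv k (Q x) / ρ ^ 4 * (x - y) i ^ 2 := by
      intro i
      have h2 : HasFDerivAt (fun x => k (Q x)) (deriv k (Q x) • (2 / ρ ^ 2) • innerSL ℝ (x - y)) x :=
        (hk.differentiable (by simp) (Q x)).hasDerivAt.comp_hasFDerivAt x (hQd x)
      have h3 : HasFDerivAt (fun x : EuclideanSpace ℝ (Fin n) => (x - y) i)
          (EuclideanSpace.proj (𝕜 := ℝ) i) x := by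
        exact ((EuclideanSpace.proj (𝕜 := ℝ) i).hasFDerivAt).comp x ((hasFDerivAt_id x).sub_const y)
      have h4 : HasFDerivAt (fun x : EuclideanSpace ℝ (Fin n) => -(k (Q x) * (ρ ^ 2)⁻¹) * (x - y) i) _ x :=
        (h2.mul_const (ρ ^ 2)⁻¹).neg.mul h3
      have h5 : (fun x => V x i) = fun x => -(k (Q x) * (ρ ^ 2)⁻¹) * (x - y) i := by
        ext x
        simp [hV, div_eq_mul_inv]
      rw [h5, h4.fderiv]
      simp [EuclideanSpace.inner_single_right]
      field_simp
      ring
    rw [Finset.sum_congr rfl fun i _ => h1 i, Finset.sum_sub_distrib, ← Finset.mul_sum]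
    have h6 : ∑ i, (x - y) i ^ 2 = Q x * ρ ^ 2 := by
      rw [hQ, div_mul_cancel₀ _ (by positivity), EuclideanSpace.norm_sq_eq]
      simp
    rw [h6, hL]
    simp
    field_simp
    ring
  have hΦ0 : ∀ x, x ∉ ball y ρ → Ψ (Q x) = 0 := fun x hx => hΨ1 _ (hQout x hx)
  have hV0 : ∀ x, x ∉ ball y ρ → V x = 0 := fun x hx => by simp [hV, hk1 _ (hQout x hx)]
  have hL0 : ∀ x, x ∉ ball y ρ → L x = 0 := fun x hx => by
    simp [hL, hk1 _ (hQout x hx), hk'1 _ (hQout x hx)]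
  have hQ1 : ∀ x, x ∈ ball y ρ → Q x ∈ Set.Icc (0 : ℝ) 1 := by
    intro x hx
    refine ⟨hQ0 x, ?_⟩
    have := (hQin x 1 one_pos).2 (by rwa [one_mul])
    linarith
  refine ⟨fun x => Ψ (Q x), L, ⟨hΨ.comp hQs, fun x => hΨ0 _, fun x => ?_, hΦ0,
    hasCompactSupport_of_eq_zero_off_ball hΦ0, fun x => ?_, fun x hx => by rw [hgrad, hV0 x hx],
    ?_, hL0, fun x => ?_, fun x hx => ?_, fun x hx hx' => ?_, fun x hx => ?_, fun u hu => ?_⟩⟩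
  · by_cases hx : x ∈ ball y ρ
    · exact (le_abs_self _).trans ((hK₁ _ (hQ1 x hx)).trans h1K)
    · simpa only [hΦ0 x hx] using hK0
  · rw [hgrad]
    by_cases hx : x ∈ ball y ρ
    · rw [hV, norm_smul, norm_neg, norm_div, Real.norm_of_nonneg (by positivity : 0 ≤ ρ ^ 2)]
      have h1 := (hK₂ _ (hQ1 x hx)).trans h2K
      have h2 : ‖x - y‖ ≤ ρ := by
        rw [← dist_eq_norm]
        exact (mem_ball.1 hx).le
      calc _ ≤ K / ρ ^ 2 * ρ := by gcongr
        _ = K / ρ := by field_simp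
    · rw [hV0 x hx, norm_zero]
      positivity
  · exact (((hk.continuous.comp hQs.continuous).const_mul _).add
      ((hQs.continuous.const_mul _).mul (hk'.comp hQs.continuous))).neg.div_const _
  · by_cases hx : x ∈ ball y ρ
    · have h1 := (hK₃ _ (hQ1 x hx)).trans h3K
      rw [hL, abs_div, abs_neg, abs_of_nonneg (by positivity : 0 ≤ ρ ^ 2)]
      gcongr
      exact h1
    · rw [hL0 x hx, abs_zero]
      positivity
  · rw [← hQin x s hs, not_lt] at hx
    have := hkn _ hx
    exact div_nonneg (by linarith) (by positivity)
  · rw [← hQin x s hs, not_lt] at hx'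
    have h1 := (hQin x (1 / 2) (by norm_num)).2 (by convert hx using 2; ring)
    have := hkc _ hx' (by linarith)
    exact div_le_div_of_nonneg_right (by linarith) (by positivity)
  · have := hkA _ (hQ0 x) ((hQin x s hs).2 hx).le
    rw [← neg_div]
    exact div_le_div_of_nonneg_right (by linarith) (by positivity)
  · have h1 := hu.hasWeakGrad_weakGrad.integral_mul_divergence hVs
      (hasCompactSupport_of_eq_zero_off_ball hV0)
    simp_rw [hdiv] at h1
    simp_rw [hgrad]
    exact h1

end Barrier

/-! ### Lower bound for the integral against the Laplacian of the barrier. -/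

section BarrierIntegrals

variable {n : ℕ} {v Φ L : EuclideanSpace ℝ (Fin n) → ℝ} {y : EuclideanSpace ℝ (Fin n)}
  {ρ s c A K : ℝ}

/-- A pointwise comparison of c·v₊ on B(y, ρ/2) with ρ²vL. It is direct where v > 0 away from B(y,
sρ). In the small ball the error is at most (A + c)m, and where v ≤ 0 it is at most KM. -/
theorem IsBarrier.le_integral_mul (hb : IsBarrier y ρ s c A K Φ L) (hv : MemW12 v) (hρ : 0 < ρ)
    (hs : 0 < s) (hs2 : s ≤ 1 / 2) (hc : 0 ≤ c) (hA : 0 ≤ A) (hK : 0 ≤ K) (hcont : ContinuousOn v (ball y ρ))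
    {m M : ℝ} (hm : 0 ≤ m) (hvm : ∀ x ∈ ball y (s * ρ), v x ≤ m) (hvM : ∀ x ∈ ball y ρ, |v x| ≤ M) :
    c * (∫ x in ball y (ρ / 2), posPartFun v x) ≤ ρ ^ 2 * (∫ x, v x * L x) +
      (A + c) * m * (unitBallVolume n * (s * ρ) ^ n) +
      K * M * volume.real {x ∈ ball y ρ | v x ≤ 0} := by
  have hM : 0 ≤ M := (abs_nonneg _).trans (hvM y (mem_ball_self hρ))
  set Z := {x ∈ ball y ρ | v x ≤ 0} with hZ
  have hZm : MeasurableSet Z := by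
    have : Z = ball y ρ \ ({x | 0 < v x} ∩ ball y ρ) := by
      ext x
      refine ⟨fun h => ⟨h.1, fun h' => not_lt.2 h.2 h'.1⟩, fun h => ⟨h.1, ?_⟩⟩
      exact not_lt.1 fun h' => h.2 ⟨h', h.1⟩
    rw [this]
    exact MeasurableSet.diff measurableSet_ball (FBProblem.measurableSet_pos_inter_ball hcont)
  have hZb : Z ⊆ ball y ρ := fun x hx => hx.1
  have hZfin : volume Z ≠ ⊤ := ne_top_of_le_ne_top measure_ball_lt_top.ne (measure_mono hZb)
  have h1 : ball y (s * ρ) ⊆ ball y (ρ / 2) := ball_subset_ball (by nlinarith)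
  have h2 : ball y (ρ / 2) ⊆ ball y ρ := ball_subset_ball (by linarith)
  have hρ2 : 0 < ρ ^ 2 := by positivity
  have i1 : Integrable ((ball y (ρ / 2)).indicator fun x => c * posPartFun v x) volume :=
    (integrable_indicator_iff measurableSet_ball).2 ((hv.posPart.1.integrableOn_ball _ _).const_mul c)
  have i2 : Integrable ((ball y (s * ρ)).indicator fun _ => (A + c) * m) volume :=
    (integrable_indicator_iff measurableSet_ball).2 (integrableOn_const measure_ball_lt_top.ne)
  have i3 : Integrable (Z.indicator fun _ => K * M) volume :=
    (integrable_indicator_iff hZm).2 (integrableOn_const hZfin)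
  have i0 : Integrable (fun x => v x * L x) volume :=
    hv.hasWeakGrad_weakGrad.1.integrable_smul_right_of_hasCompactSupport hb.continuous
      (hasCompactSupport_of_eq_zero_off_ball hb.lap_eq_zero)
  have i4 : Integrable (fun x => ρ ^ 2 * (v x * L x) +
      (ball y (s * ρ)).indicator (fun _ => (A + c) * m) x) volume := (i0.const_mul _).add i2
  have hle : ∫ x, (ball y (ρ / 2)).indicator (fun x => c * posPartFun v x) x ≤
      ∫ x, (ρ ^ 2 * (v x * L x) + (ball y (s * ρ)).indicator (fun _ => (A + c) * m) x +
        Z.indicator (fun _ => K * M) x) := by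
    refine integral_mono i1 (i4.add i3) fun x => ?_
    have n2 : 0 ≤ (ball y (s * ρ)).indicator (fun _ => (A + c) * m) x :=
      Set.indicator_nonneg (fun _ _ => by positivity) x
    have n3 : 0 ≤ Z.indicator (fun _ => K * M) x :=
      Set.indicator_nonneg (fun _ _ => by positivity) x
    by_cases hx : x ∈ ball y ρ
    swap
    · simp only
      rw [Set.indicator_of_notMem (fun h => hx (h2 h)), hb.lap_eq_zero x hx]
      simp only [mul_zero, zero_add]
      positivity
    by_cases hp : 0 < v x
    · have e : posPartFun v x = v x := max_eq_right hp.le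
      by_cases hxs : x ∈ ball y (s * ρ)
      · have h3 := hb.neg_le_lap x hxs
        simp only
        rw [Set.indicator_of_mem (h1 hxs), Set.indicator_of_mem hxs, e]
        have h4 := hvm x hxs
        have h5 : -A ≤ ρ ^ 2 * L x := by
          have : ρ ^ 2 * -(A / ρ ^ 2) ≤ ρ ^ 2 * L x := by gcongr
          rwa [mul_neg, mul_div_cancel₀ _ hρ2.ne'] at this
        have h6 : -A * v x ≤ ρ ^ 2 * L x * v x := by gcongr
        have h7 : (A + c) * v x ≤ (A + c) * m := by gcongr
        linarith
      · by_cases hxh : x ∈ ball y (ρ / 2)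
        · have h3 := hb.le_lap x hxh hxs
          simp only
          rw [Set.indicator_of_mem hxh, e]
          have h5 : c ≤ ρ ^ 2 * L x := by
            rwa [div_le_iff₀ hρ2, mul_comm] at h3
          have h6 : c * v x ≤ ρ ^ 2 * L x * v x := by gcongr
          linarith
        · have h3 := hb.lap_nonneg x hxs
          simp only
          rw [Set.indicator_of_notMem hxh]
          positivity
    · have e : posPartFun v x = 0 := max_eq_left (not_lt.1 hp)
      simp only
      rw [Set.indicator_of_mem (show x ∈ Z from ⟨hx, not_lt.1 hp⟩)]
      have h3 : |v x * L x| ≤ M * (K / ρ ^ 2) := by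
        rw [abs_mul]
        exact mul_le_mul (hvM x hx) (hb.abs_lap_le x) (abs_nonneg _) hM
      have h4 : ρ ^ 2 * (-(M * (K / ρ ^ 2))) ≤ ρ ^ 2 * (v x * L x) := by
        gcongr
        exact (abs_le.1 h3).1
      have h5 : ρ ^ 2 * (-(M * (K / ρ ^ 2))) = -(K * M) := by field_simp
      have h6 : (ball y (ρ / 2)).indicator (fun x => c * posPartFun v x) x = 0 := by
        exact Set.indicator_apply_eq_zero.2 fun _ => by rw [e, mul_zero]
      rw [h6]
      linarith
  rw [integral_add i4 i3, integral_add (i0.const_mul _) i2,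
    integral_indicator measurableSet_ball, integral_indicator measurableSet_ball,
    integral_indicator hZm, integral_const_mul, integral_const_mul, setIntegral_const, setIntegral_const,
    volume_real_ball y (by positivity)] at hle
  simp only [smul_eq_mul] at hle
  linarith

end BarrierIntegrals

/-! ### Almost minimality tested with the barrier. -/

namespace FBProblem

variable {n N : ℕ} {P : FBProblem n N} {j : Fin N} {Kf Kg : ℝ}
  {v Φ L : EuclideanSpace ℝ (Fin n) → ℝ} {y : EuclideanSpace ℝ (Fin n)} {ρ s c A K : ℝ}

/-- Testing almost minimality with `v + tΦ` for a barrier `Φ`. -/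
theorem integral_mul_lap_le (hf : P.BoundedOn (P.f j) Kf) (hg : P.BoundedOn (P.g j) Kg)
    (hKf : 0 ≤ Kf) (hKg : 0 ≤ Kg) (hb : IsBarrier y ρ s c A K Φ L) (hv : MemW12 v)
    (hconv : IntegrableOn (fun x => v x ^ 2 * P.f j x - v x * P.g j x) P.Ω volume) (hρ : 0 < ρ)
    (hK : 0 ≤ K) {M t err : ℝ} (hvM : ∀ x ∈ ball y ρ, |v x| ≤ M) (ht : 0 < t)
    (hcost : P.cost j v ≤ P.cost j (fun x => v x + t * Φ x) + err) :
    2 * t * (∫ x, v x * L x) ≤ unitBallVolume n * ρ ^ n *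
      (t ^ 2 * (K / ρ) ^ 2 + ((2 * t * (M * K) + t ^ 2 * K ^ 2) * Kf + t * K * Kg)) + err := by
  have hM : 0 ≤ M := (abs_nonneg _).trans (hvM y (mem_ball_self hρ))
  obtain ⟨-, -, hc⟩ := cost_add_mul hf hg hv hconv hb.contDiff hb.hasCompactSupport t
  rw [hc] at hcost
  rw [hb.integral_mul v hv]
  have hvol : volume.real (ball y ρ) = unitBallVolume n * ρ ^ n := volume_real_ball y hρ
  have b1 : ∫ x, ‖gradient Φ x‖ ^ 2 ≤ (K / ρ) ^ 2 * (unitBallVolume n * ρ ^ n) := by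
    rw [← setIntegral_eq_integral_of_forall_compl_eq_zero (s := ball y ρ)
      (fun x hx => by simp [hb.gradient_eq_zero x hx]), ← hvol]
    have := norm_setIntegral_le_of_norm_le_const (f := fun x => ‖gradient Φ x‖ ^ 2)
      (C := (K / ρ) ^ 2) (measure_ball_lt_top (μ := volume) (x := y) (r := ρ)) (fun x _ => by
        rw [norm_pow, norm_norm]
        gcongr
        exact hb.norm_gradient_le x)
    exact (le_abs_self _).trans this
  have b2 : ∫ x in P.Ω, ((2 * t * (v x * Φ x) + t ^ 2 * Φ x ^ 2) * P.f j x - t * Φ x * P.g j x) ≤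
      ((2 * t * (M * K) + t ^ 2 * K ^ 2) * Kf + t * K * Kg) * (unitBallVolume n * ρ ^ n) := by
    set C := (2 * t * (M * K) + t ^ 2 * K ^ 2) * Kf + t * K * Kg
    have hC : 0 ≤ C := by positivity
    set F := fun x => (2 * t * (v x * Φ x) + t ^ 2 * Φ x ^ 2) * P.f j x - t * Φ x * P.g j x with hF
    have hF0 : ∀ x, x ∉ ball y ρ → F x = 0 := fun x hx => by simp [hF, hb.eq_zero x hx]
    have e1 : ∫ x in P.Ω, F x = ∫ x in P.Ω ∩ ball y ρ, F x :=
      setIntegral_eq_of_subset_of_forall_sdiff_eq_zero P.measurableSet_Ω Set.inter_subset_left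
        fun x hx => hF0 x fun h => hx.2 ⟨hx.1, h⟩
    have hfin : volume (P.Ω ∩ ball y ρ) < ⊤ :=
      (measure_mono Set.inter_subset_right).trans_lt measure_ball_lt_top
    rw [e1]
    have h1 : ∀ᵐ x ∂volume.restrict (P.Ω ∩ ball y ρ), ‖F x‖ ≤ C := by
      have hr : volume.restrict (P.Ω ∩ ball y ρ) ≤ volume.restrict P.Ω :=
        Measure.restrict_mono Set.inter_subset_left le_rfl
      filter_upwards [ae_mono hr hf.2, ae_mono hr hg.2,
        ae_restrict_mem (P.measurableSet_Ω.inter measurableSet_ball)] with x hfx hgx hx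
      have hΦ0 := hb.nonneg x
      have hΦK := hb.le x
      have hvx := hvM x hx.2
      have e2 : |2 * t * (v x * Φ x) + t ^ 2 * Φ x ^ 2| ≤ 2 * t * (M * K) + t ^ 2 * K ^ 2 := by
        refine (abs_add_le _ _).trans ?_
        rw [abs_of_nonneg (by positivity : 0 ≤ t ^ 2 * Φ x ^ 2), abs_mul (2 * t), abs_mul (v x),
          abs_of_nonneg (by positivity : 0 ≤ 2 * t), abs_of_nonneg hΦ0]
        gcongr
      calc |F x| ≤ |(2 * t * (v x * Φ x) + t ^ 2 * Φ x ^ 2) * P.f j x| + |t * Φ x * P.g j x| :=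
            abs_sub _ _
        _ = |2 * t * (v x * Φ x) + t ^ 2 * Φ x ^ 2| * |P.f j x| + t * Φ x * |P.g j x| := by
            rw [abs_mul, abs_mul, abs_of_nonneg (by positivity : 0 ≤ t * Φ x)]
        _ ≤ (2 * t * (M * K) + t ^ 2 * K ^ 2) * Kf + t * K * Kg := by gcongr
    have h2 := norm_setIntegral_le_of_norm_le_const_ae hfin h1
    refine (le_abs_self _).trans (h2.trans ?_)
    rw [← hvol]
    exact mul_le_mul_of_nonneg_left (measureReal_mono Set.inter_subset_right measure_ball_lt_top.ne) hC
  have b3 : t ^ 2 * ∫ x, ‖gradient Φ x‖ ^ 2 ≤ t ^ 2 * ((K / ρ) ^ 2 * (unitBallVolume n * ρ ^ n)) := by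
    gcongr
  linarith

/-- The inequality between the constants that follows from the nondegeneracy and the almost
minimality of `v` in `B(y, ρ)`. -/
theorem barrier_inequality (hf : P.BoundedOn (P.f j) Kf) (hg : P.BoundedOn (P.g j) Kg)
    (hKf : 0 ≤ Kf) (hKg : 0 ≤ Kg) (hb : IsBarrier y ρ s c A K Φ L) (hv : MemW12 v)
    (hconv : IntegrableOn (fun x => v x ^ 2 * P.f j x - v x * P.g j x) P.Ω volume) (hρ : 0 < ρ)
    (hρ1 : ρ ≤ 1) (hs : 0 < s) (hs2 : s ≤ 1 / 2) (hc : 0 ≤ c) (hA : 0 ≤ A) (hK : 0 ≤ K)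
    (hcont : ContinuousOn v (ball y ρ)) {cN M μ ζ e θ : ℝ} (hM : 0 < M) (hμ : 0 ≤ μ) (hθ : 0 < θ)
    (hθ1 : θ ≤ 1) (hvM : ∀ x ∈ ball y ρ, |v x| ≤ M * ρ)
    (hvm : ∀ x ∈ ball y (s * ρ), v x ≤ μ * ρ)
    (hN : cN * ρ ^ (n + 2) ≤ ∫ x in ball y (ρ / 2), posPartFun v x ^ 2)
    (hZ : volume.real {x ∈ ball y ρ | v x ≤ 0} ≤ ζ * ρ ^ n)
    (hcost : P.cost j v ≤ P.cost j (fun x => v x + θ * ρ * Φ x) + e * ρ ^ n) :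
    c * cN / M ≤ (A + c) * μ * (unitBallVolume n * s ^ n) + K * M * ζ + unitBallVolume n / 2 *
      (θ * K ^ 2 + ρ * ((2 * M * K + K ^ 2) * Kf + K * Kg)) + e / (2 * θ) := by
  have hω := unitBallVolume_pos n
  have h1 := hb.le_integral_mul hv hρ hs hs2 hc hA hK hcont (m := μ * ρ) (by positivity) hvm hvM
  have h2 := integral_mul_lap_le hf hg hKf hKg hb hv hconv hρ hK hvM (t := θ * ρ) (by positivity) hcost
  set I := ∫ x, v x * L x
  -- The sup bound v ≤ Mρ converts nondegeneracy in L² into nondegeneracy in L¹.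
  have h3 : cN * ρ ^ (n + 2) ≤ M * ρ * ∫ x in ball y (ρ / 2), posPartFun v x := by
    refine hN.trans ?_
    rw [← integral_const_mul]
    refine setIntegral_mono_on (hv.posPart.1.integrableOn_sq _ _)
      ((hv.posPart.1.integrableOn_ball _ _).const_mul _) measurableSet_ball fun x hx => ?_
    rw [sq]
    gcongr
    · exact posPartFun_nonneg _ _
    · refine max_le (by positivity) ((le_abs_self _).trans (hvM x ?_))
      exact ball_subset_ball (by linarith) hx
  set S := ∫ x in ball y (ρ / 2), posPartFun v x
  have hρn : 0 < ρ ^ (n + 1) := by positivity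
  have hB : 0 ≤ (2 * M * K + K ^ 2) * Kf := by positivity
  -- With t = θρ all main terms scale like ρ^n; the terms from f and g keep one extra factor ρ,
  -- after θ ≤ 1 and ρ ≤ 1 are used inside.
  have h4 : ρ * I ≤ ρ ^ n * (unitBallVolume n / 2 *
      (θ * K ^ 2 + ρ * ((2 * M * K + K ^ 2) * Kf + K * Kg)) + e / (2 * θ)) := by
    have h5 : 2 * θ * (ρ * I) ≤ 2 * θ * (ρ ^ n * (unitBallVolume n / 2 *
      (θ * K ^ 2 + ρ * ((2 * M * K * ρ + θ * K ^ 2 * ρ) * Kf + K * Kg)) + e / (2 * θ))) := by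
      calc _ = 2 * (θ * ρ) * I := by ring
        _ ≤ _ := h2
        _ = _ := by field_simp
    have h6 := le_of_mul_le_mul_left h5 (by positivity)
    refine h6.trans ?_
    have : θ * K ^ 2 * ρ ≤ 1 * K ^ 2 * 1 := by gcongr
    have h7 : 2 * M * K * ρ + θ * K ^ 2 * ρ ≤ 2 * M * K + K ^ 2 := by
      have : 2 * M * K * ρ ≤ 2 * M * K * 1 := by gcongr
      linarith
    gcongr
  have h8 : ρ ^ (n + 1) * (c * cN / M) ≤ c * S := by
    rw [mul_div_assoc', div_le_iff₀ hM]
    refine le_of_mul_le_mul_left ?_ hρ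
    calc _ = c * (cN * ρ ^ (n + 2)) := by ring
      _ ≤ c * (M * ρ * S) := by gcongr
      _ = _ := by ring
  have h9 : K * (M * ρ) * volume.real {x ∈ ball y ρ | v x ≤ 0} ≤ K * (M * ρ) * (ζ * ρ ^ n) := by
    gcongr
  refine le_of_mul_le_mul_left (h8.trans (h1.trans ?_)) hρn
  have h10 : ρ ^ 2 * I ≤ ρ * (ρ ^ n * (unitBallVolume n / 2 *
      (θ * K ^ 2 + ρ * ((2 * M * K + K ^ 2) * Kf + K * Kg)) + e / (2 * θ))) := by
    calc ρ ^ 2 * I = ρ * (ρ * I) := by ring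
      _ ≤ _ := by gcongr
  calc _ ≤ _ := add_le_add (add_le_add h10 le_rfl) h9
    _ = _ := by rw [mul_pow]; ring

end FBProblem

/-! ### Giving a ball to one phase. -/

namespace FBProblem

section Comparison

variable {n N : ℕ} {P : FBProblem n N} {u : Fin N → EuclideanSpace ℝ (Fin n) → ℝ}
  {W : Fin N → Set (EuclideanSpace ℝ (Fin n))} {i : Fin N} {Kf Kg : ℝ}

theorem IsMinimizer.ae_eq_zero_of_mem (h : P.IsMinimizer u W) {j : Fin N} (hj : j ≠ i) :
    ∀ᵐ x ∂volume, x ∈ W j → u i x = 0 := by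
  filter_upwards [h.ae_mem_of_pos i] with x hx hxj
  by_contra h0
  exact Set.disjoint_left.1 (h.1.1.2.2 hj) hxj (hx h0)

/-- The other phases vanish on the boundary of a phase. -/
theorem IsMinimizer.eq_zero_of_mem_frontier (h : P.IsMinimizer u W) {x y : EuclideanSpace ℝ (Fin n)}
    {r : ℝ} (hc : ∀ j, ContinuousOn (u j) (ball x r)) (hy : y ∈ ball x r)
    (hf : y ∈ frontier (P.posSet (u i))) {j : Fin N} (hj : j ≠ i) : u j y = 0 := by
  by_contra h0
  have ho : IsOpen (ball x r ∩ u j ⁻¹' {0}ᶜ) :=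
    (hc j).isOpen_inter_preimage isOpen_ball isOpen_compl_singleton
  -- If `u j` were nonzero at y, then near y both `u i` and `u j` would be nonzero on a nonempty
  -- open set, against the disjointness of the phases.
  obtain ⟨z, hz, hpos⟩ := exists_mem_posSet ho ⟨y, ⟨hy, h0⟩, hf⟩
  have ho' : IsOpen ((ball x r ∩ u j ⁻¹' {0}ᶜ) ∩ (ball x r ∩ u i ⁻¹' Set.Ioi 0)) :=
    ho.inter ((hc i).isOpen_inter_preimage isOpen_ball isOpen_Ioi)
  refine (ho'.measure_pos volume ⟨z, hz, hz.1, hpos⟩).ne' ?_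
  refine measure_mono_null ?_ (ae_iff.1 ((h.ae_mem_of_pos j).and (h.ae_eq_zero_of_mem hj)))
  intro a ha hp
  have h1 : 0 < u i a := ha.2.2
  exact h1.ne' (hp.2 (hp.1 ha.1.2))

/-- The other phases are disjoint and `u i` vanishes a.e. on each of them. This makes every error
term below proportional to |{u ≤ 0}|. -/
theorem IsMinimizer.sum_volume_inter_le (h : P.IsMinimizer u W) (i : Fin N)
    {B : Set (EuclideanSpace ℝ (Fin n))} (hB : MeasurableSet B) :
    ∑ j ∈ Finset.univ.erase i, volume (W j ∩ B) ≤ volume {x ∈ B | u i x ≤ 0} := by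
  rw [← measure_biUnion_finset]
  · refine measure_mono_ae ?_
    have h1 : ∀ᵐ x ∂volume, ∀ j, j ≠ i → x ∈ W j → u i x = 0 := by
      rw [ae_all_iff]
      intro j
      by_cases hj : j = i
      · exact Eventually.of_forall fun _ h' => absurd hj h'
      · filter_upwards [h.ae_eq_zero_of_mem (i := i) hj] with x hx _ using hx
    filter_upwards [h1] with x hx hxU
    obtain ⟨j, hj, hxj⟩ := Set.mem_iUnion₂.1 hxU
    exact ⟨hxj.2, (hx j (Finset.ne_of_mem_erase hj) hxj.1).le⟩
  · intro j _ k _ hjk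
    exact (h.1.1.2.2 hjk).mono Set.inter_subset_left Set.inter_subset_left
  · exact fun j _ => (h.1.1.1 j).inter hB

/-- Giving a ball to the phase `i` does not cost much more than the change in the `i`-th component
allows, if that phase nearly fills the ball already. -/
theorem IsMinimizer.cost_le_of_ball (h : P.IsMinimizer u W) (hf : ∀ j, P.BoundedOn (P.f j) Kf)
    (hg : ∀ j, P.BoundedOn (P.g j) Kg) (hKf : 0 ≤ Kf) (hKg : 0 ≤ Kg) {L : ℝ≥0}
    (hL : P.FLipschitz L) {C C₀ : ℝ} (hcut : IsCutoffConstant C) (hC₀ : 0 ≤ C₀)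
    {y : EuclideanSpace ℝ (Fin n)} {ρ : ℝ} (hρ : 0 < ρ) (hρ1 : ρ ≤ 1) (hΩ : ball y ρ ⊆ P.Ω)
    (hu : ∀ j, j ≠ i → ∀ x ∈ ball y (2 * ρ), |u j x| ≤ 2 * C₀ * ρ)
    {v : EuclideanSpace ℝ (Fin n) → ℝ} (hv : MemW12 v)
    (hv0 : ∀ᵐ x ∂volume, x ∉ W i ∪ ball y ρ → v x = 0)
    (hconv : IntegrableOn (fun x => v x ^ 2 * P.f i x - v x * P.g i x) P.Ω volume) :
    P.cost i (u i) ≤ P.cost i v + ((12 * C ^ 2 + Kf) * (4 * C₀ ^ 2) + 2 * Kg * C₀ + 2 * L) *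
      volume.real {x ∈ ball y (2 * ρ) | u i x ≤ 0} := by
  obtain ⟨ξ, hξ, hξ0, hξ1, hξs, hξs', hξc, hξg⟩ := hcut n y ρ (2 * ρ) hρ (by linarith)
  set Z := {x ∈ ball y (2 * ρ) | u i x ≤ 0} with hZ
  have hZfin : volume Z ≠ ⊤ := ne_top_of_le_ne_top measure_ball_lt_top.ne
    (measure_mono fun x (hx : x ∈ Z) => hx.1)
  set E₁ := (12 * C ^ 2 + Kf) * (4 * C₀ ^ 2) + 2 * Kg * C₀ with hE₁
  have hE₁0 : 0 ≤ E₁ := by positivity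
  have hBfin : ∀ j, volume (W j ∩ ball y (2 * ρ)) ≠ ⊤ := fun j =>
    ne_top_of_le_ne_top measure_ball_lt_top.ne (measure_mono Set.inter_subset_right)
  set B := ball y ρ with hB
  have hBB : B ⊆ ball y (2 * ρ) := ball_subset_ball (by linarith)
  -- The other components are cut off to zero on B(y, ρ), whatever their sign; hence
  -- `cost_sub_mul_le` is used with S the whole space.
  set w : Fin N → EuclideanSpace ℝ (Fin n) → ℝ := fun j x => u j x - ξ x ^ 2 * u j x with hw
  have hwj := fun j => cost_sub_mul_le (hf j) (hg j) hKf hKg (h.memW12 j) (h.2.1 j)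
    (Set.indicator_univ (u j)).symm (h.memW12 j)
    (by rw [Set.indicator_univ]; exact (h.memW12 j).hasWeakGrad_weakGrad) hξ hξ0 hξ1 hξc hξg hξs hξs'
  have hcostj : ∀ j, j ≠ i → P.cost j (w j) ≤
      P.cost j (u j) + E₁ * volume.real (W j ∩ ball y (2 * ρ)) := by
    intro j hj
    have h1 := (hwj j).2.2
    set V := volume.real (W j ∩ ball y (2 * ρ))
    have hV : 0 ≤ V := measureReal_nonneg
    have h2 : 0 ≤ ∫ x in ball y ρ, ‖weakGrad (u j) x‖ ^ 2 := integral_nonneg fun _ => by positivity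
    have key : ∀ (a : EuclideanSpace ℝ (Fin n) → ℝ) (b : ℝ), (∀ x, u j x = 0 → a x = 0) →
        (∀ x ∈ ball y (2 * ρ), ‖a x‖ ≤ b) → ∫ x in ball y (2 * ρ), a x ≤ b * V := by
      intro a b ha hab
      have e : ∫ x in ball y (2 * ρ), a x = ∫ x in W j ∩ ball y (2 * ρ), a x := by
        refine setIntegral_eq_of_subset_of_ae_sdiff_eq_zero measurableSet_ball.nullMeasurableSet
          Set.inter_subset_right ?_
        filter_upwards [(h.1.2 j).2] with x hx hx'
        exact ha x (hx fun h3 => hx'.2 ⟨h3, hx'.1⟩)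
      rw [e]
      exact (le_abs_self _).trans (norm_setIntegral_le_of_norm_le_const (hBfin j).lt_top
        fun x hx => hab x hx.2)
    have k1 : ∫ x in ball y (2 * ρ), u j x ^ 2 ≤ (2 * C₀ * ρ) ^ 2 * V := by
      refine key _ _ (fun x hx => by simp [hx]) fun x hx => ?_
      rw [norm_pow]
      gcongr
      exact hu j hj x hx
    have k2 : ∫ x in ball y (2 * ρ), |u j x| ≤ (2 * C₀ * ρ) * V := by
      refine key _ _ (fun x hx => by simp [hx]) fun x hx => ?_
      rw [norm_abs_eq_norm]
      exact hu j hj x hx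
    have e3 : 2 * ρ - ρ = ρ := by ring
    rw [e3] at h1
    -- The factor ρ^(-2) from the cutoff is compensated by |u j| ≤ 2C₀ρ, so only the measure of the
    -- phase in the ball remains.
    have k3 : (12 * (C / ρ) ^ 2 + Kf) * (∫ x in ball y (2 * ρ), u j x ^ 2) ≤
        (12 * C ^ 2 + Kf) * (4 * C₀ ^ 2) * V := by
      calc _ ≤ (12 * (C / ρ) ^ 2 + Kf) * ((2 * C₀ * ρ) ^ 2 * V) := by gcongr
        _ = (12 * C ^ 2 + Kf * ρ ^ 2) * (4 * C₀ ^ 2) * V := by field_simp; ring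
        _ ≤ (12 * C ^ 2 + Kf * 1) * (4 * C₀ ^ 2) * V := by
          gcongr
          exact pow_le_one₀ hρ.le hρ1
        _ = _ := by ring
    have k4 : Kg * (∫ x in ball y (2 * ρ), |u j x|) ≤ 2 * Kg * C₀ * V := by
      calc _ ≤ Kg * ((2 * C₀ * ρ) * V) := by gcongr
        _ ≤ Kg * ((2 * C₀ * 1) * V) := by gcongr
        _ = _ := by ring
    have e4 : E₁ * V = (12 * C ^ 2 + Kf) * (4 * C₀ ^ 2) * V + 2 * Kg * C₀ * V := by rw [hE₁]; ring
    simp only [hw]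
    linarith
  set u' : Fin N → EuclideanSpace ℝ (Fin n) → ℝ := fun j => if j = i then v else w j with hu'
  set W' : Fin N → Set (EuclideanSpace ℝ (Fin n)) := fun j => if j = i then W i ∪ B else W j \ B
    with hW'
  have hu'i : u' i = v := if_pos rfl
  have hu'j : ∀ j, j ≠ i → u' j = w j := fun j hj => if_neg hj
  have hW'i : W' i = W i ∪ B := if_pos rfl
  have hW'j : ∀ j, j ≠ i → W' j = W j \ B := fun j hj => if_neg hj
  have hWt := h.1.1
  have hdisj : ∀ j, j ≠ i → Disjoint (W' i) (W' j) := by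
    intro j hj
    rw [hW'i, hW'j j hj]
    exact Set.disjoint_union_left.2 ⟨(hWt.2.2 hj.symm).mono_right Set.sdiff_subset,
      Set.disjoint_sdiff_right⟩
  have htuple : P.IsTuple W' := by
    refine ⟨fun j => ?_, fun j => ?_, fun j k hjk => ?_⟩
    · by_cases hj : j = i
      · rw [hj, hW'i]
        exact (hWt.1 i).union measurableSet_ball
      · rw [hW'j j hj]
        exact MeasurableSet.diff (hWt.1 j) measurableSet_ball
    · by_cases hj : j = i
      · rw [hj, hW'i]
        exact Set.union_subset (hWt.2.1 i) hΩ
      · rw [hW'j j hj]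
        exact Set.sdiff_subset.trans (hWt.2.1 j)
    · by_cases hj : j = i
      · subst hj
        exact hdisj k hjk.symm
      · by_cases hk : k = i
        · subst hk
          exact (hdisj j hj).symm
        · show Disjoint (W' j) (W' k)
          rw [hW'j j hj, hW'j k hk]
          exact (hWt.2.2 hjk).mono Set.sdiff_subset Set.sdiff_subset
  have hle := h.2.2 u' W' ⟨htuple, fun j => ?_⟩ fun j => ?_
  rotate_left
  · by_cases hj : j = i
    · subst hj
      rw [hu'i, hW'i]
      exact ⟨hv, hv0⟩
    · rw [hu'j j hj, hW'j j hj]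
      refine ⟨(hwj j).1, ?_⟩
      filter_upwards [(h.1.2 j).2] with x hx hxW
      by_cases hxB : x ∈ B
      · simp [hw, hξs x (ball_subset_closedBall hxB)]
      · simp [hw, hx fun h' => hxW ⟨h', hxB⟩]
  · by_cases hj : j = i
    · subst hj
      rw [hu'i]
      exact hconv
    · rw [hu'j j hj]
      exact (hwj j).2.1
  have hsum := h.sum_volume_inter_le i (measurableSet_ball (x := y) (ε := 2 * ρ))
  have hsumr : ∑ j ∈ Finset.univ.erase i, volume.real (W j ∩ ball y (2 * ρ)) ≤ volume.real Z := by
    have := ENNReal.toReal_mono hZfin hsum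
    rwa [ENNReal.toReal_sum fun j _ => hBfin j] at this
  have hF : P.F W' ≤ P.F W + 2 * L * volume.real Z := by
    -- One |Z| bounds what phase i gains, since `u i` is a.e. zero off `W i`; the other bounds what
    -- the remaining phases lose.
    have h1 : ∑ j, volume (symmDiff (W j) (W' j)) ≤ 2 * volume Z := by
      rw [← Finset.add_sum_erase _ _ (Finset.mem_univ i), two_mul]
      refine add_le_add ?_ (le_trans (Finset.sum_le_sum fun j hj => ?_) hsum)
      · refine measure_mono_ae ?_
        filter_upwards [h.ae_mem_of_pos i] with x hx hx'
        rw [hW'i] at hx'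
        rcases hx' with h2 | h2
        · exact absurd (Or.inl h2.1) h2.2
        · rcases h2.1 with h3 | h3
          · exact absurd h3 h2.2
          · refine ⟨hBB h3, ?_⟩
            by_contra h4
            exact h2.2 (hx fun h5 => h4 h5.le)
      · refine measure_mono ?_
        rw [hW'j j (Finset.ne_of_mem_erase hj)]
        rintro x (h2 | h2)
        · refine ⟨h2.1, hBB ?_⟩
          by_contra h3
          exact h2.2 ⟨h2.1, h3⟩
        · exact absurd h2.1.1 h2.2
    have h2 := (hL W W' hWt htuple).trans (mul_le_mul_right h1 _)
    have h3 : (L : ℝ≥0∞) * (2 * volume Z) = ENNReal.ofReal (2 * L * volume.real Z) := by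
      rw [ENNReal.ofReal_mul (by positivity), ENNReal.ofReal_mul (by norm_num), ENNReal.ofReal_coe_nnreal,
        Measure.real, ENNReal.ofReal_toReal hZfin]
      simp only [ENNReal.ofReal_ofNat]
      ring
    rw [h3, ENNReal.ofReal_le_ofReal_iff (by positivity)] at h2
    linarith [neg_abs_le (P.F W - P.F W')]
  rw [J_eq_sum_cost, J_eq_sum_cost, ← Finset.add_sum_erase _ _ (Finset.mem_univ i),
    ← Finset.add_sum_erase _ (fun j => P.cost j (u' j)) (Finset.mem_univ i), hu'i] at hle
  have hS : ∑ j ∈ Finset.univ.erase i, P.cost j (u' j) ≤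
      (∑ j ∈ Finset.univ.erase i, P.cost j (u j)) + E₁ * volume.real Z := by
    calc _ ≤ ∑ j ∈ Finset.univ.erase i,
          (P.cost j (u j) + E₁ * volume.real (W j ∩ ball y (2 * ρ))) :=
          Finset.sum_le_sum fun j hj => by
            rw [hu'j j (Finset.ne_of_mem_erase hj)]
            exact hcostj j (Finset.ne_of_mem_erase hj)
      _ = (∑ j ∈ Finset.univ.erase i, P.cost j (u j)) +
          E₁ * ∑ j ∈ Finset.univ.erase i, volume.real (W j ∩ ball y (2 * ρ)) := by
        rw [Finset.sum_add_distrib, Finset.mul_sum]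
      _ ≤ _ := by gcongr
  have e5 : (E₁ + 2 * L) * volume.real Z = E₁ * volume.real Z + 2 * L * volume.real Z := by ring
  rw [e5]
  linarith

end Comparison

/-! ### Choice of constants in the barrier argument. -/

theorem div_add_one_mul_le {a G : ℝ} (ha : 0 ≤ a) (hG : 0 < G) : G / (a + 1) * a ≤ G := by
  rw [div_mul_eq_mul_div, div_le_iff₀ (by positivity)]
  nlinarith

/-- For a suitable choice of constants, a function that is nondegenerate in `B(y, ρ)`, but small near
`y`, and whose negativity set is small, is not almost minimal. -/
theorem exists_forall_not_almostMinimal {n : ℕ} (hn : n ≠ 0) {cN M C₀ E₀ Kf Kg : ℝ} (hcN : 0 < cN)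
    (hM : 0 < M) (hC₀ : 0 ≤ C₀) (hE₀ : 0 ≤ E₀) (hKf : 0 ≤ Kf) (hKg : 0 ≤ Kg) :
    ∃ η > (0 : ℝ), ∃ ζ > (0 : ℝ), ∃ θ > (0 : ℝ), ∃ ρ₀ > (0 : ℝ), η ≤ 1 ∧ ρ₀ ≤ 1 ∧
      ∀ (y : EuclideanSpace ℝ (Fin n)) (ρ : ℝ), 0 < ρ → ρ ≤ ρ₀ → ∃ Φ : EuclideanSpace ℝ (Fin n) → ℝ,
        ContDiff ℝ ∞ Φ ∧ HasCompactSupport Φ ∧ (∀ x, x ∉ ball y ρ → Φ x = 0) ∧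
        ∀ {N : ℕ} {P : FBProblem n N} {j : Fin N} {v : EuclideanSpace ℝ (Fin n) → ℝ},
          P.BoundedOn (P.f j) Kf → P.BoundedOn (P.g j) Kg → MemW12 v →
          IntegrableOn (fun x => v x ^ 2 * P.f j x - v x * P.g j x) P.Ω volume →
          ContinuousOn v (ball y ρ) → (∀ x ∈ ball y ρ, |v x| ≤ M * ρ) →
          (∀ x ∈ ball y ρ, v x ≤ η * ρ + C₀ * dist x y) →
          cN * ρ ^ (n + 2) ≤ ∫ x in ball y (ρ / 2), posPartFun v x ^ 2 →
          volume.real {x ∈ ball y ρ | v x ≤ 0} ≤ ζ * ρ ^ n →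
          ¬ P.cost j v ≤ P.cost j (fun x => v x + θ * ρ * Φ x) + E₀ * ζ * ρ ^ n := by
  have hω := unitBallVolume_pos n
  obtain ⟨c, hc, H⟩ := exists_barrier n hn
  -- G is the left side of `barrier_inequality`; the errors are made to total at most 5G/8. The
  -- order of choice is κ, then s with A and K, then η, θ and ρ₀, and finally ζ, which has to absorb
  -- E₀/(2θ).
  set G := c * cN / M with hG
  have hG0 : 0 < G := by positivity
  obtain ⟨s, hs, hs2, hsκ, A, K, hA, hAs, hK, hbar⟩ :=
    H (G / 8 / ((1 + c) * unitBallVolume n * C₀ + 1)) (by positivity)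
  set κ := G / 8 / ((1 + c) * unitBallVolume n * C₀ + 1)
  have hκ : κ * ((1 + c) * unitBallVolume n * C₀) ≤ G / 8 :=
    div_add_one_mul_le (by positivity) (by positivity)
  have hη := div_add_one_mul_le (a := (A + c) * unitBallVolume n * s ^ n) (G := G / 8) (by positivity)
    (by positivity)
  set η := min 1 (G / 8 / ((A + c) * unitBallVolume n * s ^ n + 1)) with hηdef
  have hη0 : 0 < η := by positivity
  have hη' : η * ((A + c) * unitBallVolume n * s ^ n) ≤ G / 8 := by
    refine le_trans ?_ hη
    gcongr
    exact min_le_right _ _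
  have hθ := div_add_one_mul_le (a := unitBallVolume n / 2 * K ^ 2) (G := G / 8) (by positivity)
    (by positivity)
  set θ := min 1 (G / 8 / (unitBallVolume n / 2 * K ^ 2 + 1)) with hθdef
  have hθ0 : 0 < θ := by positivity
  have hθ' : θ * (unitBallVolume n / 2 * K ^ 2) ≤ G / 8 := by
    refine le_trans ?_ hθ
    gcongr
    exact min_le_right _ _
  set B := (2 * M * K + K ^ 2) * Kf + K * Kg with hB
  have hB0 : 0 ≤ B := by positivity
  have hρ₀ := div_add_one_mul_le (a := unitBallVolume n / 2 * B) (G := G / 8) (by positivity)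
    (by positivity)
  set ρ₀ := min 1 (G / 8 / (unitBallVolume n / 2 * B + 1)) with hρ₀def
  have hρ₀0 : 0 < ρ₀ := by positivity
  have hζ := div_add_one_mul_le (a := K * M + E₀ / (2 * θ)) (G := G / 8) (by positivity)
    (by positivity)
  set ζ := G / 8 / (K * M + E₀ / (2 * θ) + 1) with hζdef
  have hζ0 : 0 < ζ := by positivity
  refine ⟨η, hη0, ζ, hζ0, θ, hθ0, ρ₀, hρ₀0, min_le_left _ _, min_le_left _ _, fun y ρ hρ hρρ₀ => ?_⟩
  obtain ⟨Φ, L, hb⟩ := hbar y ρ hρ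
  refine ⟨Φ, hb.contDiff, hb.hasCompactSupport, hb.eq_zero, ?_⟩
  intro N P j v hf hg hv hconv hcont hvM hvm hN hZ hcost
  have key := barrier_inequality hf hg hKf hKg hb hv hconv hρ (hρρ₀.trans (min_le_left _ _)) hs hs2
    hc.le hA hK hcont hM (μ := η + C₀ * s) (by positivity) hθ0 (min_le_left _ _) hvM (fun x hx => ?_)
    hN hZ hcost
  -- On B(y, sρ) the Lipschitz growth contributes C₀s, and here the smallness of As^(n+1), rather
  -- than of As^n, is what counts.
  · have k1 : (A + c) * (η + C₀ * s) * (unitBallVolume n * s ^ n) ≤ G / 8 + G / 8 := by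
      have h1 : (A + c) * s ^ (n + 1) ≤ κ * (1 + c) := by
        have h2 : s ^ (n + 1) ≤ κ := (pow_le_of_le_one hs.le (by linarith) (by simp)).trans hsκ
        have h3 : c * s ^ (n + 1) ≤ c * κ := by gcongr
        linarith
      calc _ = η * ((A + c) * unitBallVolume n * s ^ n) +
            (A + c) * s ^ (n + 1) * (unitBallVolume n * C₀) := by ring
        _ ≤ G / 8 + κ * (1 + c) * (unitBallVolume n * C₀) := by gcongr
        _ ≤ _ := by linarith
    have k2 : unitBallVolume n / 2 * (θ * K ^ 2 + ρ * B) ≤ G / 8 + G / 8 := by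
      have h1 : ρ * (unitBallVolume n / 2 * B) ≤ G / 8 := by
        refine le_trans ?_ hρ₀
        gcongr
        exact hρρ₀.trans (min_le_right _ _)
      linarith
    have k3 : K * M * ζ + E₀ * ζ / (2 * θ) ≤ G / 8 := by
      calc _ = ζ * (K * M + E₀ / (2 * θ)) := by ring
        _ ≤ _ := hζ
    linarith
  · have h1 : s * ρ ≤ ρ := by nlinarith
    refine (hvm x (ball_subset_ball h1 hx)).trans ?_
    have h2 : C₀ * dist x y ≤ C₀ * (s * ρ) := by
      gcongr
      exact (mem_ball.1 hx).le
    linarith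

end FBProblem

/-! ### Growth inside the phase, and density of its complement. -/

namespace FBProblem

/-- Inside `{u > 0}`, the function `u` is at least proportional to the distance to the complement. -/
theorem exists_le_of_infEDist {n : ℕ} (hn : n ≠ 0) {lam Kf Kg : ℝ} {C₀ : ℝ≥0} (hlam : 0 < lam)
    (hKf : 0 ≤ Kf) (hKg : 0 ≤ Kg) : ∃ c₅ > (0 : ℝ), ∀ {N : ℕ} {P : FBProblem n N}
      {u : Fin N → EuclideanSpace ℝ (Fin n) → ℝ} {W : Fin N → Set (EuclideanSpace ℝ (Fin n))}
      {i : Fin N} {ε : ℝ}, P.IsGoodMinimizer u W i lam ε Kf Kg → 0 < ε → Continuous (u i) →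
      ∀ x ∈ P.posSet (u i),
        LipschitzOnWith C₀ (u i) (eball x (infEDist x (P.posSet (u i))ᶜ / 2)) →
        c₅ * (min (infEDist x (P.posSet (u i))ᶜ)
          (ENNReal.ofReal (min (ε ^ (1 / (n : ℝ))) 1))).toReal ≤ u i x := by
  obtain ⟨c, hc, hND⟩ := exists_nondegeneracy_near hn hlam hKf hKg
  -- E₀ = 0 because the sets W stay unchanged. M = 1 + C₀ comes from u ≤ ηρ + C₀ρ with η ≤ 1, and cN
  -- from nondegeneracy at radius ρ/2.
  obtain ⟨η, hη, ζ, hζ, θ, hθ, ρ₀, hρ₀, hη1, hρ₀1, H⟩ := exists_forall_not_almostMinimal hn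
    (cN := c / 2 ^ (n + 2)) (M := 1 + C₀) (C₀ := C₀) (E₀ := 0) (by positivity) (by positivity)
    C₀.coe_nonneg le_rfl hKf hKg
  -- With ρ = bd ≤ d/4, the ball B(x, ρ) lies in the positivity set and in the ball where u is
  -- Lipschitz.
  set b := min ρ₀ (1 / 4) with hb
  have hb0 : 0 < b := by positivity
  have hb4 : b ≤ 1 / 4 := min_le_right _ _
  refine ⟨η * b, by positivity, ?_⟩
  intro N P u W i ε h hε hcont x hx hlip
  set δ := infEDist x (P.posSet (u i))ᶜ with hδ
  set m := min (ε ^ (1 / (n : ℝ))) 1 with hm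
  set d := (min δ (ENNReal.ofReal m)).toReal with hd
  have hfin : min δ (ENNReal.ofReal m) ≠ ⊤ := ne_top_of_le_ne_top ENNReal.ofReal_ne_top (min_le_right _ _)
  have hm0 : 0 < m := by positivity
  have hdδ : ENNReal.ofReal d ≤ δ := by
    rw [hd, ENNReal.ofReal_toReal hfin]
    exact min_le_left _ _
  have hdm : d ≤ m := ENNReal.toReal_le_of_le_ofReal hm0.le (min_le_right _ _)
  by_contra hcon
  rw [not_le] at hcon
  have hux : 0 < u i x := hx.2
  have hd0 : 0 < d := by
    by_contra h0
    have : d = 0 := le_antisymm (not_lt.1 h0) ENNReal.toReal_nonneg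
    rw [this, mul_zero] at hcon
    exact lt_asymm hux hcon
  set ρ := b * d with hρ
  have hρ0 : 0 < ρ := by positivity
  have hρd : ρ ≤ d / 4 := by nlinarith
  have hd1 : d ≤ 1 := hdm.trans (min_le_right _ _)
  have hρρ₀ : ρ ≤ ρ₀ := (mul_le_of_le_one_right hb0.le hd1).trans (min_le_left _ _)
  have hball : ∀ z ∈ ball x ρ, z ∈ eball x (δ / 2) := by
    intro z hz
    have h1 : dist z x < d / 2 := (mem_ball.1 hz).trans_le (by linarith)
    rw [mem_eball, edist_dist]
    calc ENNReal.ofReal (dist z x) < ENNReal.ofReal (d / 2) :=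
          (ENNReal.ofReal_lt_ofReal_iff (by positivity)).2 h1
      _ = ENNReal.ofReal d / 2 := by
          rw [ENNReal.ofReal_div_of_pos (by norm_num), ENNReal.ofReal_ofNat]
      _ ≤ δ / 2 := by gcongr
  have hpos : ∀ z ∈ ball x ρ, z ∈ P.posSet (u i) := by
    intro z hz
    by_contra hz'
    have h1 : δ ≤ edist x z := infEDist_le_edist_of_mem hz'
    have h2 : edist z x < δ / 2 := hball z hz
    rw [edist_comm] at h2
    exact absurd (h2.trans_le ENNReal.half_le_self) (not_lt.2 h1)
  have huxη : u i x < η * ρ := by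
    rw [hρ]
    linarith
  have hlip' : ∀ z ∈ ball x ρ, u i z ≤ η * ρ + C₀ * dist z x := by
    intro z hz
    have h1 := hlip.dist_le_mul z (hball z hz) x (hball x (mem_ball_self hρ0))
    rw [Real.dist_eq] at h1
    linarith [le_abs_self (u i z - u i x)]
  obtain ⟨Φ, hΦ, hΦc, hΦ0, HΦ⟩ := H x ρ hρ0 hρρ₀
  have hmin := h.isMinimizer
  have hui := hmin.memW12 i
  obtain ⟨hw, hwconv, -⟩ := cost_add_mul h.boundedOn_f h.boundedOn_g hui (hmin.2.1 i) hΦ hΦc (θ * ρ)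
  refine HΦ h.boundedOn_f h.boundedOn_g hui (hmin.2.1 i) hcont.continuousOn (fun z hz => ?_) hlip' ?_ ?_ ?_
  · rw [abs_of_pos (hpos z hz).2]
    refine (hlip' z hz).trans ?_
    have h1 : C₀ * dist z x ≤ C₀ * ρ := by
      gcongr
      exact (mem_ball.1 hz).le
    have h2 : η * ρ ≤ 1 * ρ := by gcongr
    linarith
  · have h1 := hND h hε (x := x) (z := x) (r := ρ / 2) (by positivity) (by
      rw [min_comm]
      linarith) hcont.continuousOn (mem_ball_self (by positivity)) hux
    calc c / 2 ^ (n + 2) * ρ ^ (n + 2) = c * (ρ / 2) ^ (n + 2) := by rw [div_pow]; ring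
      _ ≤ _ := h1
      _ ≤ _ := hui.posPart.1.setIntegral_sq_mono (ball_subset_ball (by linarith))
  · have : {z ∈ ball x ρ | u i z ≤ 0} = ∅ := by
      refine Set.eq_empty_of_forall_notMem fun z hz => ?_
      exact not_lt.2 hz.2 (hpos z hz.1).2
    rw [this, measureReal_empty]
    positivity
  -- Adding a multiple of Φ is admissible for the same W: Φ lives where u > 0, which is a.e. inside
  -- `W i`.
  · have h1 := hmin.cost_add_le (i := i) hmin.1.1 hw ?_ (fun _ _ => le_rfl) hwconv
    · linarith
    · filter_upwards [(hmin.1.2 i).2] with z hz hzW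
      have h2 := hz hzW
      have h3 : z ∉ ball x ρ := fun h4 => (hpos z h4).2.ne' h2
      rw [h2, hΦ0 z h3]
      ring

/-- Lower density of `{u ≤ 0}` near a boundary point of `{u > 0}`. -/
theorem exists_density_compl {n : ℕ} (hn : n ≠ 0) {lam Kf Kg : ℝ} {L C₀ : ℝ≥0} (hlam : 0 < lam)
    (hKf : 0 ≤ Kf) (hKg : 0 ≤ Kg) (hC₀ : 0 < C₀) : ∃ c₆ > (0 : ℝ), ∀ ε > (0 : ℝ), ∃ r₀ > (0 : ℝ),
      ∀ {N : ℕ} {P : FBProblem n N} {u : Fin N → EuclideanSpace ℝ (Fin n) → ℝ}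
        {W : Fin N → Set (EuclideanSpace ℝ (Fin n))} {i : Fin N}, P.IsMinimizer u W →
        (∀ j, P.BoundedOn (P.f j) Kf) → (∀ j, P.BoundedOn (P.g j) Kg) → P.FLipschitz L →
        P.IsGoodIndex W i lam ε → ∀ {x : EuclideanSpace ℝ (Fin n)} {r : ℝ}, r ≤ r₀ →
        ball x r ⊆ P.Ω → (∀ j, LipschitzOnWith C₀ (u j) (ball x r)) →
        (ball x (r / 2) ∩ frontier (P.posSet (u i))).Nonempty →
        ENNReal.ofReal (c₆ * r ^ n) ≤ volume {y ∈ ball x r | u i y ≤ 0} := by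
  obtain ⟨c, hc, hND⟩ := exists_nondegeneracy_near hn hlam hKf hKg
  obtain ⟨C, hC, hcut⟩ := exists_isCutoffConstant
  have hC₀' : (0 : ℝ) < C₀ := hC₀
  -- This is the constant of `IsMinimizer.cost_le_of_ball`, the price per unit of |{u ≤ 0}|.
  set E₀ := (12 * C ^ 2 + Kf) * (4 * (C₀ : ℝ) ^ 2) + 2 * Kg * C₀ + 2 * L with hE₀
  have hE₀0 : 0 ≤ E₀ := by positivity
  obtain ⟨η, hη, ζ, hζ, θ, hθ, ρ₀, hρ₀, hη1, hρ₀1, H⟩ := exists_forall_not_almostMinimal hn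
    (cN := c / 2 ^ (n + 2)) (M := C₀) (C₀ := C₀) (by positivity) hC₀' hC₀'.le hE₀0 hKf hKg
  refine ⟨ζ / 4 ^ n, by positivity, fun ε hε => ⟨min ρ₀ (ε ^ (1 / (n : ℝ))), by positivity, ?_⟩⟩
  intro N P u W i hmin hf hg hL hgood x r hr hΩ hlip ⟨y, hy, hyf⟩
  have h : P.IsGoodMinimizer u W i lam ε Kf Kg := ⟨hmin, hf i, hg i, hgood⟩
  have hyx : dist y x < r / 2 := hy
  have hr0 : 0 < r := by linarith [dist_nonneg (x := y) (y := x)]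
  -- B(y, 2ρ), on which the other phases are cut off, must fit in B(x, r) although y is only known
  -- to lie in B(x, r/2). This is also the origin of 4^n in c₆.
  obtain ⟨ρ, hρ⟩ : ∃ ρ, ρ = r / 4 := ⟨_, rfl⟩
  have hρ0 : 0 < ρ := by rw [hρ]; positivity
  have hrρ : r = 4 * ρ := by rw [hρ]; ring
  have hb2 : ball y (2 * ρ) ⊆ ball x r := ball_subset_ball' (by linarith)
  have hb1 : ball y ρ ⊆ ball x r := (ball_subset_ball (by linarith)).trans hb2
  have hρρ₀ : ρ ≤ ρ₀ := by linarith [min_le_left ρ₀ (ε ^ (1 / (n : ℝ)))]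
  have hρε : ρ / 2 ≤ ε ^ (1 / (n : ℝ)) := by linarith [min_le_right ρ₀ (ε ^ (1 / (n : ℝ)))]
  have hcont : ∀ j, ContinuousOn (u j) (ball x r) := fun j => (hlip j).continuousOn
  have hyr : y ∈ ball x r := hb1 (mem_ball_self hρ0)
  -- All components vanish at y, so each is at most C₀ times the distance to y; this bounds both the
  -- good component and the cutoff errors of the others.
  have hzero : ∀ j, u j y = 0 := by
    intro j
    by_cases hj : j = i
    · rw [hj]
      exact eq_zero_of_mem_frontier_posSet (hcont i) (fun a ha ha' => absurd (hΩ ha) ha') hyr hyf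
    · exact hmin.eq_zero_of_mem_frontier hcont hyr hyf hj
  have hbound : ∀ j, ∀ a ∈ ball x r, |u j a| ≤ C₀ * dist a y := by
    intro j a ha
    have := (hlip j).dist_le_mul a ha y hyr
    rwa [hzero j, Real.dist_0_eq_abs] at this
  set Z := {y ∈ ball x r | u i y ≤ 0} with hZ
  have hZfin : volume Z ≠ ⊤ := ne_top_of_le_ne_top measure_ball_lt_top.ne
    (measure_mono fun a (ha : a ∈ Z) => ha.1)
  rw [ENNReal.ofReal_le_iff_le_toReal hZfin]
  by_contra hcon
  rw [not_le] at hcon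
  have hZs : volume.real Z ≤ ζ * ρ ^ n := by
    refine hcon.le.trans (le_of_eq ?_)
    rw [hρ, div_pow]
    ring
  obtain ⟨Φ, hΦ, hΦc, hΦ0, HΦ⟩ := H y ρ hρ0 hρρ₀
  have hui := hmin.memW12 i
  obtain ⟨hw, hwconv, -⟩ := cost_add_mul (hf i) (hg i) hui (hmin.2.1 i) hΦ hΦc (θ * ρ)
  refine HΦ (hf i) (hg i) hui (hmin.2.1 i) ((hcont i).mono hb1) (fun a ha => ?_) (fun a ha => ?_) ?_ ?_ ?_
  · refine (hbound i a (hb1 ha)).trans ?_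
    gcongr
    exact (mem_ball.1 ha).le
  · have h1 := (le_abs_self _).trans (hbound i a (hb1 ha))
    have h2 : 0 ≤ η * ρ := by positivity
    linarith
  · obtain ⟨z, hz, hzpos⟩ := exists_mem_posSet (isOpen_ball (x := y) (ε := ρ / 2 / 2))
      ⟨y, mem_ball_self (by positivity), hyf⟩
    have h1 := hND h hε (x := y) (z := z) (r := ρ / 2) (by positivity)
      (le_min (by linarith) hρε)
      ((hcont i).mono ((ball_subset_ball (by linarith)).trans hb1)) hz hzpos
    calc c / 2 ^ (n + 2) * ρ ^ (n + 2) = c * (ρ / 2) ^ (n + 2) := by rw [div_pow]; ring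
      _ ≤ _ := h1
      _ ≤ _ := hui.posPart.1.setIntegral_sq_mono (ball_subset_ball (by linarith))
  · refine (measureReal_mono ?_ hZfin).trans hZs
    exact fun a ha => ⟨hb1 ha.1, ha.2⟩
  · refine (hmin.cost_le_of_ball hf hg hKf hKg hL hcut hC₀'.le hρ0 (hρρ₀.trans hρ₀1) (hb1.trans hΩ)
      (fun j _ a ha => ?_) hw ?_ hwconv).trans ?_
    · refine (hbound j a (hb2 ha)).trans ?_
      calc C₀ * dist a y ≤ C₀ * (2 * ρ) := by
            gcongr
            exact (mem_ball.1 ha).le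
        _ = _ := by ring
    · filter_upwards [(hmin.1.2 i).2] with a ha haW
      rw [ha fun h' => haW (Or.inl h'), hΦ0 a fun h' => haW (Or.inr h')]
      ring
    · have h1 : volume.real {a ∈ ball y (2 * ρ) | u i a ≤ 0} ≤ ζ * ρ ^ n := by
        refine (measureReal_mono ?_ hZfin).trans hZs
        exact fun a ha => ⟨hb2 ha.1, ha.2⟩
      rw [mul_assoc E₀]
      gcongr

theorem BoundedOn.mono {n N : ℕ} {P : FBProblem n N} {h : EuclideanSpace ℝ (Fin n) → ℝ} {K K' : ℝ}
    (hh : P.BoundedOn h K) (hK : K ≤ K') : P.BoundedOn h K' :=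
  ⟨hh.1, hh.2.mono fun _ hx => hx.trans hK⟩

end FBProblem

/-! ### Assembly of the four statements. -/

theorem theorem13p1 (n : ℕ) (hn : 2 ≤ n) :
    -- lower bounds for the size of `u₊` and for the density of `{u > 0}`
    (∀ lam Kf Kg Lam : ℝ, 0 < lam →
      ∃ c₁ > (0 : ℝ), ∃ c₂ > (0 : ℝ),
        ∀ (N : ℕ) (P : FBProblem n N) (u : Fin N → EuclideanSpace ℝ (Fin n) → ℝ)
          (W : Fin N → Set (EuclideanSpace ℝ (Fin n))) (i : Fin N) (ε : ℝ),
          P.IsMinimizer u W → P.BoundedOn (P.f i) Kf → P.BoundedOn (P.g i) Kg →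
          0 < ε → P.IsGoodIndex W i lam ε →
          ∀ (x : EuclideanSpace ℝ (Fin n)) (r : ℝ), 0 < r →
            (∀ j, ContinuousOn (u j) (Metric.ball x r)) →
            r ≤ min 1 (ε ^ (1 / (n : ℝ))) →
            (Metric.ball x (r / 2) ∩ frontier (P.posSet (u i))).Nonempty →
            ⨍ y in Metric.ball x r, ‖weakGrad (posPartFun (u i)) y‖ ^ 2 ≤ Lam →
            c₁ * r ^ 2 ≤ ⨍ y in Metric.ball x r, posPartFun (u i) y ^ 2 ∧
            ENNReal.ofReal (c₂ * r ^ n) ≤ volume (P.posSet (u i) ∩ Metric.ball x r)) ∧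
    -- lower bound for the gradient
    (∀ (lam Kf Kg : ℝ) (C₀ : ℝ≥0), 0 < lam → 0 < C₀ →
      ∃ c₃ > (0 : ℝ),
        ∀ (N : ℕ) (P : FBProblem n N) (u : Fin N → EuclideanSpace ℝ (Fin n) → ℝ)
          (W : Fin N → Set (EuclideanSpace ℝ (Fin n))) (i : Fin N) (ε : ℝ),
          P.IsMinimizer u W → P.BoundedOn (P.f i) Kf → P.BoundedOn (P.g i) Kg →
          0 < ε → P.IsGoodIndex W i lam ε →
          ∀ (x : EuclideanSpace ℝ (Fin n)) (r : ℝ), 0 < r →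
            (∀ j, ContinuousOn (u j) (Metric.ball x r)) →
            r ≤ min 1 (ε ^ (1 / (n : ℝ))) →
            (Metric.ball x (r / 2) ∩ frontier (P.posSet (u i))).Nonempty →
            ((LipschitzOnWith C₀ (u i) (Metric.ball x r) ∧
                ∀ y ∈ Metric.ball x r, y ∉ P.Ω → u i y = 0) ∨
              ENNReal.ofReal ((C₀ : ℝ)⁻¹ * r ^ n) ≤
                volume (Metric.ball x r \ P.posSet (u i))) →
            c₃ ≤ ⨍ y in Metric.ball x r, ‖weakGrad (posPartFun (u i)) y‖ ^ 2) ∧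
    -- comparison with the distance to the complement of `{u > 0}`
    (∀ (lam Kf Kg : ℝ) (C₀ : ℝ≥0), 0 < lam → 1 ≤ C₀ →
      ∃ c₅ > (0 : ℝ),
        ∀ (N : ℕ) (P : FBProblem n N) (u : Fin N → EuclideanSpace ℝ (Fin n) → ℝ)
          (W : Fin N → Set (EuclideanSpace ℝ (Fin n))) (i : Fin N) (ε : ℝ),
          P.IsMinimizer u W → P.BoundedOn (P.f i) Kf → P.BoundedOn (P.g i) Kg →
          0 < ε → P.IsGoodIndex W i lam ε → Continuous (u i) →
          ∀ x ∈ P.posSet (u i),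
            LipschitzOnWith C₀ (u i)
              (Metric.eball x (Metric.infEDist x (P.posSet (u i))ᶜ / 2)) →
            c₅ * (min (Metric.infEDist x (P.posSet (u i))ᶜ)
              (ENNReal.ofReal (min (ε ^ (1 / (n : ℝ))) 1))).toReal ≤ u i x) ∧
    -- lower density of the complement of `{u > 0}`
    (∀ (lam Kf Kg : ℝ) (L C₀ : ℝ≥0), 0 < lam → 1 ≤ C₀ →
      ∃ c₆ > (0 : ℝ), ∀ ε > (0 : ℝ), ∃ r₀ > (0 : ℝ),
        ∀ (N : ℕ) (P : FBProblem n N) (u : Fin N → EuclideanSpace ℝ (Fin n) → ℝ)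
          (W : Fin N → Set (EuclideanSpace ℝ (Fin n))) (i : Fin N),
          P.IsMinimizer u W →
          (∀ j, P.BoundedOn (P.f j) Kf) → (∀ j, P.BoundedOn (P.g j) Kg) →
          P.FLipschitz L → P.IsGoodIndex W i lam ε →
          ∀ (x : EuclideanSpace ℝ (Fin n)) (r : ℝ), 0 ≤ r → r ≤ r₀ →
            Metric.ball x r ⊆ P.Ω →
            (∀ j, LipschitzOnWith C₀ (u j) (Metric.ball x r)) →
            (Metric.ball x (r / 2) ∩ frontier (P.posSet (u i))).Nonempty →
            ENNReal.ofReal (c₆ * r ^ n) ≤ volume {y ∈ Metric.ball x r | u i y ≤ 0}) := by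
  have hn0 : n ≠ 0 := by omega
  -- The bounds Kf, Kg and Lam may be negative here, whereas the lemmas assume them nonnegative.
  have hmax : ∀ K : ℝ, K ≤ max K 0 := fun K => le_max_left _ _
  have hmax0 : ∀ K : ℝ, 0 ≤ max K 0 := fun K => le_max_right _ _
  refine ⟨fun lam Kf Kg Lam hlam => ?_, fun lam Kf Kg C₀ hlam hC₀ => ?_, fun lam Kf Kg C₀ hlam _ => ?_,
    fun lam Kf Kg L C₀ hlam hC₀ => ?_⟩
  · obtain ⟨c₁, hc₁, c₂, hc₂, H⟩ := FBProblem.exists_density_bounds hn0 hlam (hmax0 Kf) (hmax0 Kg)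
      (hmax0 Lam)
    refine ⟨c₁, hc₁, c₂, hc₂, ?_⟩
    intro N P u W i ε hmin hf hg hε hgood x r hr hc hrε hfr hL
    exact H ⟨hmin, hf.mono (hmax _), hg.mono (hmax _), hgood⟩ hε hr (hc i) hrε hfr (hL.trans (hmax _))
  · obtain ⟨c₃, hc₃, H⟩ := FBProblem.exists_gradient_bound hn0 hlam (hmax0 Kf) (hmax0 Kg) hC₀
    refine ⟨c₃, hc₃, ?_⟩
    intro N P u W i ε hmin hf hg hε hgood x r hr hc hrε hfr hor
    exact H ⟨hmin, hf.mono (hmax _), hg.mono (hmax _), hgood⟩ hε hr (hc i) hrε hfr hor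
  · obtain ⟨c₅, hc₅, H⟩ := FBProblem.exists_le_of_infEDist hn0 hlam (hmax0 Kf) (hmax0 Kg) (C₀ := C₀)
    refine ⟨c₅, hc₅, ?_⟩
    intro N P u W i ε hmin hf hg hε hgood hc x hx hlip
    exact H ⟨hmin, hf.mono (hmax _), hg.mono (hmax _), hgood⟩ hε hc x hx hlip
  · obtain ⟨c₆, hc₆, H⟩ := FBProblem.exists_density_compl hn0 hlam (hmax0 Kf) (hmax0 Kg) (L := L)
      (zero_lt_one.trans_le hC₀)
    refine ⟨c₆, hc₆, fun ε hε => ?_⟩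
    obtain ⟨r₀, hr₀, H⟩ := H ε hε
    refine ⟨r₀, hr₀, ?_⟩
    intro N P u W i hmin hf hg hL hgood x r _ hr hΩ hlip hfr
    exact H hmin (fun j => (hf j).mono (hmax _)) (fun j => (hg j).mono (hmax _)) hL hgood hr hΩ hlip hfr
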